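/- Fix $0<\alpha\le\beta<1$, $A>0$, $B>0$, $T>0$ and a measurable function $\gamma:[0,1]\to[0,1]$. Let $\mathscr M$ be the set of non-negative measures on $[0,1]$ with total mass at most $1$, endowed with the weak topology, and let $D([0,T],\mathscr M)$ be the space of right-continuous functions $[0,T]\to\mathscr M$ with left limits, endowed with the Skorohod topology. Let $\mathscr M_{\rm ac}\subset\mathscr M$ be the set of measures $g(x)\,dx$ with $0\le g\le 1$. For a path $\pi(t,dx)=u(t,x)\,dx$ in $D([0,T],\mathscr M_{\rm ac})$ define the energy $$\mathcal Q_{[0,T]}(u)=\sup_G\Big\{\int_0^T\!\!\int_0^1 u\,\partial_xG\,dx\,dt-\frac12\int_0^T\!\!\int_0^1 G^2\,dx\,dt\Big\},$$ the supremum being over smooth functions $G:[0,T]\times(0,1)\to\mathbb R$ with compact support, and let $D_{\mathcal E}$ be the set of paths in $D([0,T],\mathscr M_{\rm ac})$ with finite energy. For $\pi=u\,dx\in D_{\mathcal E}$, for almost every $t$ the function $u_t=u(t,\cdot)$ has a continuous version, and $u_t(0),u_t(1)$ denote its boundary values. Let $\sigma(a)=a(1-a)$ and $$\mathfrak b_{\varrho,D}(a,M)=\frac1D\big\{(1-a)\varrho\,(e^M-1)+a(1-\varrho)(e^{-M}-1)\big\}.$$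 For $H\in C^{1,2}([0,T]\times[0,1])$ (that is, $H,\partial_tH,\partial_xH,\partial_x^2H$ exist and are continuous up to the boundary) and $\pi=u\,dx\in D_{\mathcal E}$ let, with $\langle f,g\rangle=\int_0^1 fg\,dx$, $$\begin{aligned}J_{T,H}(\pi)={}&\langle u_T,H_T\rangle-\langle u_0,H_0\rangle-\int_0^T\langle u_t,\partial_tH_t\rangle\,dt-\int_0^T\langle u_t,\partial_x^2H_t\rangle\,dt\\&+\int_0^Tu_t(1)\,\partial_xH_t(1)\,dt-\int_0^Tu_t(0)\,\partial_xH_t(0)\,dt-\int_0^T\langle\sigma(u_t),(\partial_xH_t)^2\rangle\,dt\\&-\int_0^T\big\{\mathfrak b_{\alpha,A}(u_t(0),H_t(0))+\mathfrak b_{\beta,B}(u_t(1),H_t(1))\big\}\,dt,\end{aligned}$$ and let $J_{T,H}(\pi)=+\infty$ for $\pi\notin D_{\mathcal E}$. Put $I_{[0,T]}(\pi)=\sup_{H\in C^{1,2}([0,T]\times[0,1])}J_{T,H}(\pi)$, and let $I_{[0,T]}(\pi|\gamma)=I_{[0,T]}(\pi)$ if $\pi(0,dx)$ has density $\gamma$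 (almost everywhere), and $I_{[0,T]}(\pi|\gamma)=+\infty$ otherwise. Then $I_{[0,T]}(\,\cdot\,|\gamma)$ takes values in $[0,\infty]$ on $D([0,T],\mathscr M)$, it is convex, it is lower semicontinuous, and it has compact level sets: for every $q\in\mathbb R$ the set $\{\pi\in D([0,T],\mathscr M): I_{[0,T]}(\pi|\gamma)\le q\}$ is compact. -/

import Mathlib

open Set Filter Topology MeasureTheory
open scoped NNReal ENNReal ContDiff

noncomputable section

namespace RobinExclusion

/-! ### The Skorohod space `D([0,T], X)` -/

/-- Right-continuous functions `[0,T] → X` with left limits. One-sided neighbourhoods are taken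
inside `[0,T]`, so there is no condition from the left at `0` and none from the right at `T`. -/
structure SkorohodPath (T : ℝ) (X : Type*) [TopologicalSpace X] where
  toFun : Icc (0 : ℝ) T → X
  right_continuous : ∀ t, ContinuousWithinAt toFun (Ici t) t
  left_limit : ∀ t, ∃ l, Tendsto toFun (𝓝[<] t) (𝓝 l)

instance {T : ℝ} {X : Type*} [TopologicalSpace X] :
    CoeFun (SkorohodPath T X) (fun _ => Icc (0 : ℝ) T → X) := ⟨SkorohodPath.toFun⟩

/-- `y` belongs to the Skorohod neighbourhood of `x` of size `ε` in time and `V` in space: up to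
an increasing time change `l` of `[0,T]` that moves no point by `ε` or more, the paths `x` and `y`
are uniformly `V`-close. For a metric space `X` and `V = {p | dist p.1 p.2 < ε}` this is
`sup_t |l t - t| < ε`, `sup_t dist (x t) (y (l t)) < ε` (up to strictness of the inequalities). -/
def SkorohodClose {T : ℝ} {X : Type*} [UniformSpace X] (ε : ℝ) (V : Set (X × X))
    (x y : SkorohodPath T X) : Prop :=
  ∃ l : Icc (0 : ℝ) T ≃o Icc (0 : ℝ) T,
    (∀ t, |(l t : ℝ) - t| < ε) ∧ ∀ t, (x t, y (l t)) ∈ V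

/-- The Skorohod (J1) topology on `D([0,T], X)`. For a metric space `X` this is the topology of
the metric `d(x, y) = inf_l max (sup_t |l t - t|, sup_t dist (x t) (y (l t)))`. -/
instance {T : ℝ} {X : Type*} [UniformSpace X] : TopologicalSpace (SkorohodPath T X) where
  IsOpen U := ∀ x ∈ U, ∃ ε > 0, ∃ V ∈ uniformity X, ∀ y, SkorohodClose ε V x y → y ∈ U
  isOpen_univ := fun _ _ => ⟨1, one_pos, univ, univ_mem, fun _ _ => mem_univ _⟩
  isOpen_inter := by
    rintro U W hU hW x ⟨hxU, hxW⟩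
    obtain ⟨ε, hε, V, hV, h⟩ := hU x hxU
    obtain ⟨ε', hε', V', hV', h'⟩ := hW x hxW
    refine ⟨min ε ε', lt_min hε hε', V ∩ V', inter_mem hV hV', ?_⟩
    rintro y ⟨l, hl, hy⟩
    exact ⟨h y ⟨l, fun t => (hl t).trans_le (min_le_left _ _), fun t => (hy t).1⟩,
      h' y ⟨l, fun t => (hl t).trans_le (min_le_right _ _), fun t => (hy t).2⟩⟩
  isOpen_sUnion := by
    rintro S hS x ⟨U, hUS, hxU⟩
    obtain ⟨ε, hε, V, hV, h⟩ := hS U hUS x hxU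
    exact ⟨ε, hε, V, hV, fun y hy => ⟨U, hUS, h y hy⟩⟩

/-! ### Measures on `[0,1]` of mass at most one -/

/-- Nonnegative measures on `[0,1]` with total mass at most `1`. -/
structure SubMeasure where
  fin : FiniteMeasure unitInterval
  mass_le : fin.mass ≤ 1

namespace SubMeasure

/-- The underlying measure. -/
def meas (π : SubMeasure) : Measure unitInterval := (π.fin : Measure unitInterval)

/-- The pairings `F ↦ ∫ F dπ` with continuous functions. -/
def pairing (π : SubMeasure) (F : C(unitInterval, ℝ)) : ℝ := ∫ x, F x ∂π.meas

/-- The weak topology, as the subspace topology of Mathlib's topology of weak convergence of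
finite measures. -/
abbrev weakTopology : TopologicalSpace SubMeasure := TopologicalSpace.induced fin inferInstance

theorem weakTopology_eq : weakTopology = TopologicalSpace.induced pairing inferInstance := by
  let _ : TopologicalSpace SubMeasure := weakTopology
  have hfin : IsInducing fin := ⟨rfl⟩
  refine IsInducing.eq_induced (f := pairing) ?_
  rw [isInducing_iff_nhds]
  intro π
  have key : ∀ f : Filter SubMeasure, f ≤ 𝓝 π ↔ Tendsto pairing f (𝓝 (pairing π)) := by
    intro f
    have h1 : f ≤ 𝓝 π ↔ Tendsto fin f (𝓝 π.fin) := by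
      rw [hfin.nhds_eq_comap, tendsto_iff_comap]
    rw [h1, FiniteMeasure.tendsto_iff_forall_integral_tendsto, tendsto_pi_nhds]
    constructor
    · intro h F
      exact h (BoundedContinuousFunction.mkOfCompact F)
    · intro h F
      exact h F.toContinuousMap
  apply le_antisymm
  · exact tendsto_iff_comap.1 ((key _).1 le_rfl)
  · exact (key _).2 tendsto_comap

/-- The uniform structure of the weak topology: the coarsest one for which all pairings with
continuous functions are uniformly continuous. Its topology is `weakTopology`. Since the space is
compact and Hausdorff, this is the only uniform structure compatible with that topology; in
particular it is the one given by any metric that induces the weak topology. -/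
instance : UniformSpace SubMeasure :=
  @UniformSpace.replaceTopology _ weakTopology (UniformSpace.comap pairing inferInstance)
    weakTopology_eq

theorem isInducing_fin : IsInducing fin := ⟨rfl⟩

/-- The convex combination `a π + b ν`. -/
def comb (a b : ℝ≥0) (hab : a + b = 1) (π ν : SubMeasure) : SubMeasure :=
  ⟨a • π.fin + b • ν.fin, by
    have h : (a • π.fin + b • ν.fin).mass = a * π.fin.mass + b * ν.fin.mass := by
      rw [FiniteMeasure.mass, FiniteMeasure.coeFn_add, Pi.add_apply,
        FiniteMeasure.coeFn_smul, FiniteMeasure.coeFn_smul]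
      rfl
    calc (a • π.fin + b • ν.fin).mass = a * π.fin.mass + b * ν.fin.mass := h
      _ ≤ a * 1 + b * 1 := by gcongr <;> exact mass_le _
      _ = 1 := by rw [mul_one, mul_one, hab]⟩

theorem tendsto_comb (a b : ℝ≥0) (hab : a + b = 1) {ι : Type*} {F : Filter ι}
    {f g : ι → SubMeasure} {l m : SubMeasure} (hf : Tendsto f F (𝓝 l)) (hg : Tendsto g F (𝓝 m)) :
    Tendsto (fun i => comb a b hab (f i) (g i)) F (𝓝 (comb a b hab l m)) := by
  rw [isInducing_fin.tendsto_nhds_iff] at hf hg ⊢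
  exact (hf.const_smul a).add (hg.const_smul b)

/-- `π(dx) = g(x) dx` with `0 ≤ g ≤ 1`. -/
def IsAC (π : SubMeasure) : Prop :=
  ∃ g : unitInterval → ℝ, Measurable g ∧ (∀ x, g x ∈ Icc (0 : ℝ) 1) ∧
    π.meas = volume.withDensity (fun x => ENNReal.ofReal (g x))

/-- The density of `π` with respect to the Lebesgue measure on `[0,1]`. -/
def density (π : SubMeasure) (x : unitInterval) : ℝ := (π.meas.rnDeriv volume x).toReal

end SubMeasure

/-- Paths in `D([0,T], M)`. -/
abbrev MPath (T : ℝ) : Type := SkorohodPath T SubMeasure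

namespace MPath

variable {T : ℝ}

/-- The convex combination `(a π + b ν)(t) = a π(t) + b ν(t)` of paths. -/
def comb (a b : ℝ≥0) (hab : a + b = 1) (π ν : MPath T) : MPath T where
  toFun t := SubMeasure.comb a b hab (π t) (ν t)
  right_continuous t :=
    SubMeasure.tendsto_comb a b hab (π.right_continuous t) (ν.right_continuous t)
  left_limit t := by
    obtain ⟨l, hl⟩ := π.left_limit t
    obtain ⟨m, hm⟩ := ν.left_limit t
    exact ⟨SubMeasure.comb a b hab l m, SubMeasure.tendsto_comb a b hab hl hm⟩

end MPath

/-! ### The energy -/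

/-- Smooth functions `G : [0,T] × (0,1) → ℝ` with compact support (values outside
`[0,T] × (0,1)` are irrelevant). -/
structure EnergyTest (T : ℝ) where
  toFun : ℝ → ℝ → ℝ
  smooth : ContDiffOn ℝ ∞ (fun p : ℝ × ℝ => toFun p.1 p.2) (Icc 0 T ×ˢ Ioo 0 1)
  compact_support : ∃ K : Set (ℝ × ℝ), IsCompact K ∧ K ⊆ Icc 0 T ×ˢ Ioo 0 1 ∧
    ∀ p ∈ Icc 0 T ×ˢ Ioo (0 : ℝ) 1, p ∉ K → toFun p.1 p.2 = 0

variable {T : ℝ}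

/-- The Lebesgue measure on `[0,T]`. -/
def leb (T : ℝ) : Measure (Icc (0 : ℝ) T) := (volume : Measure ℝ).comap (↑)

/-- `∫₀ᵀ ∫₀¹ u ∇G dx dt - ½ ∫₀ᵀ ∫₀¹ G² dx dt`, where `π(t,dx) = u(t,x) dx`. -/
def energyFunctional (G : EnergyTest T) (π : MPath T) : ℝ :=
  (∫ t, (∫ x, (π t).density x * deriv (G.toFun t) x) ∂leb T)
    - (1 / 2) * ∫ t : Icc (0 : ℝ) T, (∫ x : unitInterval, (G.toFun t x) ^ 2) ∂leb T

/-- The energy of a path with values in the absolutely continuous measures. -/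
def energy (π : MPath T) : EReal := ⨆ G : EnergyTest T, (energyFunctional G π : EReal)

/-- The paths `π(t,dx) = u(t,x) dx`, `0 ≤ u ≤ 1`, with finite energy. (The set of measures with
density in `[0,1]` is weakly closed, so left limits need not be mentioned.) -/
def HasFiniteEnergy (π : MPath T) : Prop := (∀ t, (π t).IsAC) ∧ energy π < ⊤

/-! ### The rate functional -/

/-- Functions `H : [0,T] × [0,1] → ℝ` of class `C^{1,2}`, together with the derivatives
`∂ₜH`, `∇H`, `ΔH`, all continuous on `[0,T] × [0,1]` (values outside are irrelevant). -/
structure C12 (T : ℝ) where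
  toFun : ℝ → ℝ → ℝ
  dt : ℝ → ℝ → ℝ
  dx : ℝ → ℝ → ℝ
  dxx : ℝ → ℝ → ℝ
  hasDeriv_dt : ∀ t ∈ Icc 0 T, ∀ x ∈ Icc (0 : ℝ) 1,
    HasDerivWithinAt (fun s => toFun s x) (dt t x) (Icc 0 T) t
  hasDeriv_dx : ∀ t ∈ Icc 0 T, ∀ x ∈ Icc (0 : ℝ) 1,
    HasDerivWithinAt (toFun t) (dx t x) (Icc 0 1) x
  hasDeriv_dxx : ∀ t ∈ Icc 0 T, ∀ x ∈ Icc (0 : ℝ) 1,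
    HasDerivWithinAt (dx t) (dxx t x) (Icc 0 1) x
  cont : ContinuousOn (fun p : ℝ × ℝ => toFun p.1 p.2) (Icc 0 T ×ˢ Icc 0 1)
  cont_dt : ContinuousOn (fun p : ℝ × ℝ => dt p.1 p.2) (Icc 0 T ×ˢ Icc 0 1)
  cont_dx : ContinuousOn (fun p : ℝ × ℝ => dx p.1 p.2) (Icc 0 T ×ˢ Icc 0 1)
  cont_dxx : ContinuousOn (fun p : ℝ × ℝ => dxx p.1 p.2) (Icc 0 T ×ˢ Icc 0 1)

/-- `(1/D) {(1-a) ϱ (e^M - 1) + a (1-ϱ) (e^{-M} - 1)}`. -/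
def bdry (ϱ D a M : ℝ) : ℝ :=
  (1 / D) * ((1 - a) * ϱ * (Real.exp M - 1) + a * (1 - ϱ) * (Real.exp (-M) - 1))

/-- The mobility. -/
def mobility (a : ℝ) : ℝ := a * (1 - a)

open Classical in
/-- The value at `x` of the continuous version of `u : [0,1] → ℝ` (which is unique), and `0` if
there is none. Along a path of finite energy almost every `u_t` has a continuous version. -/
def contValue (u : unitInterval → ℝ) (x : unitInterval) : ℝ :=
  if h : ∃ w : C(unitInterval, ℝ), u =ᵐ[volume] w then h.choose x else 0

/-- The time `0` in `[0,T]`. -/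
def timeZero (hT : 0 < T) : Icc (0 : ℝ) T := ⟨0, left_mem_Icc.2 hT.le⟩

/-- The time `T` in `[0,T]`. -/
def timeEnd (hT : 0 < T) : Icc (0 : ℝ) T := ⟨T, right_mem_Icc.2 hT.le⟩

/-- The functional `J_{T,H}` on paths of finite energy, with `u_t = (π t).density`. -/
def JReal (α A β B : ℝ) (hT : 0 < T) (H : C12 T) (π : MPath T) : ℝ :=
  (∫ x : unitInterval, (π (timeEnd hT)).density x * H.toFun T x)
    - (∫ x : unitInterval, (π (timeZero hT)).density x * H.toFun 0 x)
    - (∫ t, (∫ x : unitInterval, (π t).density x * H.dt t x) ∂leb T)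
    - (∫ t, (∫ x : unitInterval, (π t).density x * H.dxx t x) ∂leb T)
    + (∫ t, contValue (π t).density 1 * H.dx t 1 ∂leb T)
    - (∫ t, contValue (π t).density 0 * H.dx t 0 ∂leb T)
    - (∫ t, (∫ x : unitInterval, mobility ((π t).density x) * (H.dx t x) ^ 2) ∂leb T)
    - (∫ t,
        (bdry α A (contValue (π t).density 0) (H.toFun t 0)
          + bdry β B (contValue (π t).density 1) (H.toFun t 1)) ∂leb T)

open Classical in
/-- `J_{T,H}` on `D([0,T], M)`, equal to `+∞` off the paths of finite energy. -/
def J (α A β B : ℝ) (hT : 0 < T) (H : C12 T) (π : MPath T) : EReal :=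
  if HasFiniteEnergy π then (JReal α A β B hT H π : EReal) else ⊤

/-- `I_{[0,T]}(π) = sup_H J_{T,H}(π)`. -/
def rate (α A β B : ℝ) (hT : 0 < T) (π : MPath T) : EReal := ⨆ H : C12 T, J α A β B hT H π

open Classical in
/-- `I_{[0,T]}(π | γ)`. -/
def rateFrom (α A β B : ℝ) (hT : 0 < T) (γ : unitInterval → unitInterval) (π : MPath T) :
    EReal :=
  if (π (timeZero hT)).density =ᵐ[volume] (fun x => (γ x : ℝ)) then rate α A β B hT π else ⊤

end RobinExclusion

end

noncomputable section

namespace RobinExclusion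

/-! ### Cosine polynomials on the unit interval -/

/-! The analysis runs through the cosine coefficients c_n(t) = ∫ cos(nπx) π_t(dx). They determine
the weak uniformity on measures of mass at most one, and a cosine polynomial in x has zero
derivative at 0 and 1, so as a test function it makes the terms u(0)∂ₓH(0) and u(1)∂ₓH(1) vanish.

Two choices of H give a priori bounds on the paths of rate at most q. For H = l θ(t) cos(nπx), with
θ a smoothed indicator of [s,t], one gets l (c_n(t) − c_n(s)) ≤ q + C(n,|l|)(t − s)
(`mul_coef_sub_le`); taking |l| large and then t − s small yields an equicontinuity of c_n that is
uniform over the level set (`coef_equicontinuous`). For H close to u itself, regularised by a Fejér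
mean in space and a Steklov average in time, positivity of the Fejér kernel keeps 0 ≤ H ≤ 1, so the
exponential boundary terms stay bounded, while the diffusion term dominates the mobility term. This
bounds ∫ Σ (nπ c_n)² dt (`fourier_energy_le`), which is the H¹ energy in Fourier form.

Under that bound the cosine series of almost every u_t converges absolutely, and after integration
in time its tails are small uniformly over the level set. So integrals of boundary values pass to
the limit when all coefficients converge pointwise in time (`tendsto_integral_contValue_mul`),
although evaluation at an endpoint is not weakly continuous. The boundary functional is affine in
the boundary value, and every other term of J is linear in u except −∫∫ σ(u)(∂ₓH)²; since σ is
concave, its tangent at the limit density gives the inequality in the right direction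
(`exists_mobility_upper_bound`). Hence level sets are stable under pointwise convergence of
coefficients (`rate_le_of_tendsto`), finite energy of the limit included.

On a level set small time changes are harmless by equicontinuity, so Skorohod proximity forces
uniform proximity and level sets are closed (`isClosed_level`), which is lower semicontinuity. Along
an ultrafilter on a level set, pointwise limits exist because the space of measures is compact; the
limit path is continuous and convergence is uniform, hence Skorohod (`isCompact_level`). Convexity
holds because each J is affine up to the convex term −∫∫ σ(u)(∂ₓH)² (`JReal_comb_le`), and
nonnegativity comes from H = 0. -/

/-- The function `x ↦ cos (nπx)` on `[0,1]`. -/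
def cosMap (n : ℕ) : C(unitInterval, ℝ) := ⟨fun x => Real.cos (n * Real.pi * x), by fun_prop⟩

@[simp] theorem cosMap_apply (n : ℕ) (x : unitInterval) :
    cosMap n x = Real.cos (n * Real.pi * x) := rfl

theorem cosMap_mul_cosMap (m n : ℕ) (h : n ≤ m) :
    cosMap m * cosMap n = (1 / 2 : ℝ) • (cosMap (m + n) + cosMap (m - n)) := by
  ext x
  simp only [ContinuousMap.mul_apply, ContinuousMap.smul_apply, ContinuousMap.add_apply,
    cosMap_apply, smul_eq_mul]
  push_cast [h]
  rw [add_mul, add_mul, sub_mul, sub_mul, Real.cos_add, Real.cos_sub]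
  ring

/-- The product-to-sum formula makes the linear span of the cosines an algebra, as Stone–Weierstrass
requires. The two cases come from the truncated subtraction in the frequency m − n. -/
theorem cosMap_mul_mem_span (m n : ℕ) :
    cosMap m * cosMap n ∈ Submodule.span ℝ (range cosMap) := by
  rcases le_total n m with h | h
  · rw [cosMap_mul_cosMap m n h]
    exact Submodule.smul_mem _ _ (Submodule.add_mem _ (Submodule.subset_span ⟨_, rfl⟩)
      (Submodule.subset_span ⟨_, rfl⟩))
  · rw [mul_comm, cosMap_mul_cosMap n m h]
    exact Submodule.smul_mem _ _ (Submodule.add_mem _ (Submodule.subset_span ⟨_, rfl⟩)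
      (Submodule.subset_span ⟨_, rfl⟩))

/-- The algebra of cosine polynomials. -/
def cosAlgebra : Subalgebra ℝ C(unitInterval, ℝ) :=
  (Submodule.span ℝ (range cosMap)).toSubalgebra
    (Submodule.subset_span ⟨0, by ext x; simp⟩) (by
      intro f g hf hg
      induction hf using Submodule.span_induction with
      | mem f hf =>
        obtain ⟨m, rfl⟩ := hf
        induction hg using Submodule.span_induction with
        | mem g hg => obtain ⟨n, rfl⟩ := hg; exact cosMap_mul_mem_span m n
        | zero => simp
        | add g h _ _ h1 h2 => rw [mul_add]; exact Submodule.add_mem _ h1 h2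
        | smul a g _ h1 => rw [mul_smul_comm]; exact Submodule.smul_mem _ _ h1
      | zero => simp
      | add f h _ _ h1 h2 => rw [add_mul]; exact Submodule.add_mem _ h1 h2
      | smul a f _ h1 => rw [smul_mul_assoc]; exact Submodule.smul_mem _ _ h1)

/-- A single function, x ↦ cos(πx), already separates points, being injective on [0,1]. -/
theorem cosAlgebra_topologicalClosure : cosAlgebra.topologicalClosure = ⊤ := by
  apply ContinuousMap.subalgebra_topologicalClosure_eq_top_of_separatesPoints
  intro x y hxy
  refine ⟨cosMap 1, ⟨cosMap 1, Submodule.subset_span ⟨1, rfl⟩, rfl⟩, fun h => hxy ?_⟩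
  simp only [cosMap_apply, Nat.cast_one, one_mul] at h
  have hm : ∀ z : unitInterval, Real.pi * z ∈ Icc 0 Real.pi := fun z =>
    ⟨mul_nonneg Real.pi_pos.le z.2.1, mul_le_of_le_one_right Real.pi_pos.le z.2.2⟩
  exact Subtype.ext (mul_left_cancel₀ Real.pi_ne_zero (Real.injOn_cos (hm x) (hm y) h))

theorem exists_cos_polynomial_near (f : C(unitInterval, ℝ)) {ε : ℝ} (hε : 0 < ε) :
    ∃ g ∈ Submodule.span ℝ (range cosMap), ∀ x, |f x - g x| < ε := by
  have hf : f ∈ closure (cosAlgebra : Set C(unitInterval, ℝ)) := by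
    rw [← Subalgebra.topologicalClosure_coe, cosAlgebra_topologicalClosure]; trivial
  obtain ⟨g, hg, h⟩ := Metric.mem_closure_iff.1 hf ε hε
  refine ⟨g, hg, fun x => ?_⟩
  rw [← Real.dist_eq]
  exact (ContinuousMap.dist_apply_le_dist x).trans_lt h

/-! ### Measures of mass at most one -/

namespace SubMeasure

instance (p : SubMeasure) : IsFiniteMeasure p.meas := by unfold meas; infer_instance

theorem meas_univ_le (p : SubMeasure) : p.meas univ ≤ 1 := by
  have h := p.mass_le
  rw [← ENNReal.coe_le_coe, FiniteMeasure.ennreal_mass] at h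
  exact h

theorem real_univ_le (p : SubMeasure) : p.meas.real univ ≤ 1 :=
  ENNReal.toReal_le_of_le_ofReal zero_le_one (by simpa using p.meas_univ_le)

theorem integrable_continuousMap (p : SubMeasure) (f : C(unitInterval, ℝ)) :
    Integrable (fun x => f x) p.meas :=
  f.continuous.integrable_of_hasCompactSupport (HasCompactSupport.of_compactSpace _)

theorem abs_pairing_le (p : SubMeasure) {f : C(unitInterval, ℝ)} {C : ℝ} (hC : 0 ≤ C)
    (h : ∀ x, |f x| ≤ C) : |p.pairing f| ≤ C := by
  have := norm_integral_le_of_norm_le_const (μ := p.meas) (f := fun x => f x) (ae_of_all _ h)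
  refine this.trans (mul_le_of_le_one_right hC p.real_univ_le)

theorem pairing_add (p : SubMeasure) (f g : C(unitInterval, ℝ)) :
    p.pairing (f + g) = p.pairing f + p.pairing g :=
  integral_add (p.integrable_continuousMap f) (p.integrable_continuousMap g)

theorem pairing_sub (p : SubMeasure) (f g : C(unitInterval, ℝ)) :
    p.pairing (f - g) = p.pairing f - p.pairing g :=
  integral_sub (p.integrable_continuousMap f) (p.integrable_continuousMap g)

theorem pairing_smul (p : SubMeasure) (a : ℝ) (f : C(unitInterval, ℝ)) :
    p.pairing (a • f) = a * p.pairing f := integral_const_mul a _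

theorem pairing_zero (p : SubMeasure) : p.pairing 0 = 0 := by simp [pairing]

/-! ### The weak uniformity in terms of cosine coefficients -/

/-- The cosine coefficients `∫ cos (nπx) p(dx)`. -/
def coef (n : ℕ) (p : SubMeasure) : ℝ := p.pairing (cosMap n)

theorem abs_coef_le (n : ℕ) (p : SubMeasure) : |p.coef n| ≤ 1 :=
  p.abs_pairing_le zero_le_one fun _ => Real.abs_cos_le_one _

/-- Uniform approximation of f by a cosine polynomial costs the same for all measures, because their
masses are at most 1. Countably many coefficients thus control every pairing. -/
theorem pairing_control (f : C(unitInterval, ℝ)) {ε : ℝ} (hε : 0 < ε) :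
    ∃ N : ℕ, ∃ δ > 0, ∀ p q : SubMeasure, (∀ n < N, |p.coef n - q.coef n| < δ) →
      |p.pairing f - q.pairing f| < ε := by
  have key : ∀ g ∈ Submodule.span ℝ (range cosMap), ∀ ε > 0,
      ∃ N : ℕ, ∃ δ > 0, ∀ p q : SubMeasure, (∀ n < N, |p.coef n - q.coef n| < δ) →
        |p.pairing g - q.pairing g| < ε := by
    intro g hg
    induction hg using Submodule.span_induction with
    | mem g hg =>
      obtain ⟨m, rfl⟩ := hg
      exact fun ε hε => ⟨m + 1, ε, hε, fun p q h => h m (Nat.lt_succ_self m)⟩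
    | zero => exact fun ε hε => ⟨0, 1, one_pos, fun p q _ => by simpa [pairing_zero] using hε⟩
    | add g h _ _ h1 h2 =>
      intro ε hε
      obtain ⟨N, δ, hδ, H⟩ := h1 (ε / 2) (half_pos hε)
      obtain ⟨N', δ', hδ', H'⟩ := h2 (ε / 2) (half_pos hε)
      refine ⟨max N N', min δ δ', lt_min hδ hδ', fun p q hpq => ?_⟩
      have a1 := abs_lt.1 <| H p q fun n hn =>
        (hpq n (hn.trans_le (le_max_left _ _))).trans_le (min_le_left _ _)
      have a2 := abs_lt.1 <| H' p q fun n hn =>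
        (hpq n (hn.trans_le (le_max_right _ _))).trans_le (min_le_right _ _)
      rw [pairing_add, pairing_add, abs_lt]
      constructor <;> linarith
    | smul a g _ h1 =>
      intro ε hε
      obtain ⟨N, δ, hδ, H⟩ := h1 (ε / (|a| + 1)) (by positivity)
      refine ⟨N, δ, hδ, fun p q hpq => ?_⟩
      rw [pairing_smul, pairing_smul, ← mul_sub, abs_mul]
      have h3 := H p q hpq
      rw [lt_div_iff₀ (by positivity)] at h3
      nlinarith [abs_nonneg (p.pairing g - q.pairing g), abs_nonneg a]
  obtain ⟨g, hg, hfg⟩ := exists_cos_polynomial_near f (ε := ε / 4) (by linarith)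
  obtain ⟨N, δ, hδ, H⟩ := key g hg (ε / 4) (by linarith)
  refine ⟨N, δ, hδ, fun p q hpq => ?_⟩
  have h1 := abs_le.1 <| p.abs_pairing_le (f := f - g) (by linarith : 0 ≤ ε / 4)
    fun x => (hfg x).le
  have h2 := abs_le.1 <| q.abs_pairing_le (f := f - g) (by linarith : 0 ≤ ε / 4)
    fun x => (hfg x).le
  have h3 := abs_lt.1 (H p q hpq)
  rw [pairing_sub] at h1 h2
  rw [abs_lt]
  constructor <;> linarith

theorem uniformity_eq : uniformity SubMeasure =
    comap (fun p : SubMeasure × SubMeasure => (p.1.pairing, p.2.pairing))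
      (uniformity (C(unitInterval, ℝ) → ℝ)) := rfl

theorem pairing_mem_uniformity (f : C(unitInterval, ℝ)) {ε : ℝ} (hε : 0 < ε) :
    {p : SubMeasure × SubMeasure | |p.1.pairing f - p.2.pairing f| < ε} ∈
      uniformity SubMeasure := by
  rw [uniformity_eq, Pi.uniformity, comap_iInf]
  refine mem_iInf_of_mem f ?_
  rw [comap_comap]
  exact ⟨_, Metric.dist_mem_uniformity hε, fun p hp => by simpa [Real.dist_eq] using hp⟩

/-- The sets defined by finitely many coefficients generate, as a directed infimum of principal
filters, a filter finer than the uniformity by `pairing_control`; directedness then yields one such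
set inside V. -/
theorem exists_coef_control {V : Set (SubMeasure × SubMeasure)} (hV : V ∈ uniformity SubMeasure) :
    ∃ N : ℕ, ∃ δ > 0, ∀ p q : SubMeasure, (∀ n < N, |p.coef n - q.coef n| < δ) → (p, q) ∈ V := by
  let S : ℕ × {δ : ℝ // 0 < δ} → Set (SubMeasure × SubMeasure) :=
    fun i => {p | ∀ n < i.1, |p.1.coef n - p.2.coef n| < i.2}
  let 𝓖 : Filter (SubMeasure × SubMeasure) := ⨅ i, 𝓟 (S i)
  have hdir : Directed (· ≥ ·) fun i => 𝓟 (S i) := by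
    rintro ⟨N, δ, hδ⟩ ⟨N', δ', hδ'⟩
    refine ⟨⟨max N N', min δ δ', lt_min hδ hδ'⟩, ?_, ?_⟩ <;>
      refine principal_mono.2 fun p hp n hn => ?_
    · exact (hp n (hn.trans_le (le_max_left _ _))).trans_le (min_le_left _ _)
    · exact (hp n (hn.trans_le (le_max_right _ _))).trans_le (min_le_right _ _)
  have : Nonempty (ℕ × {δ : ℝ // 0 < δ}) := ⟨0, 1, one_pos⟩
  have hle : 𝓖 ≤ uniformity SubMeasure := by
    rw [uniformity_eq, Pi.uniformity, comap_iInf]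
    refine le_iInf fun f => ?_
    rw [comap_comap, ← tendsto_iff_comap, Metric.uniformity_basis_dist.tendsto_right_iff]
    intro ε hε
    obtain ⟨N, δ, hδ, H⟩ := pairing_control f hε
    refine mem_iInf_of_mem (⟨N, δ, hδ⟩ : ℕ × {δ : ℝ // 0 < δ}) ?_
    exact fun p hp => by simpa [Real.dist_eq] using H p.1 p.2 hp
  obtain ⟨⟨N, δ, hδ⟩, hi⟩ := (mem_iInf_of_directed hdir _).1 (hle hV)
  exact ⟨N, δ, hδ, fun p q h => hi h⟩

theorem continuous_pairing (f : C(unitInterval, ℝ)) :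
    Continuous fun p : SubMeasure => p.pairing f := by
  refine UniformContinuous.continuous ?_
  rw [UniformContinuous, Metric.uniformity_basis_dist.tendsto_right_iff]
  intro ε hε
  filter_upwards [pairing_mem_uniformity f hε] with p hp
  simpa [Real.dist_eq] using hp

theorem tendsto_pairing {ι : Type*} {F : Filter ι} {y : ι → SubMeasure} {p : SubMeasure}
    (h : ∀ n, Tendsto (fun i => (y i).coef n) F (𝓝 (p.coef n))) (f : C(unitInterval, ℝ)) :
    Tendsto (fun i => (y i).pairing f) F (𝓝 (p.pairing f)) := by
  rw [Metric.tendsto_nhds]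
  intro ε hε
  obtain ⟨N, δ, hδ, H⟩ := pairing_control f hε
  have : ∀ᶠ i in F, ∀ n < N, |(y i).coef n - p.coef n| < δ := by
    have := (eventually_all_finite (Set.finite_Iio N)).2
      fun n _ => Metric.tendsto_nhds.1 (h n) δ hδ
    filter_upwards [this] with i hi n hn using by simpa [Real.dist_eq] using hi n hn
  filter_upwards [this] with i hi
  simpa [Real.dist_eq] using H _ _ hi

instance : CompactSpace SubMeasure := by
  have h := isCompact_setOfPred_finiteMeasure_le_of_compactSpace unitInterval 1
  refine ⟨isInducing_fin.isCompact_iff.2 ?_⟩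
  convert h
  ext μ
  exact ⟨fun ⟨p, _, hp⟩ => hp ▸ p.mass_le, fun hμ => ⟨⟨μ, hμ⟩, trivial, rfl⟩⟩

end SubMeasure

namespace SubMeasure

/-! ### Densities -/

theorem measurable_density (p : SubMeasure) : Measurable p.density :=
  (Measure.measurable_rnDeriv _ _).ennreal_toReal

theorem density_nonneg (p : SubMeasure) (x : unitInterval) : 0 ≤ p.density x :=
  ENNReal.toReal_nonneg

theorem IsAC.le_volume {p : SubMeasure} (h : p.IsAC) : p.meas ≤ volume := by
  obtain ⟨g, hg, hg1, hp⟩ := h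
  rw [hp]
  calc volume.withDensity (fun x => ENNReal.ofReal (g x)) ≤ volume.withDensity 1 :=
        withDensity_mono (ae_of_all _ fun x => by
          simpa using ENNReal.ofReal_le_one.2 (hg1 x).2)
    _ = volume := withDensity_one

theorem density_le_one_of_le_volume {p : SubMeasure} (h : p.meas ≤ volume) :
    ∀ᵐ x, p.density x ∈ Icc (0 : ℝ) 1 := by
  filter_upwards [Measure.rnDeriv_le_one_of_le h] with x hx
  exact ⟨p.density_nonneg x, ENNReal.toReal_le_of_le_ofReal zero_le_one (by simpa using hx)⟩

theorem meas_eq_withDensity {p : SubMeasure} (h : p.meas ≪ volume) :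
    p.meas = volume.withDensity fun x => ENNReal.ofReal (p.density x) := by
  conv_lhs => rw [← Measure.withDensity_rnDeriv_eq _ _ h]
  refine withDensity_congr_ae ?_
  filter_upwards [Measure.rnDeriv_lt_top p.meas volume] with x hx
  rw [density, ENNReal.ofReal_toReal hx.ne]

/-- Domination by Lebesgue measure can be tested on continuous functions, hence survives weak
limits. The density is truncated at 1 because its bound holds only almost everywhere. -/
theorem isAC_iff_le_volume {p : SubMeasure} : p.IsAC ↔ p.meas ≤ volume := by
  refine ⟨IsAC.le_volume, fun h => ⟨fun x => min (p.density x) 1,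
    p.measurable_density.min measurable_const,
    fun x => ⟨le_min (p.density_nonneg x) zero_le_one, min_le_right _ _⟩, ?_⟩⟩
  rw [meas_eq_withDensity h.absolutelyContinuous]
  refine withDensity_congr_ae ?_
  filter_upwards [density_le_one_of_le_volume h] with x hx
  rw [min_eq_left hx.2]

theorem IsAC.density_mem {p : SubMeasure} (h : p.IsAC) : ∀ᵐ x, p.density x ∈ Icc (0 : ℝ) 1 :=
  density_le_one_of_le_volume h.le_volume

theorem IsAC.integrable_density_mul {p : SubMeasure} (h : p.IsAC) {f : unitInterval → ℝ}
    (hf : Integrable f) : Integrable fun x => p.density x * f x := by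
  refine hf.bdd_mul (c := 1) p.measurable_density.aestronglyMeasurable ?_
  filter_upwards [h.density_mem] with x hx
  rw [Real.norm_eq_abs, abs_of_nonneg hx.1]
  exact hx.2

theorem IsAC.pairing_eq {p : SubMeasure} (h : p.IsAC) (f : C(unitInterval, ℝ)) :
    p.pairing f = ∫ x, p.density x * f x := by
  rw [pairing, meas_eq_withDensity h.le_volume.absolutelyContinuous]
  rw [integral_withDensity_eq_integral_toReal_smul
    p.measurable_density.ennreal_ofReal (ae_of_all _ fun _ => ENNReal.ofReal_lt_top)]
  refine integral_congr_ae (ae_of_all _ fun x => ?_)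
  simp [ENNReal.toReal_ofReal (p.density_nonneg x)]

/-- Closed sets are decreasing limits of continuous functions, and inner regularity by closed sets
does the rest. -/
theorem le_volume_of_pairing_le {p : SubMeasure}
    (h : ∀ f : C(unitInterval, ℝ), (∀ x, 0 ≤ f x) → p.pairing f ≤ ∫ x, f x) :
    p.meas ≤ volume := by
  have hclosed : ∀ F : Set unitInterval, IsClosed F → p.meas F ≤ volume F := by
    intro F hF
    refine le_of_tendsto_of_tendsto'
      (HasOuterApproxClosed.tendsto_lintegral_apprSeq hF p.meas)
      (HasOuterApproxClosed.tendsto_lintegral_apprSeq hF volume) fun n => ?_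
    let f : C(unitInterval, ℝ) := ⟨fun x => (hF.apprSeq n x : ℝ), by fun_prop⟩
    have hint : ∀ μ : Measure unitInterval, IsFiniteMeasure μ →
        ∫⁻ x, (hF.apprSeq n x : ℝ≥0∞) ∂μ = ENNReal.ofReal (∫ x, f x ∂μ) := by
      intro μ _
      rw [ofReal_integral_eq_lintegral_ofReal
        (f.continuous.integrable_of_hasCompactSupport (HasCompactSupport.of_compactSpace _))
        (ae_of_all _ fun x => NNReal.coe_nonneg _)]
      simp [f]
    rw [hint p.meas inferInstance, hint volume inferInstance]
    exact ENNReal.ofReal_le_ofReal (h f fun x => NNReal.coe_nonneg _)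
  refine Measure.le_iff.2 fun s hs => ?_
  rw [hs.measure_eq_iSup_isClosed_of_ne_top (measure_ne_top _ _)]
  exact iSup₂_le fun K hK => iSup_le fun hc => (hclosed K hc).trans (measure_mono hK)

theorem IsAC.pairing_le {p : SubMeasure} (h : p.IsAC) {f : C(unitInterval, ℝ)}
    (hf : ∀ x, 0 ≤ f x) : p.pairing f ≤ ∫ x, f x :=
  integral_mono_measure h.le_volume (ae_of_all _ hf)
    (f.continuous.integrable_of_hasCompactSupport (HasCompactSupport.of_compactSpace _))

theorem isAC_of_tendsto {ι : Type*} {F : Filter ι} [F.NeBot] {y : ι → SubMeasure} {p : SubMeasure}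
    (hy : ∀ i, (y i).IsAC) (h : ∀ n, Tendsto (fun i => (y i).coef n) F (𝓝 (p.coef n))) :
    p.IsAC :=
  isAC_iff_le_volume.2 <| le_volume_of_pairing_le fun f hf =>
    le_of_tendsto' (tendsto_pairing h f) fun i => (hy i).pairing_le hf

theorem abs_integral_density_mul_le {p : SubMeasure} (hp : p.IsAC) {f : unitInterval → ℝ}
    (hf : Integrable f) : |∫ x, p.density x * f x| ≤ ∫ x, |f x| := by
  refine (norm_integral_le_integral_norm _).trans
    (integral_mono_ae (hp.integrable_density_mul hf).norm hf.abs ?_)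
  filter_upwards [hp.density_mem] with x hx
  rw [norm_mul, Real.norm_eq_abs, abs_of_nonneg hx.1]
  exact mul_le_of_le_one_left (norm_nonneg _) hx.2

/-- Densities bounded by 1 turn an L¹ approximation of f by continuous functions into an error
uniform along the family. Merely integrable f are needed because the tangent to the mobility has a
discontinuous coefficient. -/
theorem tendsto_integral_density_mul {ι : Type*} {F : Filter ι} {y : ι → SubMeasure}
    {p : SubMeasure} (hy : ∀ i, (y i).IsAC) (hp : p.IsAC)
    (h : ∀ n, Tendsto (fun i => (y i).coef n) F (𝓝 (p.coef n)))
    {f : unitInterval → ℝ} (hf : Integrable f) :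
    Tendsto (fun i => ∫ x, (y i).density x * f x) F (𝓝 (∫ x, p.density x * f x)) := by
  rw [Metric.tendsto_nhds]
  intro ε hε
  obtain ⟨g, hg, hgi⟩ := hf.exists_boundedContinuous_integral_sub_le (ε := ε / 4) (by linarith)
  have hd : ∀ q : SubMeasure, q.IsAC →
      |(∫ x, q.density x * f x) - q.pairing g.toContinuousMap| ≤ ε / 4 := by
    intro q hq
    rw [hq.pairing_eq]
    change |(∫ x, q.density x * f x) - ∫ x, q.density x * g x| ≤ ε / 4
    rw [← integral_sub (hq.integrable_density_mul hf)
      (hq.integrable_density_mul hgi)]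
    simp_rw [← mul_sub]
    exact (abs_integral_density_mul_le hq (hf.sub hgi)).trans hg
  filter_upwards [Metric.tendsto_nhds.1 (tendsto_pairing h g.toContinuousMap) (ε / 4)
    (by linarith)] with i hi
  have h1 := abs_le.1 (hd _ (hy i))
  have h2 := abs_le.1 (hd p hp)
  rw [Real.dist_eq, abs_lt] at hi ⊢
  constructor <;> linarith [hi.1, hi.2, h1.1, h1.2, h2.1, h2.2]

end SubMeasure

/-! ### Measurability along paths -/

variable {T : ℝ}

theorem leb_univ (T : ℝ) : leb T univ = ENNReal.ofReal T := by
  rw [leb, (MeasurableEmbedding.subtype_coe measurableSet_Icc).comap_apply,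
    image_univ, Subtype.range_coe, Real.volume_Icc, sub_zero]

instance (T : ℝ) : IsFiniteMeasure (leb T) := ⟨by rw [leb_univ]; exact ENNReal.ofReal_lt_top⟩

theorem leb_real_univ (hT : 0 < T) : (leb T).real univ = T := by
  rw [Measure.real, leb_univ, ENNReal.toReal_ofReal hT.le]

theorem integral_leb (hT : 0 < T) (f : ℝ → ℝ) :
    ∫ t : Icc (0 : ℝ) T, f t ∂leb T = ∫ t in (0)..T, f t := by
  rw [leb, integral_subtype_comap measurableSet_Icc, integral_Icc_eq_integral_Ioc,
    intervalIntegral.integral_of_le hT.le]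

/-- The function is a pointwise limit of step functions sampled at grid points. Adding 1 to the
floor places the sample to the right of t, where right continuity applies; projecting to [0,T]
handles samples beyond T. -/
theorem measurable_of_right_continuous (hT : 0 < T) {g : Icc (0 : ℝ) T → ℝ}
    (hg : ∀ t, ContinuousWithinAt g (Ici t) t) : Measurable g := by
  let r : ℕ → ℤ → Icc (0 : ℝ) T := fun n k => projIcc 0 T hT.le ((k + 1) / (n + 1))
  have hm : ∀ n : ℕ, Measurable fun t : Icc (0 : ℝ) T => g (r n ⌊(t : ℝ) * (n + 1)⌋) := by
    intro n
    have h1 : Measurable fun k : ℤ => g (r n k) := measurable_of_countable _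
    exact h1.comp (Int.measurable_floor.comp (measurable_subtype_coe.mul_const _))
  refine measurable_of_tendsto_metrizable hm (tendsto_pi_nhds.2 fun t => ?_)
  refine (hg t).tendsto.comp (tendsto_nhdsWithin_iff.2 ⟨?_, Eventually.of_forall fun n => ?_⟩)
  · have h2 : Tendsto (fun n : ℕ => ((⌊(t : ℝ) * (n + 1)⌋ : ℝ) + 1) / (n + 1)) atTop (𝓝 (t : ℝ)) := by
      have h3 : Tendsto (fun n : ℕ => (t : ℝ) + 1 / ((n : ℝ) + 1)) atTop (𝓝 (t : ℝ)) := by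
        simpa using tendsto_const_nhds.add (tendsto_one_div_add_atTop_nhds_zero_nat (𝕜 := ℝ))
      refine tendsto_of_tendsto_of_tendsto_of_le_of_le tendsto_const_nhds h3 (fun n => ?_)
        fun n => ?_
      · have hn : (0 : ℝ) < n + 1 := by positivity
        rw [le_div_iff₀ hn]
        exact (Int.lt_floor_add_one _).le
      · have hn : (0 : ℝ) < n + 1 := by positivity
        simp only [add_div]
        gcongr
        rw [div_le_iff₀ hn]
        exact Int.floor_le _
    have h4 := (continuous_projIcc (h := hT.le)).continuousAt.tendsto.comp h2
    rwa [projIcc_val] at h4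
  · have hn : (0 : ℝ) < n + 1 := by positivity
    have : (t : ℝ) ≤ ((⌊(t : ℝ) * (n + 1)⌋ : ℝ) + 1) / (n + 1) := by
      rw [le_div_iff₀ hn]
      exact (Int.lt_floor_add_one _).le
    calc t = projIcc 0 T hT.le t := (projIcc_val hT.le t).symm
      _ ≤ _ := monotone_projIcc hT.le this

theorem SkorohodPath.measurable_pairing (hT : 0 < T) (π : MPath T) (f : C(unitInterval, ℝ)) :
    Measurable fun t => (π t).pairing f :=
  measurable_of_right_continuous hT fun t =>
    (SubMeasure.continuous_pairing f).continuousAt.comp_continuousWithinAt (π.right_continuous t)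

theorem SkorohodPath.measurable_meas (hT : 0 < T) (π : MPath T) :
    Measurable fun t => (π t).meas := by
  refine Measurable.measure_of_isPiSystem (S := {s | IsClosed s})
    (borel_eq_generateFrom_isClosed (α := unitInterval) ▸ BorelSpace.measurable_eq)
    isPiSystem_isClosed ?_ ?_
  · intro F hF
    refine measurable_of_tendsto_metrizable (f := fun n t =>
      ∫⁻ x, (IsClosed.apprSeq hF n x : ℝ≥0∞) ∂(π t).meas) (fun n => ?_)
      (tendsto_pi_nhds.2 fun t => HasOuterApproxClosed.tendsto_lintegral_apprSeq hF (π t).meas)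
    let f : C(unitInterval, ℝ) := ⟨fun x => (IsClosed.apprSeq hF n x : ℝ), by fun_prop⟩
    have : (fun t => ∫⁻ x, (IsClosed.apprSeq hF n x : ℝ≥0∞) ∂(π t).meas) =
        fun t => ENNReal.ofReal ((π t).pairing f) := by
      funext t
      rw [SubMeasure.pairing, ofReal_integral_eq_lintegral_ofReal
        ((π t).integrable_continuousMap f) (ae_of_all _ fun x => NNReal.coe_nonneg _)]
      simp [f]
    rw [this]
    exact (π.measurable_pairing hT f).ennreal_ofReal
  · have : (fun t => (π t).meas univ) = fun t => ENNReal.ofReal ((π t).pairing 1) := by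
      funext t
      simp [SubMeasure.pairing]
    rw [this]
    exact (π.measurable_pairing hT 1).ennreal_ofReal

/-- Densities chosen separately at each time need not be jointly measurable. The Radon–Nikodym
derivative of kernels supplies a jointly measurable version, equal to them almost everywhere at
every time. -/
theorem SkorohodPath.exists_joint_density (hT : 0 < T) (π : MPath T) (h : ∀ t, (π t).IsAC) :
    ∃ U : Icc (0 : ℝ) T → unitInterval → ℝ, Measurable (Function.uncurry U) ∧
      (∀ t x, U t x ∈ Icc (0 : ℝ) 1) ∧ ∀ t, (π t).density =ᵐ[volume] U t := by
  let κ : ProbabilityTheory.Kernel (Icc (0 : ℝ) T) unitInterval := ⟨_, π.measurable_meas hT⟩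
  let η : ProbabilityTheory.Kernel (Icc (0 : ℝ) T) unitInterval :=
    ProbabilityTheory.Kernel.const _ volume
  have : ProbabilityTheory.IsFiniteKernel κ := ⟨1, ENNReal.one_lt_top, fun t => (π t).meas_univ_le⟩
  refine ⟨fun t x => min ((κ.rnDeriv η t x).toReal) 1, ?_,
    fun t x => ⟨le_min ENNReal.toReal_nonneg zero_le_one, min_le_right _ _⟩, fun t => ?_⟩
  · exact (ProbabilityTheory.Kernel.measurable_rnDeriv κ η).ennreal_toReal.min measurable_const
  · have h1 : κ.rnDeriv η t =ᵐ[volume] (π t).meas.rnDeriv volume :=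
      ProbabilityTheory.Kernel.rnDeriv_eq_rnDeriv_measure (κ := κ) (η := η) (a := t)
    filter_upwards [h1, (h t).density_mem] with x hx hx1
    rw [hx]
    exact (min_eq_left hx1.2).symm

/-! ### Cosine and sine expansions on the unit interval -/

theorem integral_unitInterval (f : ℝ → ℝ) : ∫ x : unitInterval, f x = ∫ x in (0)..1, f x := by
  rw [unitInterval.volume_def, integral_subtype_comap measurableSet_Icc,
    integral_Icc_eq_integral_Ioc, intervalIntegral.integral_of_le zero_le_one]

theorem integral_cos_int_mul_pi {k : ℤ} (hk : k ≠ 0) :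
    ∫ x : unitInterval, Real.cos (k * Real.pi * x) = 0 := by
  have hc : (k : ℝ) * Real.pi ≠ 0 := mul_ne_zero (by exact_mod_cast hk) Real.pi_ne_zero
  rw [integral_unitInterval fun x => Real.cos (k * Real.pi * x),
    intervalIntegral.integral_comp_mul_left _ hc, integral_cos]
  simp [Real.sin_int_mul_pi]

theorem integrable_of_continuous {f : unitInterval → ℝ} (hf : Continuous f) : Integrable f :=
  hf.integrable_of_hasCompactSupport (HasCompactSupport.of_compactSpace _)

/-- The weights of the cosine expansion. -/
def cosWeight (n : ℕ) : ℝ := if n = 0 then 1 else 2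

theorem cosWeight_zero : cosWeight 0 = 1 := if_pos rfl

theorem cosWeight_of_ne {n : ℕ} (hn : n ≠ 0) : cosWeight n = 2 := if_neg hn

theorem cosWeight_pos (n : ℕ) : 0 < cosWeight n := by
  unfold cosWeight; split_ifs <;> norm_num

theorem cosWeight_le (n : ℕ) : cosWeight n ≤ 2 := by
  unfold cosWeight; split_ifs <;> norm_num

theorem integral_cosMap (n : ℕ) : ∫ x, cosMap n x = if n = 0 then 1 else 0 := by
  split_ifs with h
  · simp [h]
  · simpa using integral_cos_int_mul_pi (k := n) (by exact_mod_cast h)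

theorem integral_cosMap_mul_cosMap (m n : ℕ) :
    ∫ x, cosMap m x * cosMap n x = if m = n then (cosWeight n)⁻¹ else 0 := by
  have h : ∀ x : unitInterval, cosMap m x * cosMap n x =
      (1 / 2) * (Real.cos (((m + n : ℕ) : ℤ) * Real.pi * x) +
        Real.cos (((m : ℤ) - n : ℤ) * Real.pi * x)) := by
    intro x
    simp only [cosMap_apply]
    push_cast
    rw [add_mul, add_mul, sub_mul, sub_mul, Real.cos_add, Real.cos_sub]
    ring
  simp_rw [h]
  rw [integral_const_mul, integral_add (integrable_of_continuous (by fun_prop))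
    (integrable_of_continuous (by fun_prop))]
  rcases eq_or_ne m n with rfl | hmn
  · rcases eq_or_ne m 0 with rfl | hm
    · simp [cosWeight]; norm_num
    · rw [integral_cos_int_mul_pi (by omega)]
      simp [cosWeight, hm]
  · rw [integral_cos_int_mul_pi (by omega), integral_cos_int_mul_pi (by omega)]
    simp [hmn]

theorem integral_sin_mul_sin (m n : ℕ) :
    ∫ x : unitInterval, Real.sin (m * Real.pi * x) * Real.sin (n * Real.pi * x) =
      if m = n ∧ n ≠ 0 then 1 / 2 else 0 := by
  have h : ∀ x : unitInterval, Real.sin (m * Real.pi * x) * Real.sin (n * Real.pi * x) =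
      (1 / 2) * (Real.cos (((m : ℤ) - n : ℤ) * Real.pi * x) -
        Real.cos (((m + n : ℕ) : ℤ) * Real.pi * x)) := by
    intro x
    push_cast
    rw [add_mul, add_mul, sub_mul, sub_mul, Real.cos_add, Real.cos_sub]
    ring
  simp_rw [h]
  rw [integral_const_mul, integral_sub (integrable_of_continuous (by fun_prop))
    (integrable_of_continuous (by fun_prop))]
  rcases eq_or_ne m n with rfl | hmn
  · rcases eq_or_ne m 0 with rfl | hm
    · simp
    · rw [integral_cos_int_mul_pi (k := ((m + m : ℕ) : ℤ)) (by omega)]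
      simp [hm]
  · rw [integral_cos_int_mul_pi (by omega), integral_cos_int_mul_pi (by omega)]
    simp [hmn]

/-- Orthogonality of the sines; equality can fail only through the index n = 0, whose sine vanishes.
-/
theorem integral_sin_polynomial_sq_le (s : Finset ℕ) (a : ℕ → ℝ) :
    ∫ x : unitInterval, (∑ n ∈ s, a n * Real.sin (n * Real.pi * x)) ^ 2 ≤
      1 / 2 * ∑ n ∈ s, a n ^ 2 := by
  have h : ∀ x : unitInterval, (∑ n ∈ s, a n * Real.sin (n * Real.pi * x)) ^ 2 =
      ∑ m ∈ s, ∑ n ∈ s,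
        (a m * a n) * (Real.sin (m * Real.pi * x) * Real.sin (n * Real.pi * x)) := by
    intro x
    rw [sq, Finset.sum_mul_sum]
    exact Finset.sum_congr rfl fun _ _ => Finset.sum_congr rfl fun _ _ => by ring
  simp_rw [h]
  rw [integral_finsetSum _ fun m _ => integrable_of_continuous (by fun_prop), Finset.mul_sum]
  refine Finset.sum_le_sum fun m hm => ?_
  rw [integral_finsetSum _ fun n _ => integrable_of_continuous (by fun_prop)]
  simp_rw [integral_const_mul, integral_sin_mul_sin]
  rw [Finset.sum_eq_single_of_mem m hm fun n _ hn => by simp [hn.symm]]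
  split_ifs
  · linarith
  · nlinarith [sq_nonneg (a m)]

/-- Expand the nonnegative integral of (g − Σ 2 s_n sin(nπx))², where the factor 2 reflects that
each nonzero sine has squared norm 1/2. -/
theorem sin_bessel (N : ℕ) {g : unitInterval → ℝ} (hg : Continuous g) :
    2 * ∑ n ∈ Finset.range N, (∫ x : unitInterval, g x * Real.sin (n * Real.pi * x)) ^ 2 ≤
      ∫ x, g x ^ 2 := by
  set s : ℕ → ℝ := fun n => ∫ x : unitInterval, g x * Real.sin (n * Real.pi * x) with hs
  have h1 := integral_sin_polynomial_sq_le (Finset.range N) fun n => 2 * s n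
  have h2 : 0 ≤ ∫ x : unitInterval,
      (g x - ∑ n ∈ Finset.range N, 2 * s n * Real.sin (n * Real.pi * x)) ^ 2 :=
    integral_nonneg fun x => sq_nonneg _
  have h3 : ∀ x : unitInterval,
      (g x - ∑ n ∈ Finset.range N, 2 * s n * Real.sin (n * Real.pi * x)) ^ 2 =
      (g x ^ 2 - ∑ n ∈ Finset.range N, 4 * s n * (g x * Real.sin (n * Real.pi * x))) +
      (∑ n ∈ Finset.range N, 2 * s n * Real.sin (n * Real.pi * x)) ^ 2 := by
    intro x
    have : ∑ n ∈ Finset.range N, 4 * s n * (g x * Real.sin (n * Real.pi * x)) =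
        2 * g x * ∑ n ∈ Finset.range N, 2 * s n * Real.sin (n * Real.pi * x) := by
      rw [Finset.mul_sum]
      exact Finset.sum_congr rfl fun _ _ => by ring
    rw [this]; ring
  simp_rw [h3] at h2
  rw [integral_add (integrable_of_continuous (by fun_prop))
    (integrable_of_continuous (by fun_prop)), integral_sub (integrable_of_continuous (by fun_prop))
    (integrable_of_continuous (by fun_prop)),
    integral_finsetSum _ fun m _ => integrable_of_continuous (by fun_prop)] at h2
  simp_rw [integral_const_mul] at h2
  have h4 : ∑ n ∈ Finset.range N, 4 * s n * s n = 4 * ∑ n ∈ Finset.range N, s n ^ 2 := by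
    rw [Finset.mul_sum]; exact Finset.sum_congr rfl fun _ _ => by ring
  have h5 : ∑ n ∈ Finset.range N, (2 * s n) ^ 2 = 4 * ∑ n ∈ Finset.range N, s n ^ 2 := by
    rw [Finset.mul_sum]; exact Finset.sum_congr rfl fun _ _ => by ring
  rw [h5] at h1
  linarith

/-! ### The cosine Hilbert basis and Parseval's identity -/

/-- The normalized cosines in `L²`. -/
def cosLp (n : ℕ) : Lp ℝ 2 (volume : Measure unitInterval) :=
  √(cosWeight n) • ContinuousMap.toLp 2 volume ℝ (cosMap n)

theorem orthonormal_cosLp : Orthonormal ℝ cosLp := by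
  classical
  rw [orthonormal_iff_ite]
  intro m n
  rw [cosLp, cosLp, real_inner_smul_left, real_inner_smul_right, ContinuousMap.inner_toLp]
  have : ∫ x, cosMap n x * (starRingEnd ℝ) (cosMap m x) = ∫ x, cosMap m x * cosMap n x := by
    simp [mul_comm]
  rw [this, integral_cosMap_mul_cosMap]
  split_ifs with h
  · subst h
    rw [← mul_assoc, Real.mul_self_sqrt (cosWeight_pos _).le, mul_inv_cancel₀ (cosWeight_pos _).ne']
  · simp

theorem span_cosLp_dense :
    ⊤ ≤ (Submodule.span ℝ (range cosLp)).topologicalClosure := by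
  intro f _
  have hd := ContinuousMap.toLp_denseRange (μ := (volume : Measure unitInterval)) (p := 2)
    (E := ℝ) ℝ (by norm_num)
  have hsub : ∀ g ∈ Submodule.span ℝ (range cosMap),
      ContinuousMap.toLp 2 volume ℝ g ∈ Submodule.span ℝ (range cosLp) := by
    intro g hg
    induction hg using Submodule.span_induction with
    | mem g hg =>
      obtain ⟨n, rfl⟩ := hg
      have : ContinuousMap.toLp 2 volume ℝ (cosMap n) = (√(cosWeight n))⁻¹ • cosLp n := by
        rw [cosLp, smul_smul, inv_mul_cancel₀ (Real.sqrt_pos.2 (cosWeight_pos n)).ne', one_smul]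
      rw [this]
      exact Submodule.smul_mem _ _ (Submodule.subset_span ⟨n, rfl⟩)
    | zero => simp
    | add g h _ _ h1 h2 => rw [map_add]; exact Submodule.add_mem _ h1 h2
    | smul a g _ h1 => rw [map_smul]; exact Submodule.smul_mem _ _ h1
  have hc : ∀ g : C(unitInterval, ℝ), ContinuousMap.toLp 2 volume ℝ g ∈
      closure (Submodule.span ℝ (range cosLp) : Set (Lp ℝ 2 (volume : Measure unitInterval))) := by
    intro g
    have hg : g ∈ closure (cosAlgebra : Set C(unitInterval, ℝ)) := by
      rw [← Subalgebra.topologicalClosure_coe, cosAlgebra_topologicalClosure]; trivial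
    exact map_mem_closure (ContinuousMap.toLp 2 volume ℝ).continuous hg hsub
  exact closure_minimal (by rintro _ ⟨g, rfl⟩; exact hc g) isClosed_closure (hd f)

/-- The cosine basis of `L²([0,1])`. -/
def cosBasis : HilbertBasis ℕ ℝ (Lp ℝ 2 (volume : Measure unitInterval)) :=
  HilbertBasis.mk orthonormal_cosLp span_cosLp_dense

theorem inner_cosLp {u : unitInterval → ℝ} (hu : MemLp u 2) (n : ℕ) :
    inner ℝ (cosLp n) (hu.toLp u) = √(cosWeight n) * ∫ x, u x * cosMap n x := by
  rw [cosLp, real_inner_smul_left, L2.inner_def]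
  congr 1
  refine integral_congr_ae ?_
  filter_upwards [hu.coeFn_toLp,
    ContinuousMap.coeFn_toLp (p := 2) (𝕜 := ℝ) volume (cosMap n)] with x h1 h2
  rw [h1, h2]
  simp

theorem cos_parseval {u v : unitInterval → ℝ} (hu : MemLp u 2) (hv : MemLp v 2) :
    HasSum (fun n => cosWeight n * (∫ x, u x * cosMap n x) * ∫ x, v x * cosMap n x)
      (∫ x, u x * v x) := by
  have h := cosBasis.hasSum_inner_mul_inner (hu.toLp u) (hv.toLp v)
  have h1 : inner ℝ (hu.toLp u) (hv.toLp v) = ∫ x, u x * v x := by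
    rw [L2.inner_def]
    refine integral_congr_ae ?_
    filter_upwards [hu.coeFn_toLp, hv.coeFn_toLp] with x h1 h2
    rw [h1, h2]
    simp [mul_comm]
  rw [h1] at h
  refine (congrArg (fun f => HasSum f (∫ x, u x * v x)) (funext fun n => ?_)).mp h
  have hb : cosBasis n = cosLp n := by simp [cosBasis]
  rw [hb, real_inner_comm, inner_cosLp hu, inner_cosLp hv]
  linear_combination ((∫ x, u x * cosMap n x) * ∫ x, v x * cosMap n x) *
    Real.mul_self_sqrt (cosWeight_pos n).le

theorem ae_eq_of_cos_coef_eq {u v : unitInterval → ℝ} (hu : MemLp u 2) (hv : MemLp v 2)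
    (h : ∀ n, ∫ x, u x * cosMap n x = ∫ x, v x * cosMap n x) : u =ᵐ[volume] v := by
  have h1 := cos_parseval (hu.sub hv) (hu.sub hv)
  have h2 : ∀ n, ∫ x, (u - v) x * cosMap n x = 0 := by
    intro n
    have hb : ∀ w : unitInterval → ℝ, MemLp w 2 → Integrable fun x => w x * cosMap n x := by
      intro w hw
      refine (hw.integrable (by norm_num)).mul_bdd (c := 1)
        (cosMap n).continuous.aestronglyMeasurable (ae_of_all _ fun x => Real.abs_cos_le_one _)
    simp only [Pi.sub_apply, sub_mul]
    rw [integral_sub (hb u hu) (hb v hv), h n, sub_self]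
  simp only [h2, mul_zero] at h1
  have h3 := h1.unique hasSum_zero
  rw [integral_eq_zero_iff_of_nonneg (fun x => mul_self_nonneg _)
    ((hu.sub hv).integrable_mul (hu.sub hv))] at h3
  filter_upwards [h3] with x hx
  exact sub_eq_zero.1 (mul_self_eq_zero.1 hx)

/-! ### Fejér means -/

/-- The right side is |Σ_{n<N} e^{inθ}|², and N − n counts the pairs of indices below N with
difference n. Only the resulting positivity is used later. -/
theorem fejer_kernel_eq (N : ℕ) (θ : ℝ) :
    ∑ n ∈ Finset.range N, cosWeight n * (N - n) * Real.cos (n * θ) =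
      (∑ n ∈ Finset.range N, Real.cos (n * θ)) ^ 2 +
        (∑ n ∈ Finset.range N, Real.sin (n * θ)) ^ 2 := by
  induction N with
  | zero => simp
  | succ N ih =>
    have h1 : ∑ n ∈ Finset.range (N + 1), cosWeight n * ((N + 1 : ℕ) - n) * Real.cos (n * θ) =
        ∑ n ∈ Finset.range N, cosWeight n * (N - n) * Real.cos (n * θ) +
          ∑ n ∈ Finset.range (N + 1), cosWeight n * Real.cos (n * θ) := by
      rw [Finset.sum_range_succ, Finset.sum_range_succ _ N, ← add_assoc, ← Finset.sum_add_distrib]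
      push_cast
      congr 1
      · exact Finset.sum_congr rfl fun _ _ => by ring
      · ring
    have h2 : ∑ n ∈ Finset.range (N + 1), cosWeight n * Real.cos (n * θ) =
        1 + 2 * ∑ k ∈ Finset.range N, Real.cos (N * θ - k * θ) := by
      rw [Finset.sum_range_succ', Finset.mul_sum, ← Finset.sum_range_reflect, add_comm]
      simp only [cosWeight_zero, Nat.cast_zero, zero_mul, Real.cos_zero, mul_one]
      congr 1
      refine Finset.sum_congr rfl fun k hk => ?_
      have hk' : k < N := Finset.mem_range.1 hk
      rw [cosWeight_of_ne (by omega), show N - 1 - k + 1 = N - k by omega, Nat.cast_sub hk'.le,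
        sub_mul]
    rw [h1, h2, ih, Finset.sum_range_succ, Finset.sum_range_succ]
    simp_rw [Real.cos_sub]
    rw [Finset.sum_add_distrib, ← Finset.mul_sum, ← Finset.mul_sum]
    nlinarith [Real.sin_sq_add_cos_sq (N * θ)]

/-- The coefficients of the Fejér mean of order `N`. -/
def fejerCoef (N n : ℕ) : ℝ := cosWeight n * (1 - n / N)

theorem fejerCoef_nonneg {N n : ℕ} (h : n < N) : 0 ≤ fejerCoef N n := by
  have hN : (0 : ℝ) < N := by exact_mod_cast (Nat.zero_le n).trans_lt h
  refine mul_nonneg (cosWeight_pos n).le (sub_nonneg.2 ((div_le_one hN).2 ?_))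
  exact_mod_cast h.le

theorem fejerCoef_le (N n : ℕ) : fejerCoef N n ≤ 2 := by
  have h : (0 : ℝ) ≤ n / N := by positivity
  have := cosWeight_le n
  have := cosWeight_pos n
  unfold fejerCoef
  nlinarith

/-- The Fejér mean of order `N` of the cosine series with coefficients `c`. -/
def fejerSum (N : ℕ) (c : ℕ → ℝ) (x : ℝ) : ℝ :=
  ∑ n ∈ Finset.range N, fejerCoef N n * c n * Real.cos (n * Real.pi * x)

theorem fejer_kernel_nonneg {N : ℕ} (hN : 0 < N) (θ : ℝ) :
    0 ≤ ∑ n ∈ Finset.range N, fejerCoef N n * Real.cos (n * θ) := by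
  have hN' : (0 : ℝ) < N := by exact_mod_cast hN
  have h : ∑ n ∈ Finset.range N, fejerCoef N n * Real.cos (n * θ) = (N : ℝ)⁻¹ *
      ∑ n ∈ Finset.range N, cosWeight n * (N - n) * Real.cos (n * θ) := by
    rw [Finset.mul_sum]
    refine Finset.sum_congr rfl fun n _ => ?_
    unfold fejerCoef
    field_simp
  rw [h, fejer_kernel_eq]
  positivity

namespace SubMeasure

theorem pairing_sum (p : SubMeasure) {ι : Type*} (s : Finset ι) (f : ι → C(unitInterval, ℝ)) :
    p.pairing (∑ i ∈ s, f i) = ∑ i ∈ s, p.pairing (f i) := by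
  classical
  induction s using Finset.induction_on with
  | empty => simp [pairing_zero]
  | insert i s hi ih => rw [Finset.sum_insert hi, Finset.sum_insert hi, pairing_add, ih]

/-- The mean is the pairing of p with a kernel in y that averages the Fejér kernels at π(x − y) and
π(x + y). This kernel is nonnegative with integral 1, and p is dominated by Lebesgue measure. -/
theorem IsAC.fejerSum_mem {p : SubMeasure} (hp : p.IsAC) {N : ℕ} (hN : 0 < N) (x : ℝ) :
    fejerSum N (fun n => p.coef n) x ∈ Icc (0 : ℝ) 1 := by
  let F : C(unitInterval, ℝ) := ∑ n ∈ Finset.range N,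
    (fejerCoef N n * Real.cos (n * Real.pi * x)) • cosMap n
  have hF : p.pairing F = fejerSum N (fun n => p.coef n) x := by
    rw [pairing_sum, fejerSum]
    refine Finset.sum_congr rfl fun n _ => ?_
    rw [pairing_smul]
    simp only [coef]
    ring
  have hpos : ∀ y, 0 ≤ F y := by
    intro y
    have h1 : F y = 1 / 2 * (∑ n ∈ Finset.range N, fejerCoef N n *
        Real.cos (n * (Real.pi * x - Real.pi * y)) + ∑ n ∈ Finset.range N, fejerCoef N n *
        Real.cos (n * (Real.pi * x + Real.pi * y))) := by
      rw [← Finset.sum_add_distrib, Finset.mul_sum]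
      simp only [F, ContinuousMap.coe_sum, Finset.sum_apply, ContinuousMap.coe_smul, Pi.smul_apply,
        smul_eq_mul, cosMap_apply]
      refine Finset.sum_congr rfl fun n _ => ?_
      rw [mul_sub (n : ℝ), mul_add (n : ℝ), Real.cos_add, Real.cos_sub, mul_assoc (n : ℝ), mul_assoc (n : ℝ)]
      ring
    rw [h1]
    have := fejer_kernel_nonneg hN (Real.pi * x - Real.pi * y)
    have := fejer_kernel_nonneg hN (Real.pi * x + Real.pi * y)
    linarith
  have hint : ∫ y, F y = 1 := by
    simp only [F, ContinuousMap.coe_sum, Finset.sum_apply, ContinuousMap.coe_smul, Pi.smul_apply,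
      smul_eq_mul]
    rw [integral_finsetSum _ fun n _ => integrable_of_continuous (by fun_prop)]
    simp_rw [integral_const_mul, integral_cosMap]
    rw [Finset.sum_eq_single_of_mem 0 (Finset.mem_range.2 hN) fun n _ hn => by simp [hn]]
    simp [fejerCoef, cosWeight]
  rw [← hF]
  exact ⟨integral_nonneg hpos, hint ▸ hp.pairing_le hpos⟩

/-- The sum is the pairing of p with its own Fejér mean, which lies in [0,1]. -/
theorem IsAC.sum_fejerCoef_mul_sq_le {p : SubMeasure} (hp : p.IsAC) {N : ℕ} (hN : 0 < N) :
    ∑ n ∈ Finset.range N, fejerCoef N n * p.coef n ^ 2 ≤ 1 := by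
  let F : C(unitInterval, ℝ) := ∑ n ∈ Finset.range N, (fejerCoef N n * p.coef n) • cosMap n
  have hF : p.pairing F = ∑ n ∈ Finset.range N, fejerCoef N n * p.coef n ^ 2 := by
    rw [pairing_sum]
    refine Finset.sum_congr rfl fun n _ => ?_
    rw [pairing_smul]
    simp only [coef]
    ring
  have hle : ∀ x, |F x| ≤ 1 := by
    intro x
    have : F x = fejerSum N (fun n => p.coef n) x := by
      simp [F, fejerSum]
    rw [this, abs_of_nonneg (hp.fejerSum_mem hN x).1]
    exact (hp.fejerSum_mem hN x).2
  rw [← hF]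
  exact (le_abs_self _).trans (p.abs_pairing_le zero_le_one hle)

end SubMeasure

/-! ### Lower bounds for the rate functional -/

/-- A non-integrable f has integral 0, so nonnegativity of g replaces integrability of f. This
matters for the boundary terms, whose measurability in time is obtained only after the energy
estimate. -/
theorem integral_le_integral_of_le {Ω : Type*} [MeasurableSpace Ω] {μ : Measure Ω} {f g : Ω → ℝ}
    (hg : Integrable g μ) (hg0 : ∀ x, 0 ≤ g x) (h : ∀ᵐ x ∂μ, f x ≤ g x) :
    ∫ x, f x ∂μ ≤ ∫ x, g x ∂μ := by
  by_cases hf : Integrable f μ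
  · exact integral_mono_ae hf hg h
  · rw [integral_undef hf]
    exact integral_nonneg hg0

/-- Makes continuous versions unique and lets them inherit almost-everywhere bounds, also at the two
endpoints. -/
instance : (volume : Measure unitInterval).IsOpenPosMeasure := by
  refine ⟨fun U hU hne h0 => ?_⟩
  obtain ⟨V, hV, rfl⟩ := isOpen_induced_iff.1 hU
  obtain ⟨x, hx⟩ := hne
  have hxc : (x : ℝ) ∈ closure (Ioo (0 : ℝ) 1) := by
    rw [closure_Ioo zero_ne_one]; exact x.2
  have hpos := (hV.inter isOpen_Ioo).measure_pos volume (mem_closure_iff.1 hxc V hV hx)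
  refine hpos.ne' (le_antisymm ((measure_mono ?_).trans (unitInterval.volume_apply.symm.trans h0).le)
    zero_le)
  exact fun y hy => ⟨⟨y, Ioo_subset_Icc_self hy.2⟩, hy.1, rfl⟩

theorem contValue_mem {p : SubMeasure} (hp : p.IsAC) (x : unitInterval) :
    contValue p.density x ∈ Icc (0 : ℝ) 1 := by
  unfold contValue
  split_ifs with h
  · set w := h.choose
    have hw : p.density =ᵐ[volume] w := h.choose_spec
    have h1 : ∀ᵐ y, w y ∈ Icc (0 : ℝ) 1 := by
      filter_upwards [hw, hp.density_mem] with y h1 h2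
      rwa [← h1]
    have h2 : Dense {y | w y ∈ Icc (0 : ℝ) 1} := Measure.dense_of_ae h1
    have h3 : IsClosed {y | w y ∈ Icc (0 : ℝ) 1} := isClosed_Icc.preimage w.continuous
    have : x ∈ closure {y | w y ∈ Icc (0 : ℝ) 1} := h2 x
    rwa [h3.closure_eq] at this
  · exact ⟨le_rfl, zero_le_one⟩

theorem contValue_eq {u : unitInterval → ℝ} {w : C(unitInterval, ℝ)} (h : u =ᵐ[volume] w)
    (x : unitInterval) : contValue u x = w x := by
  have hex : ∃ w : C(unitInterval, ℝ), u =ᵐ[volume] w := ⟨w, h⟩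
  rw [contValue, dif_pos hex]
  have : (hex.choose : unitInterval → ℝ) = w :=
    Measure.eq_of_ae_eq (hex.choose_spec.symm.trans h) hex.choose.continuous w.continuous
  rw [this]

theorem mobility_le (a : ℝ) : mobility a ≤ 1 / 4 := by
  unfold mobility; nlinarith [sq_nonneg (a - 1 / 2)]

theorem bdry_zero (ϱ D a : ℝ) : bdry ϱ D a 0 = 0 := by simp [bdry]

/-- The two rates (1 − a)ϱ and a(1 − ϱ) are nonnegative and sum to at most 1. -/
theorem bdry_le {ϱ D a M m : ℝ} (hϱ : ϱ ∈ Icc (0 : ℝ) 1) (hD : 0 < D) (ha : a ∈ Icc (0 : ℝ) 1)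
    (hM : |M| ≤ m) : bdry ϱ D a M ≤ 1 / D * Real.exp m := by
  have h1 : Real.exp M ≤ Real.exp m := Real.exp_le_exp.2 ((le_abs_self M).trans hM)
  have h2 : Real.exp (-M) ≤ Real.exp m := Real.exp_le_exp.2 ((neg_le_abs M).trans hM)
  have h3 : 0 ≤ (1 - a) * ϱ := mul_nonneg (sub_nonneg.2 ha.2) hϱ.1
  have h4 : 0 ≤ a * (1 - ϱ) := mul_nonneg ha.1 (sub_nonneg.2 hϱ.2)
  have h5 : (1 - a) * ϱ + a * (1 - ϱ) ≤ 1 := by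
    nlinarith [mul_nonneg ha.1 hϱ.1, mul_nonneg (sub_nonneg.2 ha.2) (sub_nonneg.2 hϱ.2)]
  have h6 := Real.exp_pos m
  unfold bdry
  gcongr
  nlinarith

/-- The test function `∑ aₙ(t) cos (nπx)`. -/
def cosTest (s : Finset ℕ) (a a' : ℕ → ℝ → ℝ)
    (ha : ∀ n, ∀ t ∈ Icc 0 T, HasDerivWithinAt (a n) (a' n t) (Icc 0 T) t)
    (ha' : ∀ n, ContinuousOn (a' n) (Icc 0 T)) : C12 T where
  toFun t x := ∑ n ∈ s, a n t * Real.cos (n * Real.pi * x)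
  dt t x := ∑ n ∈ s, a' n t * Real.cos (n * Real.pi * x)
  dx t x := ∑ n ∈ s, -(n * Real.pi * a n t) * Real.sin (n * Real.pi * x)
  dxx t x := ∑ n ∈ s, -((n * Real.pi) ^ 2 * a n t) * Real.cos (n * Real.pi * x)
  hasDeriv_dt t ht x _ := HasDerivWithinAt.fun_sum fun n _ => (ha n t ht).mul_const _
  hasDeriv_dx t _ x _ := by
    refine HasDerivWithinAt.fun_sum fun n _ => HasDerivAt.hasDerivWithinAt ?_
    have h := (((hasDerivAt_id x).const_mul (n * Real.pi)).cos).const_mul (a n t)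
    exact h.congr_deriv (by simp only [id]; ring)
  hasDeriv_dxx t _ x _ := by
    refine HasDerivWithinAt.fun_sum fun n _ => HasDerivAt.hasDerivWithinAt ?_
    have h := (((hasDerivAt_id x).const_mul (n * Real.pi)).sin).const_mul (-(n * Real.pi * a n t))
    exact h.congr_deriv (by simp only [id]; ring)
  cont := continuousOn_finsetSum _ fun n _ => ContinuousOn.mul
    (ContinuousOn.comp (fun t ht => (ha n t ht).continuousWithinAt) continuousOn_fst
      fun _ h => h.1) (by fun_prop)
  cont_dt := continuousOn_finsetSum _ fun n _ => ContinuousOn.mul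
    ((ha' n).comp continuousOn_fst fun _ h => h.1) (by fun_prop)
  cont_dx := continuousOn_finsetSum _ fun n _ => ContinuousOn.mul
    (ContinuousOn.neg (continuousOn_const.mul (ContinuousOn.comp
      (fun t ht => (ha n t ht).continuousWithinAt) continuousOn_fst fun _ h => h.1))) (by fun_prop)
  cont_dxx := continuousOn_finsetSum _ fun n _ => ContinuousOn.mul
    (ContinuousOn.neg (continuousOn_const.mul (ContinuousOn.comp
      (fun t ht => (ha n t ht).continuousWithinAt) continuousOn_fst fun _ h => h.1))) (by fun_prop)

theorem SubMeasure.IsAC.integral_density_mul_cos_sum {p : SubMeasure} (hp : p.IsAC) (s : Finset ℕ)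
    (b : ℕ → ℝ) : ∫ x : unitInterval, p.density x * ∑ n ∈ s, b n * Real.cos (n * Real.pi * x) =
      ∑ n ∈ s, b n * p.coef n := by
  have h := hp.pairing_eq (∑ n ∈ s, b n • cosMap n)
  rw [SubMeasure.pairing_sum] at h
  simp_rw [SubMeasure.pairing_smul] at h
  simpa [SubMeasure.coef] using h.symm

theorem ContinuousOn.integrable_leb {f : ℝ → ℝ} (hf : ContinuousOn f (Icc 0 T)) :
    Integrable (fun t : Icc (0 : ℝ) T => f t) (leb T) := by
  have : Continuous fun t : Icc (0 : ℝ) T => f t := continuousOn_iff_continuous_domRestrict.1 hf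
  exact this.integrable_of_hasCompactSupport (HasCompactSupport.of_compactSpace _)

/-- The sines in ∂ₓH vanish at 0 and 1, which removes the terms with boundary values of ∂ₓH. The
constant 1/8 is the bound 1/4 on the mobility times the squared norm 1/2 of a sine. The boundary
functional is only majorised, by a function left to each application. -/
theorem le_JReal_cosTest (α A β B : ℝ) (hT : 0 < T) {π : MPath T} (hπ : ∀ t, (π t).IsAC)
    (s : Finset ℕ) (a a' : ℕ → ℝ → ℝ)
    (ha : ∀ n, ∀ t ∈ Icc 0 T, HasDerivWithinAt (a n) (a' n t) (Icc 0 T) t)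
    (ha' : ∀ n, ContinuousOn (a' n) (Icc 0 T)) {b : Icc (0 : ℝ) T → ℝ} (hb : Integrable b (leb T))
    (hb0 : ∀ t, 0 ≤ b t)
    (hbd : ∀ t : Icc (0 : ℝ) T,
      bdry α A (contValue (π t).density 0) ((cosTest s a a' ha ha').toFun t 0) +
        bdry β B (contValue (π t).density 1) ((cosTest s a a' ha ha').toFun t 1) ≤ b t) :
    ∑ n ∈ s, a n T * (π (timeEnd hT)).coef n - ∑ n ∈ s, a n 0 * (π (timeZero hT)).coef n
      - (∫ t, ∑ n ∈ s, a' n t * (π t).coef n ∂leb T)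
      + (∫ t, ∑ n ∈ s, (n * Real.pi) ^ 2 * a n t * (π t).coef n ∂leb T)
      - (∫ t : Icc (0 : ℝ) T, 1 / 8 * ∑ n ∈ s, (n * Real.pi * a n t) ^ 2 ∂leb T) - ∫ t, b t ∂leb T
      ≤ JReal α A β B hT (cosTest s a a' ha ha') π := by
  have e1 : ∀ t x, (cosTest s a a' ha ha').toFun t x =
    ∑ n ∈ s, a n t * Real.cos (n * Real.pi * x) := fun _ _ => rfl
  have e2 : ∀ t x, (cosTest s a a' ha ha').dt t x =
    ∑ n ∈ s, a' n t * Real.cos (n * Real.pi * x) := fun _ _ => rfl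
  have e3 : ∀ t x, (cosTest s a a' ha ha').dx t x =
    ∑ n ∈ s, -(n * Real.pi * a n t) * Real.sin (n * Real.pi * x) := fun _ _ => rfl
  have e4 : ∀ t x, (cosTest s a a' ha ha').dxx t x =
    ∑ n ∈ s, -((n * Real.pi) ^ 2 * a n t) * Real.cos (n * Real.pi * x) := fun _ _ => rfl
  have hσ : ∫ t : Icc (0 : ℝ) T, (∫ x : unitInterval, mobility ((π t).density x) *
      ((cosTest s a a' ha ha').dx t x) ^ 2) ∂leb T ≤
      ∫ t : Icc (0 : ℝ) T, 1 / 8 * ∑ n ∈ s, (n * Real.pi * a n t) ^ 2 ∂leb T := by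
    refine integral_le_integral_of_le ?_ (fun t => by positivity) (ae_of_all _ fun t => ?_)
    · refine ContinuousOn.integrable_leb (f := fun t => 1 / 8 * ∑ n ∈ s, (n * Real.pi * a n t) ^ 2)
        (continuousOn_const.mul (continuousOn_finsetSum _ fun n _ => ContinuousOn.pow
          (continuousOn_const.mul fun t ht => (ha n t ht).continuousWithinAt) 2))
    · calc ∫ x : unitInterval, mobility ((π t).density x) * ((cosTest s a a' ha ha').dx t x) ^ 2
          ≤ ∫ x : unitInterval, 1 / 4 * ((cosTest s a a' ha ha').dx t x) ^ 2 := by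
            refine integral_le_integral_of_le (integrable_of_continuous ?_)
              (fun x => by positivity) (ae_of_all _ fun x => ?_)
            · simp only [e3]; fun_prop
            · exact mul_le_mul_of_nonneg_right (mobility_le _) (sq_nonneg _)
        _ ≤ 1 / 4 * (1 / 2 * ∑ n ∈ s, (-(n * Real.pi * a n t)) ^ 2) := by
            rw [integral_const_mul]
            simp only [e3]
            gcongr
            exact integral_sin_polynomial_sq_le s fun n => -(n * Real.pi * a n t)
        _ = _ := by simp only [neg_sq]; ring
  have hB : ∫ t : Icc (0 : ℝ) T,
      (bdry α A (contValue (π t).density 0) ((cosTest s a a' ha ha').toFun t 0) +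
        bdry β B (contValue (π t).density 1) ((cosTest s a a' ha ha').toFun t 1)) ∂leb T ≤
      ∫ t, b t ∂leb T := integral_le_integral_of_le hb hb0 (ae_of_all _ hbd)
  have d0 : ∀ t, (cosTest s a a' ha ha').dx t 0 = 0 := by simp [e3]
  have d1 : ∀ t, (cosTest s a a' ha ha').dx t 1 = 0 := by simp [e3, Real.sin_nat_mul_pi]
  unfold JReal
  simp only [d0, d1, mul_zero, integral_zero, add_zero, sub_zero]
  have t1 : ∫ x : unitInterval, (π (timeEnd hT)).density x * (cosTest s a a' ha ha').toFun T x =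
      ∑ n ∈ s, a n T * (π (timeEnd hT)).coef n := (hπ _).integral_density_mul_cos_sum s _
  have t2 : ∫ x : unitInterval, (π (timeZero hT)).density x * (cosTest s a a' ha ha').toFun 0 x =
      ∑ n ∈ s, a n 0 * (π (timeZero hT)).coef n := (hπ _).integral_density_mul_cos_sum s _
  have t3 : ∀ t : Icc (0 : ℝ) T, ∫ x : unitInterval,
      (π t).density x * (cosTest s a a' ha ha').dt t x = ∑ n ∈ s, a' n t * (π t).coef n :=
    fun t => (hπ _).integral_density_mul_cos_sum s _
  have t4 : ∀ t : Icc (0 : ℝ) T, ∫ x : unitInterval,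
      (π t).density x * (cosTest s a a' ha ha').dxx t x =
        -∑ n ∈ s, (n * Real.pi) ^ 2 * a n t * (π t).coef n := by
    intro t
    simp_rw [e4]
    rw [(hπ t).integral_density_mul_cos_sum s]
    simp [Finset.sum_neg_distrib]
  rw [t1, t2]
  simp_rw [t3, t4]
  rw [integral_neg]
  linarith

theorem isAC_and_JReal_le_of_rate_le {α A β B : ℝ} {hT : 0 < T} {π : MPath T} {q : ℝ}
    (h : rate α A β B hT π ≤ q) : HasFiniteEnergy π ∧ ∀ H, JReal α A β B hT H π ≤ q := by
  have h1 : ∀ H, J α A β B hT H π ≤ q := fun H => (le_iSup _ H).trans h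
  have h2 : HasFiniteEnergy π := by
    by_contra hne
    have := h1 (cosTest ∅ (fun _ _ => 0) (fun _ _ => 0) (fun _ _ _ => hasDerivWithinAt_const ..)
      fun _ => continuousOn_const)
    rw [J, if_neg hne, top_le_iff] at this
    exact EReal.coe_ne_top _ this
  refine ⟨h2, fun H => ?_⟩
  have := h1 H
  rw [J, if_pos h2] at this
  exact_mod_cast this

theorem rate_le_of_JReal_le {α A β B : ℝ} {hT : 0 < T} {π : MPath T} {q : ℝ}
    (h : HasFiniteEnergy π) (hJ : ∀ H, JReal α A β B hT H π ≤ q) : rate α A β B hT π ≤ q :=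
  iSup_le fun H => by rw [J, if_pos h]; exact_mod_cast hJ H

/-! ### Equicontinuity of level sets -/

/-- A smooth ramp from `0` at `s` to `1` at `s + ε`. -/
def ramp (ε s r : ℝ) : ℝ := Real.smoothTransition ((r - s) / ε)

/-- The derivative of `ramp`. -/
def rampDeriv (ε s r : ℝ) : ℝ := deriv Real.smoothTransition ((r - s) / ε) / ε

theorem hasDerivAt_ramp (ε s r : ℝ) : HasDerivAt (ramp ε s) (rampDeriv ε s r) r := by
  have h1 : HasDerivAt Real.smoothTransition (deriv Real.smoothTransition ((r - s) / ε))
      ((r - s) / ε) :=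
    ((Real.smoothTransition.contDiff (n := 1)).differentiable (by norm_num) _).hasDerivAt
  have h2 : HasDerivAt (fun r : ℝ => (r - s) / ε) (1 / ε) r :=
    ((hasDerivAt_id r).sub_const s).div_const ε
  exact (h1.comp r h2).congr_deriv (by rw [rampDeriv]; ring)

theorem continuous_rampDeriv (ε s : ℝ) : Continuous (rampDeriv ε s) := by
  have : Continuous (deriv Real.smoothTransition) :=
    (Real.smoothTransition.contDiff (n := 1)).continuous_deriv le_rfl
  unfold rampDeriv
  fun_prop

theorem ramp_mem (ε s r : ℝ) : ramp ε s r ∈ Icc (0 : ℝ) 1 :=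
  ⟨Real.smoothTransition.nonneg _, Real.smoothTransition.le_one _⟩

theorem ramp_eq_zero {ε s r : ℝ} (hε : 0 < ε) (h : r ≤ s) : ramp ε s r = 0 :=
  Real.smoothTransition.zero_of_nonpos (div_nonpos_of_nonpos_of_nonneg (sub_nonpos.2 h) hε.le)

theorem ramp_eq_one {ε s r : ℝ} (hε : 0 < ε) (h : s + ε ≤ r) : ramp ε s r = 1 :=
  Real.smoothTransition.one_of_one_le ((one_le_div hε).2 (by linarith))

theorem ramp_antitone {ε s t r : ℝ} (hε : 0 < ε) (h : s ≤ t) : ramp ε t r ≤ ramp ε s r :=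
  Real.smoothTransition.monotone (div_le_div_of_nonneg_right (by linarith) hε.le)

theorem rampDeriv_nonneg {ε : ℝ} (hε : 0 < ε) (s r : ℝ) : 0 ≤ rampDeriv ε s r :=
  div_nonneg (Real.smoothTransition.monotone.deriv_nonneg) hε.le

theorem rampDeriv_eq_zero_of_lt {ε s r : ℝ} (hε : 0 < ε) (h : r < s) : rampDeriv ε s r = 0 := by
  have h1 : ramp ε s =ᶠ[𝓝 r] fun _ => 0 := by
    filter_upwards [Iio_mem_nhds h] with x hx using ramp_eq_zero hε (le_of_lt hx)
  exact (hasDerivAt_ramp ε s r).unique ((hasDerivAt_const r (0 : ℝ)).congr_of_eventuallyEq h1)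

theorem rampDeriv_eq_zero_of_gt {ε s r : ℝ} (hε : 0 < ε) (h : s + ε < r) :
    rampDeriv ε s r = 0 := by
  have h1 : ramp ε s =ᶠ[𝓝 r] fun _ => 1 := by
    filter_upwards [Ioi_mem_nhds h] with x hx using ramp_eq_one hε (le_of_lt hx)
  exact (hasDerivAt_ramp ε s r).unique ((hasDerivAt_const r (1 : ℝ)).congr_of_eventuallyEq h1)

theorem integral_rampDeriv (hT : 0 < T) (ε s : ℝ) :
    ∫ t : Icc (0 : ℝ) T, rampDeriv ε s t ∂leb T = ramp ε s T - ramp ε s 0 := by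
  rw [integral_leb hT (rampDeriv ε s)]
  exact intervalIntegral.integral_eq_sub_of_hasDerivAt (fun r _ => hasDerivAt_ramp ε s r)
    ((continuous_rampDeriv ε s).intervalIntegrable _ _)

/-- The derivative of the ramp is a unit mass concentrating on [s, s + ε], so right continuity at s
identifies the limit. The expression is what the time terms of J become when the test function is a
ramp in time. -/
theorem tendsto_ramp_increment (hT : 0 < T) {g : Icc (0 : ℝ) T → ℝ} (hm : Measurable g)
    (hg1 : ∀ t, |g t| ≤ 1) (s : Icc (0 : ℝ) T) (hs : ContinuousWithinAt g (Ici s) s) :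
    Tendsto (fun ε : ℝ => ramp ε s T * g (timeEnd hT) - ramp ε s 0 * g (timeZero hT) -
      ∫ t : Icc (0 : ℝ) T, rampDeriv ε s t * g t ∂leb T) (𝓝[>] 0) (𝓝 (g (timeEnd hT) - g s)) := by
  have hgi : ∀ ε : ℝ, Integrable (fun t : Icc (0 : ℝ) T => rampDeriv ε s t * g t) (leb T) := by
    intro ε
    exact (ContinuousOn.integrable_leb (continuous_rampDeriv ε s).continuousOn).mul_bdd (c := 1)
      hm.aestronglyMeasurable (ae_of_all _ hg1)
  -- A ramp starting at T never gets going: it vanishes on [0,T], and its derivative vanishes off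
  -- the null set {T}.
  rcases eq_or_lt_of_le s.2.2 with hsT | hsT
  · have hs' : s = timeEnd hT := Subtype.ext hsT
    rw [← hs', sub_self]
    refine Tendsto.congr' ?_ tendsto_const_nhds
    filter_upwards [self_mem_nhdsWithin] with ε hε
    have h0 : ∫ t : Icc (0 : ℝ) T, rampDeriv ε s t * g t ∂leb T = 0 := by
      have hae : ∀ᵐ t ∂leb T, t ≠ s := by
        have hz : leb T {s} = 0 := by
          rw [leb, (MeasurableEmbedding.subtype_coe measurableSet_Icc).comap_apply]
          simp
        exact measure_eq_zero_iff_ae_notMem.1 hz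
      refine integral_eq_zero_of_ae ?_
      filter_upwards [hae] with t ht
      have : (t : ℝ) < s := lt_of_le_of_ne (t.2.2.trans_eq hsT.symm) fun h => ht (Subtype.ext h)
      rw [rampDeriv_eq_zero_of_lt hε this, zero_mul, Pi.zero_apply]
    rw [h0, ramp_eq_zero hε hsT.ge, ramp_eq_zero hε s.2.1]
    simp
  · rw [Metric.tendsto_nhds]
    intro η hη
    have hη2 : 0 < η / 2 := half_pos hη
    obtain ⟨δ, hδ, hδg⟩ := Metric.continuousWithinAt_iff.1 hs (η / 2) hη2
    have hmem : Ioo (0 : ℝ) (min δ (T - s)) ∈ 𝓝[>] (0 : ℝ) :=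
      Ioo_mem_nhdsGT (lt_min hδ (sub_pos.2 hsT))
    filter_upwards [hmem] with ε hε
    have hε0 : 0 < ε := hε.1
    have hεδ : ε < δ := hε.2.trans_le (min_le_left _ _)
    have hεT : ε < T - s := hε.2.trans_le (min_le_right _ _)
    have r1 : ramp ε s T = 1 := ramp_eq_one hε0 (by linarith)
    have r0 : ramp ε s 0 = 0 := ramp_eq_zero hε0 s.2.1
    have hi1 : ∫ t : Icc (0 : ℝ) T, rampDeriv ε s t ∂leb T = 1 := by
      rw [integral_rampDeriv hT, r1, r0, sub_zero]
    have hri := ContinuousOn.integrable_leb (T := T) (continuous_rampDeriv ε s).continuousOn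
    have hdiff : (∫ t : Icc (0 : ℝ) T, rampDeriv ε s t * g t ∂leb T) - g s =
        ∫ t : Icc (0 : ℝ) T, rampDeriv ε s t * (g t - g s) ∂leb T := by
      simp_rw [mul_sub]
      rw [integral_sub (hgi ε) (hri.mul_const _), integral_mul_const, hi1, one_mul]
    have hbound : |(∫ t : Icc (0 : ℝ) T, rampDeriv ε s t * g t ∂leb T) - g s| ≤ η / 2 := by
      rw [hdiff]
      calc |∫ t : Icc (0 : ℝ) T, rampDeriv ε s t * (g t - g s) ∂leb T|
          ≤ ∫ t : Icc (0 : ℝ) T, rampDeriv ε s t * (η / 2) ∂leb T := by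
            rw [← Real.norm_eq_abs]
            refine norm_integral_le_of_norm_le (hri.mul_const _) (ae_of_all _ fun t => ?_)
            rw [norm_mul, Real.norm_of_nonneg (rampDeriv_nonneg hε0 _ _)]
            by_cases h1 : (t : ℝ) < s
            · rw [rampDeriv_eq_zero_of_lt hε0 h1]; simp
            by_cases h2 : (s : ℝ) + ε < t
            · rw [rampDeriv_eq_zero_of_gt hε0 h2]; simp
            refine mul_le_mul_of_nonneg_left ?_ (rampDeriv_nonneg hε0 _ _)
            have hts : dist t s < δ := by
              rw [Subtype.dist_eq, Real.dist_eq, abs_of_nonneg (by linarith)]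
              linarith
            exact (hδg (x := t) (show s ≤ t from not_lt.1 h1) hts).le
        _ = η / 2 := by rw [integral_mul_const, hi1, one_mul]
    rw [r1, r0, Real.dist_eq]
    have := abs_le.1 hbound
    rw [abs_lt]
    constructor <;> linarith

theorem leb_real_Icc_le (a b : ℝ) (hab : a ≤ b) :
    (leb T).real {t | a ≤ (t : ℝ) ∧ (t : ℝ) ≤ b} ≤ b - a := by
  refine ENNReal.toReal_le_of_le_ofReal (by linarith) ?_
  rw [leb, (MeasurableEmbedding.subtype_coe measurableSet_Icc).comap_apply, ← Real.volume_Icc]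
  refine measure_mono ?_
  rintro _ ⟨t, ht, rfl⟩
  exact ht

theorem SkorohodPath.measurable_coef (hT : 0 < T) (π : MPath T) (n : ℕ) :
    Measurable fun t => (π t).coef n := π.measurable_pairing hT _

theorem SkorohodPath.rightCont_coef (π : MPath T) (n : ℕ) (t : Icc (0 : ℝ) T) :
    ContinuousWithinAt (fun t => (π t).coef n) (Ici t) t :=
  (SubMeasure.continuous_pairing _).continuousAt.comp_continuousWithinAt (π.right_continuous t)

/-- The constant in the modulus of continuity of `coef n` along a path of finite rate. -/
def modConst (A B : ℝ) (n : ℕ) (Λ : ℝ) : ℝ :=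
  (n * Real.pi) ^ 2 * Λ + 1 / 8 * (n * Real.pi * Λ) ^ 2 + (1 / A + 1 / B) * Real.exp Λ

/-- Test with l θ(t) cos(nπx). Diffusion, mobility and boundary terms are each at most a constant
times the length of the support of θ; the time terms converge to the increment as the ramps steepen.
-/
theorem mul_coef_sub_le {α A β B : ℝ} (hα : α ∈ Icc (0 : ℝ) 1) (hβ : β ∈ Icc (0 : ℝ) 1)
    (hA : 0 < A) (hB : 0 < B) {hT : 0 < T} {π : MPath T} {q : ℝ} (h : rate α A β B hT π ≤ q)
    (n : ℕ) {l Λ : ℝ} (hl : |l| = Λ) {s t : Icc (0 : ℝ) T} (hst : s ≤ t) :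
    l * ((π t).coef n - (π s).coef n) ≤ q + modConst A B n Λ * (t - s) := by
  obtain ⟨⟨hπ, -⟩, hJ⟩ := isAC_and_JReal_le_of_rate_le h
  set g : Icc (0 : ℝ) T → ℝ := fun t => (π t).coef n with hg
  have hgm : Measurable g := π.measurable_coef hT n
  have hg1 : ∀ t, |g t| ≤ 1 := fun t => (π t).abs_coef_le n
  have hst' : (s : ℝ) ≤ t := hst
  have hΛ : 0 ≤ Λ := hl ▸ abs_nonneg l
  have key : ∀ ε > 0, l * ((ramp ε s T * g (timeEnd hT) - ramp ε s 0 * g (timeZero hT) -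
      ∫ r : Icc (0 : ℝ) T, rampDeriv ε s r * g r ∂leb T) -
      (ramp ε t T * g (timeEnd hT) - ramp ε t 0 * g (timeZero hT) -
      ∫ r : Icc (0 : ℝ) T, rampDeriv ε t r * g r ∂leb T)) ≤
        q + modConst A B n Λ * (t + ε - s) := by
    intro ε hε
    -- A smooth substitute for the indicator of [s,t], with values in [0,1] and zero off [s, t + ε].
    let θ : ℝ → ℝ := fun r => ramp ε s r - ramp ε t r
    have hθ0 : ∀ r, 0 ≤ θ r := fun r => sub_nonneg.2 (ramp_antitone hε hst')
    have hθ1 : ∀ r, θ r ≤ 1 := fun r => by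
      have := (ramp_mem ε s r).2; have := (ramp_mem ε t r).1; simp only [θ]; linarith
    let E : Set (Icc (0 : ℝ) T) := {r | (s : ℝ) ≤ r ∧ (r : ℝ) ≤ t + ε}
    have hE : MeasurableSet E :=
      (measurableSet_le measurable_const measurable_subtype_coe).inter
        (measurableSet_le measurable_subtype_coe measurable_const)
    have hθE : ∀ r : Icc (0 : ℝ) T, r ∉ E → θ r = 0 := by
      intro r hr
      by_cases h1 : (s : ℝ) ≤ r
      · have h2 : (t : ℝ) + ε < r := by
          by_contra h2; exact hr ⟨h1, not_lt.1 h2⟩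
        simp only [θ]
        rw [ramp_eq_one hε (by linarith), ramp_eq_one hε h2.le, sub_self]
      · simp only [θ]
        rw [ramp_eq_zero hε (by linarith), ramp_eq_zero hε (by linarith), sub_self]
    have hEint : ∀ c : ℝ, 0 ≤ c → ∫ r, E.indicator (fun _ => c) r ∂leb T ≤ c * (t + ε - s) := by
      intro c hc
      rw [integral_indicator_const _ hE, smul_eq_mul, mul_comm]
      exact mul_le_mul_of_nonneg_left (leb_real_Icc_le _ _ (by linarith)) hc
    have hEi : ∀ c : ℝ, Integrable (E.indicator fun _ => c) (leb T) := fun c =>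
      (integrable_const c).indicator hE
    have hE0 : ∀ c : ℝ, 0 ≤ c → ∀ r, 0 ≤ E.indicator (fun _ => c) r := fun c hc r =>
      indicator_nonneg (fun _ _ => hc) r
    have hle : ∀ (c : ℝ) (f : Icc (0 : ℝ) T → ℝ), (∀ r ∉ E, f r = 0) → (∀ r, f r ≤ c) →
        ∀ r, f r ≤ E.indicator (fun _ => c) r := by
      intro c f h0 h1 r
      by_cases hr : r ∈ E
      · rw [indicator_of_mem hr]; exact h1 r
      · rw [indicator_of_notMem hr, h0 r hr]
    have ha : ∀ _ : ℕ, ∀ r ∈ Icc 0 T, HasDerivWithinAt (fun r => l * θ r)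
        (l * (rampDeriv ε s r - rampDeriv ε t r)) (Icc 0 T) r := fun _ r _ =>
      (((hasDerivAt_ramp ε s r).sub (hasDerivAt_ramp ε t r)).const_mul l).hasDerivWithinAt
    have ha' : ∀ _ : ℕ, ContinuousOn (fun r => l * (rampDeriv ε s r - rampDeriv ε t r))
        (Icc 0 T) := fun _ =>
      (continuous_const.mul ((continuous_rampDeriv ε s).sub (continuous_rampDeriv ε t))).continuousOn
    have hABpos : 0 ≤ (1 / A + 1 / B) * Real.exp Λ := by positivity
    have hcos : ∀ (r x : ℝ), |l * θ r * Real.cos (n * Real.pi * x)| ≤ Λ := by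
      intro r x
      rw [abs_mul, abs_mul, hl, abs_of_nonneg (hθ0 r)]
      have h1 := Real.abs_cos_le_one (n * Real.pi * x)
      have h2 := hθ1 r
      have h3 := hθ0 r
      calc Λ * θ r * |Real.cos (n * Real.pi * x)| ≤ Λ * 1 * 1 := by gcongr
        _ = Λ := by ring
    have hJ1 := le_JReal_cosTest α A β B hT hπ {n} (fun _ r => l * θ r)
      (fun _ r => l * (rampDeriv ε s r - rampDeriv ε t r)) ha ha'
      (b := E.indicator fun _ => (1 / A + 1 / B) * Real.exp Λ) (hEi _) (hE0 _ hABpos) (by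
        refine hle _ _ (fun r hr => ?_) fun r => ?_
        · simp [cosTest, hθE r hr, bdry_zero]
        · simp only [cosTest, Finset.sum_singleton]
          rw [add_mul]
          exact add_le_add (bdry_le hα hA (contValue_mem (hπ r) _) (hcos r 0))
            (bdry_le hβ hB (contValue_mem (hπ r) _) (hcos r 1)))
    have hJ2 := hJ1.trans (hJ _)
    simp only [Finset.sum_singleton] at hJ2
    have i1 : ∫ r : Icc (0 : ℝ) T, l * (rampDeriv ε s r - rampDeriv ε t r) * g r ∂leb T =
        l * ((∫ r : Icc (0 : ℝ) T, rampDeriv ε s r * g r ∂leb T) -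
          ∫ r : Icc (0 : ℝ) T, rampDeriv ε t r * g r ∂leb T) := by
      have hi : ∀ v : ℝ, Integrable (fun r : Icc (0 : ℝ) T => rampDeriv ε v r * g r) (leb T) :=
        fun v => (ContinuousOn.integrable_leb (continuous_rampDeriv ε v).continuousOn).mul_bdd
          (c := 1) hgm.aestronglyMeasurable (ae_of_all _ hg1)
      rw [← integral_sub (hi _) (hi _), ← integral_const_mul]
      refine integral_congr_ae (ae_of_all _ fun r => ?_)
      simp only; ring
    have hg1' : ∀ r, |(π r).coef n| ≤ 1 := hg1
    have hnl : 0 ≤ (n * Real.pi) ^ 2 * Λ := by positivity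
    have i2 : -((n * Real.pi) ^ 2 * Λ * (t + ε - s)) ≤
        ∫ r : Icc (0 : ℝ) T, (n * Real.pi) ^ 2 * (l * θ r) * (π r).coef n ∂leb T := by
      rw [neg_le, ← integral_neg]
      refine le_trans (integral_le_integral_of_le (hEi ((n * Real.pi) ^ 2 * Λ)) (hE0 _ hnl)
        (ae_of_all _ (hle _ _ (fun r hr => by simp [hθE r hr]) fun r => ?_))) (hEint _ hnl)
      refine (neg_le_abs _).trans ?_
      rw [abs_mul, abs_mul, abs_mul, hl, abs_of_nonneg (hθ0 r), abs_of_nonneg (sq_nonneg _)]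
      have h2 := hθ1 r
      have h3 := hθ0 r
      have h4 := hg1' r
      calc (n * Real.pi) ^ 2 * (Λ * θ r) * |(π r).coef n| ≤ (n * Real.pi) ^ 2 * (Λ * 1) * 1 := by
            gcongr
        _ = _ := by ring
    have hnl2 : 0 ≤ 1 / 8 * (n * Real.pi * Λ) ^ 2 := by positivity
    have i3 : ∫ r : Icc (0 : ℝ) T, 1 / 8 * (n * Real.pi * (l * θ r)) ^ 2 ∂leb T ≤
        1 / 8 * (n * Real.pi * Λ) ^ 2 * (t + ε - s) := by
      refine le_trans (integral_le_integral_of_le (hEi (1 / 8 * (n * Real.pi * Λ) ^ 2))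
        (hE0 _ hnl2) (ae_of_all _ (hle _ _ (fun r hr => by simp [hθE r hr]) fun r => ?_)))
        (hEint _ hnl2)
      have h2 := hθ1 r
      have h3 := hθ0 r
      have h5 : (n * Real.pi * (l * θ r)) ^ 2 = (n * Real.pi * (Λ * θ r)) ^ 2 := by
        rw [← hl, mul_pow, mul_pow, mul_pow l, mul_pow (n * Real.pi), mul_pow |l|, sq_abs]
        ring
      rw [h5]
      calc 1 / 8 * (n * Real.pi * (Λ * θ r)) ^ 2 ≤ 1 / 8 * (n * Real.pi * (Λ * 1)) ^ 2 := by gcongr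
        _ = _ := by ring
    have i4 := hEint _ hABpos
    have i1' : ∫ r : Icc (0 : ℝ) T, l * (rampDeriv ε s r - rampDeriv ε t r) * (π r).coef n ∂leb T =
        l * ((∫ r : Icc (0 : ℝ) T, rampDeriv ε s r * g r ∂leb T) -
          ∫ r : Icc (0 : ℝ) T, rampDeriv ε t r * g r ∂leb T) := i1
    rw [i1'] at hJ2
    simp only [θ] at hJ2 i2 i3
    unfold modConst
    simp only [hg] at hJ2 ⊢
    linarith
  have hlim1 := tendsto_ramp_increment hT hgm hg1 s (π.rightCont_coef n s)
  have hlim2 := tendsto_ramp_increment hT hgm hg1 t (π.rightCont_coef n t)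
  have hlim3 : Tendsto (fun ε : ℝ => q + modConst A B n Λ * (t + ε - s)) (𝓝[>] 0)
      (𝓝 (q + modConst A B n Λ * (t + 0 - s))) := by
    refine Tendsto.mono_left ?_ nhdsWithin_le_nhds
    exact Continuous.tendsto (by fun_prop) 0
  have := le_of_tendsto_of_tendsto ((hlim1.sub hlim2).const_mul l) hlim3
    (by filter_upwards [self_mem_nhdsWithin] with ε hε using key ε hε)
  rw [add_zero] at this
  simp only [hg] at this
  linarith

theorem coef_equicontinuous {α A β B : ℝ} (hα : α ∈ Icc (0 : ℝ) 1) (hβ : β ∈ Icc (0 : ℝ) 1)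
    (hA : 0 < A) (hB : 0 < B) (hT : 0 < T) (q : ℝ) (n : ℕ) {η : ℝ} (hη : 0 < η) :
    ∃ δ > 0, ∀ π : MPath T, rate α A β B hT π ≤ q → ∀ s t : Icc (0 : ℝ) T, |(s : ℝ) - t| < δ →
      |(π s).coef n - (π t).coef n| < η := by
  -- With Λη = 2(|q| + 1) and a time step that makes the modulus term less than 1, the bound q + 1
  -- on Λ times the increment falls below Λη. Both signs of the multiplier are used.
  set Λ : ℝ := 2 * (|q| + 1) / η with hΛdef
  have hΛ : 0 < Λ := by positivity
  have hC : 0 < modConst A B n Λ := by unfold modConst; positivity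
  have hΛη : Λ * η = 2 * (|q| + 1) := by rw [hΛdef]; field_simp
  refine ⟨1 / modConst A B n Λ, by positivity, fun π hπ => ?_⟩
  have main : ∀ s t : Icc (0 : ℝ) T, s ≤ t → (t : ℝ) - s < 1 / modConst A B n Λ →
      |(π s).coef n - (π t).coef n| < η := by
    intro s t hst hd
    rw [lt_div_iff₀ hC] at hd
    have h1 := mul_coef_sub_le hα hβ hA hB hπ n (abs_of_pos hΛ) hst
    have h2 := mul_coef_sub_le hα hβ hA hB hπ n ((abs_neg Λ).trans (abs_of_pos hΛ)) hst
    have h3 := le_abs_self q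
    have h4 := abs_nonneg q
    rw [abs_lt]
    constructor <;> refine lt_of_mul_lt_mul_left ?_ hΛ.le <;> linarith
  intro s t hd
  rcases le_total s t with hst | hst
  · exact main s t hst (by rw [abs_sub_comm] at hd; exact (le_abs_self _).trans_lt hd)
  · rw [abs_sub_comm]
    exact main t s hst ((le_abs_self _).trans_lt hd)

/-! ### The energy estimate -/

theorem continuous_coef_of_rate_le {α A β B : ℝ} (hα : α ∈ Icc (0 : ℝ) 1)
    (hβ : β ∈ Icc (0 : ℝ) 1) (hA : 0 < A) (hB : 0 < B) {hT : 0 < T} {π : MPath T} {q : ℝ}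
    (h : rate α A β B hT π ≤ q) (n : ℕ) : Continuous fun t => (π t).coef n := by
  refine Metric.continuous_iff.2 fun t η hη => ?_
  obtain ⟨δ, hδ, H⟩ := coef_equicontinuous hα hβ hA hB hT q n hη
  exact ⟨δ, hδ, fun s hs => H π h s t hs⟩

/-- The Steklov average `ε⁻¹ ∫ₜᵗ⁺ᵉ f`. -/
def steklov (ε : ℝ) (f : ℝ → ℝ) (t : ℝ) : ℝ :=
  ((∫ r in (0)..(t + ε), f r) - ∫ r in (0)..t, f r) / ε

theorem hasDerivAt_primitive {f : ℝ → ℝ} (hf : Continuous f) (t : ℝ) :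
    HasDerivAt (fun t => ∫ r in (0)..t, f r) (f t) t :=
  (hf.integral_hasStrictDerivAt 0 t).hasDerivAt

theorem hasDerivAt_steklov (ε : ℝ) {f : ℝ → ℝ} (hf : Continuous f) (t : ℝ) :
    HasDerivAt (steklov ε f) ((f (t + ε) - f t) / ε) t :=
  (((hasDerivAt_primitive hf (t + ε)).comp_add_const t ε).sub
    (hasDerivAt_primitive hf t)).div_const ε

/-- Mean value theorem for the primitive. Every pointwise bound on f thereby transfers to its
averages. -/
theorem exists_steklov_eq {ε : ℝ} (hε : 0 < ε) {f : ℝ → ℝ} (hf : Continuous f) (t : ℝ) :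
    ∃ r ∈ Ioo t (t + ε), steklov ε f t = f r := by
  obtain ⟨r, hr, h⟩ := exists_hasDerivAt_eq_slope (fun t => ∫ r in (0)..t, f r) f
    (show t < t + ε by linarith)
    (fun x _ => (hasDerivAt_primitive hf x).continuousAt.continuousWithinAt)
    fun x _ => hasDerivAt_primitive hf x
  refine ⟨r, hr, ?_⟩
  rw [h, steklov, add_sub_cancel_left]

theorem steklov_sum (ε : ℝ) (s : Finset ℕ) {f : ℕ → ℝ → ℝ} (hf : ∀ n, Continuous (f n))
    (b : ℕ → ℝ) (t : ℝ) :
    ∑ n ∈ s, steklov ε (f n) t * b n = steklov ε (fun r => ∑ n ∈ s, f n r * b n) t := by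
  have hi : ∀ (a b' : ℝ) (n : ℕ), n ∈ s → IntervalIntegrable (fun r => f n r * b n) volume a b' :=
    fun a b' n _ => ((hf n).mul continuous_const).intervalIntegrable _ _
  unfold steklov
  rw [intervalIntegral.integral_finsetSum (hi _ _), intervalIntegral.integral_finsetSum (hi _ _),
    ← Finset.sum_sub_distrib,
    Finset.sum_div]
  refine Finset.sum_congr rfl fun n _ => ?_
  rw [intervalIntegral.integral_mul_const, intervalIntegral.integral_mul_const]
  ring

theorem tendsto_steklov {f : ℝ → ℝ} (hf : Continuous f) (t : ℝ) :
    Tendsto (fun ε => steklov ε f t) (𝓝[>] 0) (𝓝 (f t)) := by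
  rw [Metric.tendsto_nhds]
  intro η hη
  obtain ⟨δ, hδ, h⟩ := Metric.continuous_iff.1 hf t η hη
  filter_upwards [Ioo_mem_nhdsGT hδ] with ε hε
  obtain ⟨r, hr, hr'⟩ := exists_steklov_eq hε.1 hf t
  rw [hr']
  refine h r ?_
  rw [Real.dist_eq, abs_of_pos (by linarith [hr.1])]
  linarith [hr.2, hε.2]

/-- A discrete form of f′f = (f²)′/2: from (b − a)a ≤ (b² − a²)/2 the integral telescopes to an
average of f² over [T, T + ε], where f is constant, minus a nonnegative initial part. -/
theorem integral_mul_increment_le (hT : 0 < T) {f : ℝ → ℝ} (hf : Continuous f)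
    (hfT : ∀ t, T ≤ t → f t = f T) {ε : ℝ} (hε : 0 < ε) :
    ∫ t in (0)..T, (f (t + ε) - f t) / ε * f t ≤ 1 / 2 * f T ^ 2 := by
  have h1 : ∫ t in (0)..T, (f (t + ε) - f t) / ε * f t ≤
      ∫ t in (0)..T, (1 / (2 * ε)) * (f (t + ε) ^ 2 - f t ^ 2) := by
    refine intervalIntegral.integral_mono_on hT.le (Continuous.intervalIntegrable (by fun_prop) _ _)
      (Continuous.intervalIntegrable (by fun_prop) _ _) fun t _ => ?_
    have : (1 / (2 * ε)) * (f (t + ε) ^ 2 - f t ^ 2) - (f (t + ε) - f t) / ε * f t =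
        (1 / (2 * ε)) * (f (t + ε) - f t) ^ 2 := by field_simp; ring
    have h2 : 0 ≤ (1 / (2 * ε)) * (f (t + ε) - f t) ^ 2 := by positivity
    linarith
  have hi : ∀ a b, IntervalIntegrable (fun t => f t ^ 2) volume a b := fun a b =>
    Continuous.intervalIntegrable (by fun_prop) _ _
  have h2 : ∫ t in (0)..T, (f (t + ε) ^ 2 - f t ^ 2) ≤ ε * f T ^ 2 := by
    rw [intervalIntegral.integral_sub (Continuous.intervalIntegrable (by fun_prop) _ _) (hi _ _),
      intervalIntegral.integral_comp_add_right (fun t => f t ^ 2) ε, zero_add]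
    have e1 := intervalIntegral.integral_add_adjacent_intervals (hi ε T) (hi T (T + ε))
    have e2 := intervalIntegral.integral_add_adjacent_intervals (hi 0 ε) (hi ε T)
    have e3 : ∫ t in T..(T + ε), f t ^ 2 = ε * f T ^ 2 := by
      rw [intervalIntegral.integral_congr (g := fun _ => f T ^ 2) fun t ht => ?_]
      · simp
      · rw [uIcc_of_le (by linarith)] at ht
        simp only [hfT t ht.1]
    have e4 : 0 ≤ ∫ t in (0)..ε, f t ^ 2 :=
      intervalIntegral.integral_nonneg hε.le fun t _ => sq_nonneg _
    linarith
  rw [intervalIntegral.integral_const_mul] at h1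
  refine h1.trans ?_
  calc 1 / (2 * ε) * ∫ t in (0)..T, (f (t + ε) ^ 2 - f t ^ 2) ≤ 1 / (2 * ε) * (ε * f T ^ 2) := by
        gcongr
    _ = _ := by field_simp

/-- The bound on the energy at level `q` of the rate functional. -/
def energyConst (A B T q : ℝ) : ℝ := 4 / 3 * (q + 3 / 2 + T * ((1 / A + 1 / B) * Real.exp 1))

/-- Test with the regularised density Σ f_n S_ε c_n(t) cos(nπx), where f_n are Fejér weights and S_ε
is the Steklov average. The terminal term is nonnegative; the initial one costs 1, the time
derivative 1/2 and the boundary T(1/A + 1/B)e. As ε → 0 the diffusion term minus the mobility term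
remains, and it controls the energy. -/
theorem fourier_energy_le {α A β B : ℝ} (hα : α ∈ Icc (0 : ℝ) 1)
    (hβ : β ∈ Icc (0 : ℝ) 1) (hA : 0 < A) (hB : 0 < B) {hT : 0 < T} {π : MPath T} {q : ℝ}
    (h : rate α A β B hT π ≤ q) (M : ℕ) :
    ∫ t, ∑ n ∈ Finset.range M, (n * Real.pi * (π t).coef n) ^ 2 ∂leb T ≤ energyConst A B T q := by
  obtain ⟨⟨hπ, -⟩, hJ⟩ := isAC_and_JReal_le_of_rate_le h
  have hcont := continuous_coef_of_rate_le hα hβ hA hB h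
  -- At twice the needed order, the Fejér weights 2(1 − n/N) are at least 1 for 0 < n < M.
  set N := 2 * (M + 1) with hNdef
  have hN : 0 < N := by omega
  -- Constant extension beyond T lets the forward averages make sense up to time T.
  let c : ℕ → ℝ → ℝ := fun n => IccExtend hT.le fun t => (π t).coef n
  have hc : ∀ n, Continuous (c n) := fun n => (hcont n).Icc_extend'
  have hcπ : ∀ n (t : Icc (0 : ℝ) T), c n t = (π t).coef n := fun n t => IccExtend_val ..
  have hcT : ∀ n t, T ≤ t → c n t = c n T := fun n t ht => by
    simp only [c, IccExtend_of_right_le hT.le _ ht, IccExtend_of_right_le hT.le _ le_rfl]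
  have hc1 : ∀ n r, |c n r| ≤ 1 := fun n r => (π _).abs_coef_le n
  have hF : ∀ r x, fejerSum N (fun n => c n r) x ∈ Icc (0 : ℝ) 1 := fun r x =>
    (hπ (projIcc 0 T hT.le r)).fejerSum_mem hN x
  let K := (1 / A + 1 / B) * Real.exp 1
  have hK : 0 ≤ K := by positivity
  let f := fejerCoef N
  have hf0 : ∀ n ∈ Finset.range N, 0 ≤ f n := fun n hn => fejerCoef_nonneg (Finset.mem_range.1 hn)
  have key : ∀ ε > 0,
      (∫ t : Icc (0 : ℝ) T, ∑ n ∈ Finset.range N,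
        (n * Real.pi) ^ 2 * (f n * steklov ε (c n) t) * (π t).coef n ∂leb T) -
      (∫ t : Icc (0 : ℝ) T, 1 / 8 * ∑ n ∈ Finset.range N,
        (n * Real.pi * (f n * steklov ε (c n) t)) ^ 2 ∂leb T) ≤ q + 3 / 2 + T * K := by
    intro ε hε
    have ha : ∀ n, ∀ t ∈ Icc 0 T, HasDerivWithinAt (fun t => f n * steklov ε (c n) t)
        (f n * ((c n (t + ε) - c n t) / ε)) (Icc 0 T) t := fun n t _ =>
      ((hasDerivAt_steklov ε (hc n) t).const_mul (f n)).hasDerivWithinAt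
    have ha' : ∀ n, ContinuousOn (fun t => f n * ((c n (t + ε) - c n t) / ε)) (Icc 0 T) := by
      intro n
      have := hc n
      exact Continuous.continuousOn (by fun_prop)
    -- The test function is a time average of Fejér means of the density, hence stays in [0,1]; this
    -- keeps the exponentials at the boundary below e.
    have hH : ∀ t x, ∑ n ∈ Finset.range N, f n * steklov ε (c n) t * Real.cos (n * Real.pi * x) ∈
        Icc (0 : ℝ) 1 := by
      intro t x
      have e1 : ∑ n ∈ Finset.range N, f n * steklov ε (c n) t * Real.cos (n * Real.pi * x) =
          steklov ε (fun r => fejerSum N (fun n => c n r) x) t := by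
        have := steklov_sum ε (Finset.range N) hc (fun n => f n * Real.cos (n * Real.pi * x)) t
        have e2 : (fun r => fejerSum N (fun n => c n r) x) =
            fun r => ∑ n ∈ Finset.range N, c n r * (f n * Real.cos (n * Real.pi * x)) := by
          funext r
          exact Finset.sum_congr rfl fun n _ => by simp only [f]; ring
        rw [e2, ← this]
        exact Finset.sum_congr rfl fun n _ => by ring
      have hcF : Continuous fun r => fejerSum N (fun n => c n r) x := by
        unfold fejerSum
        exact continuous_finsetSum _ fun n _ => (continuous_const.mul (hc n)).mul continuous_const
      obtain ⟨r, -, hr⟩ := exists_steklov_eq hε hcF t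
      rw [e1, hr]
      exact hF r x
    have hJ1 := (le_JReal_cosTest α A β B hT hπ (Finset.range N)
      (fun n t => f n * steklov ε (c n) t) (fun n t => f n * ((c n (t + ε) - c n t) / ε)) ha ha'
      (b := fun _ => K) (integrable_const _) (fun _ => hK) (by
        intro t
        have h0 := hH t 0
        have h1 := hH t 1
        simp only [cosTest, K]
        rw [add_mul]
        exact add_le_add
          (bdry_le hα hA (contValue_mem (hπ t) _) (abs_le.2 ⟨by linarith [h0.1], h0.2⟩))
          (bdry_le hβ hB (contValue_mem (hπ t) _) (abs_le.2 ⟨by linarith [h1.1], h1.2⟩)))).trans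
      (hJ _)
    -- The average starting at T sees only the constant extension, so each summand is a nonnegative
    -- weight times a square.
    have i1 : 0 ≤ ∑ n ∈ Finset.range N, f n * steklov ε (c n) T * (π (timeEnd hT)).coef n := by
      refine Finset.sum_nonneg fun n hn => ?_
      obtain ⟨r, hr, hr'⟩ := exists_steklov_eq hε (hc n) T
      rw [hr', hcT n r hr.1.le, show c n T = (π (timeEnd hT)).coef n from hcπ n (timeEnd hT),
        mul_assoc]
      exact mul_nonneg (hf0 n hn) (mul_self_nonneg _)
    have i2 : ∑ n ∈ Finset.range N, f n * steklov ε (c n) 0 * (π (timeZero hT)).coef n ≤ 1 := by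
      rw [← (hπ (timeZero hT)).integral_density_mul_cos_sum]
      refine (le_abs_self _).trans ((SubMeasure.abs_integral_density_mul_le (hπ _)
        (integrable_of_continuous (by fun_prop))).trans ?_)
      calc ∫ x : unitInterval, |∑ n ∈ Finset.range N,
            f n * steklov ε (c n) 0 * Real.cos (n * Real.pi * x)| ≤ ∫ x : unitInterval, (1 : ℝ) := by
            refine integral_le_integral_of_le (integrable_const _) (fun _ => zero_le_one)
              (ae_of_all _ fun x => ?_)
            rw [abs_of_nonneg (hH 0 x).1]
            exact (hH 0 x).2
        _ = 1 := by simp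
    have i3 : ∫ t : Icc (0 : ℝ) T, ∑ n ∈ Finset.range N,
        f n * ((c n (t + ε) - c n t) / ε) * (π t).coef n ∂leb T ≤ 1 / 2 := by
      have e1 : ∀ t : Icc (0 : ℝ) T, ∑ n ∈ Finset.range N,
          f n * ((c n (t + ε) - c n t) / ε) * (π t).coef n =
          ∑ n ∈ Finset.range N, f n * ((c n (t + ε) - c n t) / ε * c n t) := by
        intro t
        exact Finset.sum_congr rfl fun n _ => by rw [hcπ, mul_assoc]
      simp_rw [e1]
      rw [integral_leb hT fun t => ∑ n ∈ Finset.range N, f n * ((c n (t + ε) - c n t) / ε * c n t),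
        intervalIntegral.integral_finsetSum fun n _ => Continuous.intervalIntegrable
          (by have := hc n; fun_prop) _ _]
      calc ∑ n ∈ Finset.range N, ∫ t in (0)..T, f n * ((c n (t + ε) - c n t) / ε * c n t)
          ≤ ∑ n ∈ Finset.range N, 1 / 2 * (f n * (π (timeEnd hT)).coef n ^ 2) := by
            refine Finset.sum_le_sum fun n hn => ?_
            rw [intervalIntegral.integral_const_mul]
            have := integral_mul_increment_le hT (hc n) (hcT n) hε
            rw [show c n T = (π (timeEnd hT)).coef n from hcπ n (timeEnd hT)] at this
            have := mul_le_mul_of_nonneg_left this (hf0 n hn)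
            linarith
        _ ≤ 1 / 2 := by
            rw [← Finset.mul_sum]
            have := (hπ (timeEnd hT)).sum_fejerCoef_mul_sq_le hN
            linarith
    have i4 : ∫ _ : Icc (0 : ℝ) T, K ∂leb T = T * K := by
      rw [integral_const, leb_real_univ hT, smul_eq_mul]
    rw [i4] at hJ1
    linarith
  have hst1 : ∀ n, ∀ ε > 0, ∀ t, |f n * steklov ε (c n) t| ≤ |f n| := by
    intro n ε hε t
    obtain ⟨r, -, hr⟩ := exists_steklov_eq hε (hc n) t
    rw [hr, abs_mul]
    exact mul_le_of_le_one_right (abs_nonneg _) (hc1 n r)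
  have hsc : ∀ n ε, Continuous fun t : Icc (0 : ℝ) T => steklov ε (c n) t := fun n ε =>
    (continuous_iff_continuousAt.2 fun t => (hasDerivAt_steklov ε (hc n) t).continuousAt).comp
      continuous_subtype_val
  have lim1 : Tendsto (fun ε => ∫ t : Icc (0 : ℝ) T, ∑ n ∈ Finset.range N,
        (n * Real.pi) ^ 2 * (f n * steklov ε (c n) t) * (π t).coef n ∂leb T) (𝓝[>] 0)
      (𝓝 (∫ t : Icc (0 : ℝ) T, ∑ n ∈ Finset.range N,
        (n * Real.pi) ^ 2 * (f n * c n t) * (π t).coef n ∂leb T)) := by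
    refine tendsto_integral_filter_of_dominated_convergence
      (fun _ => ∑ n ∈ Finset.range N, (n * Real.pi) ^ 2 * |f n|) (Eventually.of_forall fun ε => ?_)
      ?_ (integrable_const _) (ae_of_all _ fun t => ?_)
    · exact (continuous_finsetSum _ fun n _ => (continuous_const.mul
        (continuous_const.mul (hsc n ε))).mul (hcont n)).aestronglyMeasurable
    · filter_upwards [self_mem_nhdsWithin] with ε hε
      refine ae_of_all _ fun t => (norm_sum_le _ _).trans (Finset.sum_le_sum fun n _ => ?_)
      rw [norm_mul, norm_mul, Real.norm_of_nonneg (sq_nonneg _)]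
      refine (mul_le_of_le_one_right (by positivity) ((π t).abs_coef_le n)).trans ?_
      exact mul_le_mul_of_nonneg_left (hst1 n ε hε t) (sq_nonneg _)
    · exact tendsto_finsetSum _ fun n _ => (((tendsto_steklov (hc n) t).const_mul _).const_mul
        _).mul_const _
  have lim2 : Tendsto (fun ε => ∫ t : Icc (0 : ℝ) T, 1 / 8 * ∑ n ∈ Finset.range N,
        (n * Real.pi * (f n * steklov ε (c n) t)) ^ 2 ∂leb T) (𝓝[>] 0)
      (𝓝 (∫ t : Icc (0 : ℝ) T, 1 / 8 * ∑ n ∈ Finset.range N,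
        (n * Real.pi * (f n * c n t)) ^ 2 ∂leb T)) := by
    refine tendsto_integral_filter_of_dominated_convergence
      (fun _ => 1 / 8 * ∑ n ∈ Finset.range N, (n * Real.pi * |f n|) ^ 2)
      (Eventually.of_forall fun ε => ?_) ?_ (integrable_const _) (ae_of_all _ fun t => ?_)
    · exact (continuous_const.mul (continuous_finsetSum _ fun n _ => (continuous_const.mul
        (continuous_const.mul (hsc n ε))).pow 2)).aestronglyMeasurable
    · filter_upwards [self_mem_nhdsWithin] with ε hε
      refine ae_of_all _ fun t => ?_
      rw [Real.norm_of_nonneg (by positivity)]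
      refine mul_le_mul_of_nonneg_left (Finset.sum_le_sum fun n _ => ?_) (by norm_num)
      rw [mul_pow, mul_pow (n * Real.pi), ← sq_abs (f n * _)]
      have := hst1 n ε hε t
      gcongr
    · exact (tendsto_finsetSum _ fun n _ => (((tendsto_steklov (hc n) t).const_mul _).const_mul
        _).pow 2).const_mul _
  have hlim := le_of_tendsto (lim1.sub lim2)
    (by filter_upwards [self_mem_nhdsWithin] with ε hε using key ε hε)
  rw [← integral_sub] at hlim
  rotate_left
  · exact Continuous.integrable_of_hasCompactSupport (continuous_finsetSum _ fun n _ =>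
      (continuous_const.mul (continuous_const.mul ((hc n).comp continuous_subtype_val))).mul
        (hcont n)) (HasCompactSupport.of_compactSpace _)
  · exact Continuous.integrable_of_hasCompactSupport (continuous_const.mul
      (continuous_finsetSum _ fun n _ => (continuous_const.mul (continuous_const.mul
        ((hc n).comp continuous_subtype_val))).pow 2)) (HasCompactSupport.of_compactSpace _)
  have hfinal : ∫ t, 3 / 4 * ∑ n ∈ Finset.range M, (n * Real.pi * (π t).coef n) ^ 2 ∂leb T ≤
      q + 3 / 2 + T * K := by
    refine le_trans (integral_mono ?_ ?_ fun t => ?_) hlim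
    · exact Continuous.integrable_of_hasCompactSupport (continuous_const.mul
        (continuous_finsetSum _ fun n _ => (continuous_const.mul (hcont n)).pow 2))
        (HasCompactSupport.of_compactSpace _)
    · exact Continuous.integrable_of_hasCompactSupport ((continuous_finsetSum _ fun n _ =>
        (continuous_const.mul (continuous_const.mul ((hc n).comp continuous_subtype_val))).mul
        (hcont n)).sub (continuous_const.mul
        (continuous_finsetSum _ fun n _ => (continuous_const.mul (continuous_const.mul
        ((hc n).comp continuous_subtype_val))).pow 2))) (HasCompactSupport.of_compactSpace _)
    · simp only [hcπ, Finset.mul_sum]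
      rw [← Finset.sum_sub_distrib]
      have hsub : Finset.range M ⊆ Finset.range N := Finset.range_subset_range.2 (by omega)
      -- For 0 ≤ f ≤ 2 one has f − f²/8 ≥ 3f/4.
      have hterm : ∀ n ∈ Finset.range N, 3 / 4 * f n * (n * Real.pi * (π t).coef n) ^ 2 ≤
          (n * Real.pi) ^ 2 * (f n * (π t).coef n) * (π t).coef n -
            1 / 8 * (n * Real.pi * (f n * (π t).coef n)) ^ 2 := by
        intro n hn
        have h2 : f n ≤ 2 := fejerCoef_le N n
        have h3 : 0 ≤ f n * (2 - f n) * (n * Real.pi * (π t).coef n) ^ 2 :=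
          mul_nonneg (mul_nonneg (hf0 n hn) (by linarith)) (sq_nonneg _)
        nlinarith
      refine le_trans ?_ (Finset.sum_le_sum hterm)
      refine le_trans (Finset.sum_le_sum fun n hn => ?_) (Finset.sum_le_sum_of_subset_of_nonneg hsub
        fun n hn _ => mul_nonneg (mul_nonneg (by norm_num) (hf0 n hn)) (sq_nonneg _))
      rcases eq_or_ne n 0 with rfl | hn0
      · simp
      · have hnM : (n : ℝ) < M := by exact_mod_cast Finset.mem_range.1 hn
        have hf1 : 1 ≤ f n := by
          have hle : (n : ℝ) / (N : ℝ) ≤ 1 / 2 := by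
            rw [hNdef, div_le_iff₀ (by positivity)]
            push_cast
            linarith
          simp only [f, fejerCoef, cosWeight_of_ne hn0]
          linarith
        have := mul_le_mul_of_nonneg_right hf1 (sq_nonneg (n * Real.pi * (π t).coef n))
        linarith
  rw [integral_const_mul] at hfinal
  unfold energyConst
  simp only [K] at hfinal
  linarith

/-! ### Consequences of the energy estimate -/

/-- The cosine form of the bound `∫₀ᵀ ∫₀¹ |∇u|² ≤ 2C`. -/
def FourierEnergyLe (π : MPath T) (C : ℝ) : Prop :=
  ∀ M, ∫ t, ∑ n ∈ Finset.range M, (n * Real.pi * (π t).coef n) ^ 2 ∂leb T ≤ C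

theorem integrable_coef_poly (hT : 0 < T) (π : MPath T) (n : ℕ) :
    Integrable (fun t => (n * Real.pi * (π t).coef n) ^ 2) (leb T) := by
  refine Integrable.of_bound
    (((π.measurable_coef hT n).const_mul _).pow_const 2).aestronglyMeasurable
    ((n * Real.pi * 1) ^ 2) (ae_of_all _ fun t => ?_)
  rw [Real.norm_of_nonneg (sq_nonneg _), mul_pow, mul_pow _ (1 : ℝ), ← sq_abs ((π t).coef n)]
  have := (π t).abs_coef_le n
  gcongr

/-- Monotone convergence on the partial sums in [0,∞]; the total is integrable, hence finite at
almost every time. -/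
theorem FourierEnergyLe.exists_hasSum (hT : 0 < T) {π : MPath T} {C : ℝ}
    (h : FourierEnergyLe π C) :
    ∃ e : Icc (0 : ℝ) T → ℝ, Integrable e (leb T) ∧ (∀ t, 0 ≤ e t) ∧ ∫ t, e t ∂leb T ≤ C ∧
      ∀ᵐ t ∂leb T, HasSum (fun n : ℕ => (n * Real.pi * (π t).coef n) ^ 2) (e t) := by
  have hC : 0 ≤ C := by simpa using h 0
  let E : Icc (0 : ℝ) T → ℝ≥0∞ :=
    fun t => ∑' n : ℕ, ENNReal.ofReal ((n * Real.pi * (π t).coef n) ^ 2)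
  have hm : ∀ n : ℕ, Measurable fun t => ENNReal.ofReal ((n * Real.pi * (π t).coef n) ^ 2) :=
    fun n => (((π.measurable_coef hT n).const_mul _).pow_const 2).ennreal_ofReal
  have hE : Measurable E := Measurable.tsum hm
  have hint : ∫⁻ t, E t ∂leb T ≤ ENNReal.ofReal C := by
    rw [lintegral_tsum fun n => (hm n).aemeasurable]
    refine ENNReal.tsum_le_of_sum_range_le fun M => ?_
    rw [← lintegral_finsetSum _ fun n _ => hm n]
    simp_rw [← ENNReal.ofReal_sum_of_nonneg fun n _ => sq_nonneg _]
    rw [← ofReal_integral_eq_lintegral_ofReal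
      (integrable_finsetSum _ fun n _ => integrable_coef_poly hT π n)
      (ae_of_all _ fun t => Finset.sum_nonneg fun n _ => sq_nonneg _)]
    exact ENNReal.ofReal_le_ofReal (h M)
  have hne : ∫⁻ t, E t ∂leb T ≠ ⊤ := (hint.trans_lt ENNReal.ofReal_lt_top).ne
  refine ⟨fun t => (E t).toReal, integrable_toReal_of_lintegral_ne_top hE.aemeasurable hne,
    fun t => ENNReal.toReal_nonneg, ?_, ?_⟩
  · rw [integral_toReal hE.aemeasurable (ae_lt_top hE hne)]
    exact ENNReal.toReal_le_of_le_ofReal hC hint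
  · filter_upwards [ae_lt_top hE hne] with t ht
    have h1 := ENNReal.hasSum_toReal (f := fun n : ℕ =>
      ENNReal.ofReal ((n * Real.pi * (π t).coef n) ^ 2)) ht.ne
    simp only [ENNReal.toReal_ofReal (sq_nonneg _)] at h1
    convert h1 using 1
    refine (ENNReal.tsum_toReal_eq fun n => ENNReal.ofReal_ne_top).trans ?_
    simp only [ENNReal.toReal_ofReal (sq_nonneg _)]

theorem ae_mem_Ioo : ∀ᵐ x : unitInterval, (x : ℝ) ∈ Ioo (0 : ℝ) 1 := by
  have h : ∀ y : unitInterval, ∀ᵐ x : unitInterval, x ≠ y := fun y =>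
    measure_eq_zero_iff_ae_notMem.1 (measure_singleton y)
  filter_upwards [h 0, h 1] with x h0 h1
  exact ⟨lt_of_le_of_ne x.2.1 fun h => h0 (Subtype.ext h.symm),
    lt_of_le_of_ne x.2.2 fun h => h1 (Subtype.ext h)⟩

namespace EnergyTest

/-- A test function extended by zero in space. -/
def ext (G : EnergyTest T) (t x : ℝ) : ℝ := (Ioo (0 : ℝ) 1).indicator (G.toFun t) x

theorem ext_of_mem (G : EnergyTest T) (t : ℝ) {x : ℝ} (hx : x ∈ Ioo (0 : ℝ) 1) :
    G.ext t x = G.toFun t x := indicator_of_mem hx _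

theorem ext_of_notMem (G : EnergyTest T) (t : ℝ) {x : ℝ} (hx : x ∉ Ioo (0 : ℝ) 1) :
    G.ext t x = 0 := indicator_of_notMem hx _

/-- Points outside (0,1) have a neighbourhood missing the compact support, so extension by zero
preserves smoothness. The values of G outside its domain are arbitrary, which is why the extension
is introduced. -/
theorem contDiff_ext (G : EnergyTest T) {t : ℝ} (ht : t ∈ Icc 0 T) :
    ContDiff ℝ 1 (G.ext t) := by
  obtain ⟨K, hK, hKs, hG⟩ := G.compact_support
  refine contDiff_iff_contDiffAt.2 fun x => ?_
  by_cases hx : x ∈ Ioo (0 : ℝ) 1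
  · have h1 : ContDiffOn ℝ ∞ (fun x => G.toFun t x) (Ioo 0 1) :=
      G.smooth.comp (f := fun x : ℝ => (t, x)) (contDiffOn_const.prodMk contDiffOn_id)
        fun y hy => ⟨ht, hy⟩
    refine ((h1.contDiffAt (isOpen_Ioo.mem_nhds hx)).of_le (by exact_mod_cast le_top)
      ).congr_of_eventuallyEq ?_
    filter_upwards [isOpen_Ioo.mem_nhds hx] with y hy using G.ext_of_mem t hy
  · have hxK : (t, x) ∉ K := fun h => hx (hKs h).2
    have hnear : ∀ᶠ y in 𝓝 x, (t, y) ∉ K :=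
      (Continuous.tendsto (by fun_prop : Continuous fun y : ℝ => (t, y)) x).eventually
        (hK.isClosed.isOpen_compl.mem_nhds hxK)
    refine (contDiffAt_const (c := (0 : ℝ))).congr_of_eventuallyEq ?_
    filter_upwards [hnear] with y hy
    by_cases hy1 : y ∈ Ioo (0 : ℝ) 1
    · rw [G.ext_of_mem t hy1]; exact hG (t, y) ⟨ht, hy1⟩ hy
    · exact G.ext_of_notMem t hy1

theorem continuous_ext (G : EnergyTest T) :
    Continuous fun z : Icc (0 : ℝ) T × unitInterval => G.ext z.1 z.2 := by
  obtain ⟨K, hK, hKs, hG⟩ := G.compact_support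
  refine continuous_iff_continuousAt.2 fun z => ?_
  have hcoe : Continuous fun z : Icc (0 : ℝ) T × unitInterval => ((z.1 : ℝ), (z.2 : ℝ)) := by
    fun_prop
  by_cases hx : (z.2 : ℝ) ∈ Ioo (0 : ℝ) 1
  · have hnear : ∀ᶠ w in 𝓝 z, (w.2 : ℝ) ∈ Ioo (0 : ℝ) 1 :=
      (Continuous.tendsto (by fun_prop : Continuous fun w : Icc (0 : ℝ) T × unitInterval =>
        (w.2 : ℝ)) z).eventually (isOpen_Ioo.mem_nhds hx)
    have h1 : Tendsto (fun w : Icc (0 : ℝ) T × unitInterval => ((w.1 : ℝ), (w.2 : ℝ))) (𝓝 z)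
        (𝓝[Icc 0 T ×ˢ Ioo 0 1] ((z.1 : ℝ), (z.2 : ℝ))) :=
      tendsto_nhdsWithin_iff.2 ⟨hcoe.tendsto z, by filter_upwards [hnear] with w hw using
        ⟨w.1.2, hw⟩⟩
    have h2 := (G.smooth.continuousOn ((z.1 : ℝ), (z.2 : ℝ)) ⟨z.1.2, hx⟩).tendsto.comp h1
    rw [ContinuousAt, G.ext_of_mem _ hx]
    refine h2.congr' ?_
    filter_upwards [hnear] with w hw using (G.ext_of_mem _ hw).symm
  · have hxK : ((z.1 : ℝ), (z.2 : ℝ)) ∉ K := fun h => hx (hKs h).2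
    have hnear := (hcoe.tendsto z).eventually (hK.isClosed.isOpen_compl.mem_nhds hxK)
    refine (continuousAt_const (y := (0 : ℝ))).congr ?_
    filter_upwards [hnear] with w hw
    by_cases hw1 : (w.2 : ℝ) ∈ Ioo (0 : ℝ) 1
    · rw [G.ext_of_mem _ hw1]; exact (hG (w.1, w.2) ⟨w.1.2, hw1⟩ hw).symm
    · exact (G.ext_of_notMem _ hw1).symm

theorem deriv_ext_of_mem (G : EnergyTest T) (t : ℝ) {x : ℝ} (hx : x ∈ Ioo (0 : ℝ) 1) :
    deriv (G.ext t) x = deriv (G.toFun t) x := by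
  refine Filter.EventuallyEq.deriv_eq ?_
  filter_upwards [isOpen_Ioo.mem_nhds hx] with y hy using G.ext_of_mem t hy

theorem integral_deriv_mul_cos (G : EnergyTest T) {t : ℝ} (ht : t ∈ Icc 0 T) (n : ℕ) :
    ∫ x : unitInterval, deriv (G.ext t) x * cosMap n x =
      n * Real.pi * ∫ x : unitInterval, G.ext t x * Real.sin (n * Real.pi * x) := by
  have hd := G.contDiff_ext ht
  have hcd : Continuous (deriv (G.ext t)) := hd.continuous_deriv le_rfl
  have h1 := intervalIntegral.integral_mul_deriv_eq_deriv_mul (a := 0) (b := 1)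
    (u := fun x => Real.cos (n * Real.pi * x)) (v := G.ext t)
    (u' := fun x => -Real.sin (n * Real.pi * x) * (n * Real.pi)) (v' := deriv (G.ext t))
    (fun x _ => by
      have := ((hasDerivAt_id x).const_mul (n * Real.pi)).cos
      exact this.congr_deriv (by simp only [id]; ring))
    (fun x _ => (hd.differentiable one_ne_zero x).hasDerivAt)
    (Continuous.intervalIntegrable (by fun_prop) _ _) (hcd.intervalIntegrable _ _)
  rw [G.ext_of_notMem t (x := 0) (by simp), G.ext_of_notMem t (x := 1) (by simp)] at h1
  have e1 : ∫ x : unitInterval, deriv (G.ext t) x * cosMap n x =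
      ∫ x in (0)..1, Real.cos (n * Real.pi * x) * deriv (G.ext t) x := by
    rw [← integral_unitInterval fun x => Real.cos (n * Real.pi * x) * deriv (G.ext t) x]
    simp_rw [cosMap_apply, mul_comm]
  rw [e1, h1, integral_unitInterval fun x => G.ext t x * Real.sin (n * Real.pi * x),
    ← intervalIntegral.integral_const_mul]
  simp only [mul_zero, sub_zero, zero_sub]
  rw [← intervalIntegral.integral_neg]
  exact intervalIntegral.integral_congr fun x _ => by ring

end EnergyTest

theorem SubMeasure.IsAC.memLp_density {p : SubMeasure} (hp : p.IsAC) : MemLp p.density 2 := by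
  refine MemLp.of_bound p.measurable_density.aestronglyMeasurable 1 ?_
  filter_upwards [hp.density_mem] with x hx
  rw [Real.norm_of_nonneg hx.1]
  exact hx.2

theorem memLp_of_continuous {f : unitInterval → ℝ} (hf : Continuous f) : MemLp f 2 :=
  hf.memLp_of_hasCompactSupport (HasCompactSupport.of_compactSpace _)

/-- Parseval and integration by parts turn the integral into Σ 2 (nπ c_n) s_n with s_n the sine
coefficients of G. Apply 2ab ≤ a² + b², then Bessel, which bounds Σ s_n² by half the integral of G².
-/
theorem integral_density_mul_deriv_le {p : SubMeasure} (hp : p.IsAC) {e : ℝ}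
    (he : HasSum (fun n : ℕ => (n * Real.pi * p.coef n) ^ 2) e) (G : EnergyTest T) {t : ℝ}
    (ht : t ∈ Icc 0 T) : ∫ x : unitInterval, p.density x * deriv (G.toFun t) x ≤
      e + 1 / 2 * ∫ x : unitInterval, G.ext t x ^ 2 := by
  have hd := G.contDiff_ext ht
  have hcd : Continuous fun x : unitInterval => deriv (G.ext t) x :=
    (hd.continuous_deriv le_rfl).comp continuous_subtype_val
  have hce : Continuous fun x : unitInterval => G.ext t x :=
    hd.continuous.comp continuous_subtype_val
  have e1 : ∫ x : unitInterval, p.density x * deriv (G.toFun t) x =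
      ∫ x : unitInterval, p.density x * deriv (G.ext t) x := by
    refine integral_congr_ae ?_
    filter_upwards [ae_mem_Ioo] with x hx
    rw [G.deriv_ext_of_mem t hx]
  rw [e1]
  refine le_of_tendsto' (cos_parseval hp.memLp_density
    (memLp_of_continuous hcd)).tendsto_sum_nat fun N => ?_
  have hs := sin_bessel N hce
  have hpart : ∑ n ∈ Finset.range N, (n * Real.pi * p.coef n) ^ 2 ≤ e :=
    sum_le_hasSum _ (fun n _ => sq_nonneg _) he
  refine le_trans (Finset.sum_le_sum fun n _ => ?_) (le_trans (le_of_eq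
    (Finset.sum_add_distrib (s := Finset.range N) (f := fun n : ℕ => (n * Real.pi * p.coef n) ^ 2)
    (g := fun n => (∫ x : unitInterval, G.ext t x * Real.sin (n * Real.pi * x)) ^ 2)))
    (by linarith))
  rw [G.integral_deriv_mul_cos ht n, ← hp.pairing_eq]
  change cosWeight n * p.coef n * _ ≤ _
  rcases eq_or_ne n 0 with rfl | hn
  · simp
  · rw [cosWeight_of_ne hn]
    nlinarith [sq_nonneg (n * Real.pi * p.coef n -
      ∫ x : unitInterval, G.ext t x * Real.sin (n * Real.pi * x))]

/-- The term ½∫∫G² produced by the pointwise estimate is exactly the one subtracted in the energy,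
so C bounds the energy. -/
theorem FourierEnergyLe.hasFiniteEnergy (hT : 0 < T) {π : MPath T} {C : ℝ}
    (hπ : ∀ t, (π t).IsAC) (h : FourierEnergyLe π C) : HasFiniteEnergy π := by
  refine ⟨hπ, lt_of_le_of_lt (b := (C : EReal)) (iSup_le fun G => ?_) (EReal.coe_lt_top C)⟩
  obtain ⟨e, hei, he0, heC, hes⟩ := h.exists_hasSum hT
  have hg : ∀ t : Icc (0 : ℝ) T, ∫ x : unitInterval, (G.toFun t x) ^ 2 =
      ∫ x : unitInterval, (G.ext t x) ^ 2 := by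
    intro t
    refine integral_congr_ae ?_
    filter_upwards [ae_mem_Ioo] with x hx
    rw [G.ext_of_mem t hx]
  have hgc : Continuous fun t : Icc (0 : ℝ) T => ∫ x : unitInterval, (G.ext t x) ^ 2 := by
    refine continuous_parametric_integral_of_continuous (s := univ)
      (μ := (volume : Measure unitInterval)) (f := fun
      (t : Icc (0 : ℝ) T) (x : unitInterval) => (G.ext t x) ^ 2) ?_ isCompact_univ |>.congr ?_
    · exact G.continuous_ext.pow 2
    · intro t; simp
  have hgi : Integrable (fun t : Icc (0 : ℝ) T => ∫ x : unitInterval, (G.ext t x) ^ 2) (leb T) :=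
    hgc.integrable_of_hasCompactSupport (HasCompactSupport.of_compactSpace _)
  have hmain : (∫ t : Icc (0 : ℝ) T, (∫ x : unitInterval,
      (π t).density x * deriv (G.toFun t) x) ∂leb T) ≤
      ∫ t : Icc (0 : ℝ) T, (e t + 1 / 2 * ∫ x : unitInterval, (G.ext t x) ^ 2) ∂leb T := by
    refine integral_le_integral_of_le (hei.add (hgi.const_mul _)) (fun t => ?_) ?_
    · have : 0 ≤ ∫ x : unitInterval, (G.ext t x) ^ 2 := integral_nonneg fun x => sq_nonneg _
      have := he0 t
      positivity
    · filter_upwards [hes] with t ht using integral_density_mul_deriv_le (hπ t) ht G t.2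
  rw [integral_add hei (hgi.const_mul _), integral_const_mul] at hmain
  have : energyFunctional G π ≤ C := by
    unfold energyFunctional
    simp_rw [hg]
    linarith
  exact_mod_cast this

/-! ### Boundary values -/

/-- For n ≥ 1, |c_n| ≤ n²c_n² + 1/n² and both sides of the splitting are summable. -/
theorem summable_coef {p : SubMeasure} {e : ℝ}
    (he : HasSum (fun n : ℕ => (n * Real.pi * p.coef n) ^ 2) e) :
    Summable fun n => |p.coef n| := by
  rw [← summable_nat_add_iff 1]
  have h1 : Summable fun n : ℕ => (((n + 1 : ℕ) : ℝ) * Real.pi * p.coef (n + 1)) ^ 2 :=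
    (summable_nat_add_iff 1 (f := fun n : ℕ => ((n : ℝ) * Real.pi * p.coef n) ^ 2)).2 he.summable
  have h2 : Summable fun n : ℕ => 1 / ((n + 1 : ℕ) : ℝ) ^ 2 :=
    (summable_nat_add_iff 1 (f := fun n : ℕ => 1 / (n : ℝ) ^ 2)).2
      (Real.summable_one_div_nat_pow.2 one_lt_two)
  refine Summable.of_nonneg_of_le (fun n => abs_nonneg _) (fun n => ?_) (h1.add h2)
  have hn : (0 : ℝ) < (n + 1 : ℕ) := by positivity
  have hπ : 1 ≤ Real.pi := by linarith [Real.pi_gt_three]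
  rw [mul_pow, mul_pow, ← sq_abs (p.coef (n + 1))]
  set a := |p.coef (n + 1)|
  have ha : 0 ≤ a := abs_nonneg _
  have h3 : ((n + 1 : ℕ) : ℝ) ^ 2 * a ^ 2 ≤ ((n + 1 : ℕ) : ℝ) ^ 2 * Real.pi ^ 2 * a ^ 2 := by
    have : (1 : ℝ) ≤ Real.pi ^ 2 := by nlinarith
    nlinarith [mul_nonneg (sq_nonneg ((n + 1 : ℕ) : ℝ)) (sq_nonneg a)]
  have h4 : a ≤ ((n + 1 : ℕ) : ℝ) ^ 2 * a ^ 2 + 1 / ((n + 1 : ℕ) : ℝ) ^ 2 := by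
    have h5 : ((n + 1 : ℕ) : ℝ) * a * (1 / ((n + 1 : ℕ) : ℝ)) = a := by field_simp
    have h6 : (1 / ((n + 1 : ℕ) : ℝ)) ^ 2 = 1 / ((n + 1 : ℕ) : ℝ) ^ 2 := by
      rw [div_pow, one_pow]
    nlinarith [sq_nonneg (((n + 1 : ℕ) : ℝ) * a - 1 / ((n + 1 : ℕ) : ℝ)),
      sq_nonneg (((n + 1 : ℕ) : ℝ) * a), sq_nonneg (1 / ((n + 1 : ℕ) : ℝ))]
  linarith

/-- The cosine series converges uniformly, and its sum has the same cosine coefficients as the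
density. -/
theorem exists_continuous_version {p : SubMeasure} (hp : p.IsAC) {e : ℝ}
    (he : HasSum (fun n : ℕ => (n * Real.pi * p.coef n) ^ 2) e) :
    ∃ w : C(unitInterval, ℝ), p.density =ᵐ[volume] w ∧
      ∀ x, HasSum (fun n => cosWeight n * p.coef n * cosMap n x) (w x) := by
  have hs : Summable fun n => 2 * |p.coef n| := (summable_coef he).mul_left 2
  have hb : ∀ n (x : unitInterval), ‖cosWeight n * p.coef n * cosMap n x‖ ≤ 2 * |p.coef n| := by
    intro n x
    rw [norm_mul, norm_mul, Real.norm_of_nonneg (cosWeight_pos n).le, Real.norm_eq_abs]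
    refine (mul_le_of_le_one_right (by have := cosWeight_pos n; positivity)
      (Real.abs_cos_le_one _)).trans ?_
    exact mul_le_mul_of_nonneg_right (cosWeight_le n) (abs_nonneg _)
  let w : C(unitInterval, ℝ) := ⟨fun x => ∑' n, cosWeight n * p.coef n * cosMap n x,
    continuous_tsum (fun n => continuous_const.mul (cosMap n).continuous) hs hb⟩
  have hw : ∀ x, HasSum (fun n => cosWeight n * p.coef n * cosMap n x) (w x) := fun x =>
    (Summable.of_norm_bounded hs fun n => hb n x).hasSum
  refine ⟨w, ae_eq_of_cos_coef_eq hp.memLp_density (memLp_of_continuous w.continuous) fun m => ?_,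
    hw⟩
  rw [← hp.pairing_eq]
  have h1 := hasSum_integral_of_summable_integral_norm (μ := (volume : Measure unitInterval))
    (F := fun n x => cosWeight n * p.coef n * cosMap n x * cosMap m x)
    (fun n => integrable_of_continuous (by fun_prop)) (by
      refine Summable.of_nonneg_of_le (fun n => integral_nonneg fun x => norm_nonneg _)
        (fun n => ?_) hs
      have : ∫ x : unitInterval, ‖cosWeight n * p.coef n * cosMap n x * cosMap m x‖ ≤
          ∫ _ : unitInterval, 2 * |p.coef n| := by
        refine integral_le_integral_of_le (integrable_const _) (fun _ => by positivity)
          (ae_of_all _ fun x => ?_)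
        rw [norm_mul]
        exact (mul_le_of_le_one_right (norm_nonneg _) (Real.abs_cos_le_one _)).trans (hb n x)
      simpa using this)
  have h2 : ∀ x, ∑' n, cosWeight n * p.coef n * cosMap n x * cosMap m x = w x * cosMap m x :=
    fun x => ((hw x).mul_right _).tsum_eq
  have h3 : ∀ n, ∫ x, cosWeight n * p.coef n * cosMap n x * cosMap m x =
      if n = m then p.coef m else 0 := by
    intro n
    simp_rw [mul_assoc (cosWeight n * p.coef n)]
    rw [integral_const_mul, integral_cosMap_mul_cosMap]
    split_ifs with h
    · subst h
      field_simp [(cosWeight_pos n).ne']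
    · simp
  simp only [h2, h3] at h1
  have h4 : HasSum (fun n => if n = m then p.coef m else 0) (p.coef m) := hasSum_ite_eq m _
  exact h4.unique h1

theorem hasSum_contValue {p : SubMeasure} (hp : p.IsAC) {e : ℝ}
    (he : HasSum (fun n : ℕ => (n * Real.pi * p.coef n) ^ 2) e) (x : unitInterval) :
    HasSum (fun n => cosWeight n * p.coef n * cosMap n x) (contValue p.density x) := by
  obtain ⟨w, hw, h⟩ := exists_continuous_version hp he
  rw [contValue_eq hw]
  exact h x

/-- The tail `∑_{n ≥ N} n⁻²`. -/
def sqTail (N : ℕ) : ℝ := ∑' k : ℕ, 1 / ((k + N : ℕ) : ℝ) ^ 2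

theorem tendsto_sqTail : Tendsto sqTail atTop (𝓝 0) :=
  tendsto_sum_nat_add fun n : ℕ => 1 / (n : ℝ) ^ 2

/-- Termwise 2|c_n| ≤ κ (nπ c_n)² + κ⁻¹ n⁻². The parameter κ makes the energy part small after
integration in time, and N then makes the tail small. -/
theorem abs_contValue_sub_le {p : SubMeasure} (hp : p.IsAC) {e : ℝ}
    (he : HasSum (fun n : ℕ => (n * Real.pi * p.coef n) ^ 2) e) (x : unitInterval) {N : ℕ}
    (hN : 0 < N) {κ : ℝ} (hκ : 0 < κ) :
    |contValue p.density x - ∑ n ∈ Finset.range N, cosWeight n * p.coef n * cosMap n x| ≤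
      κ * e + κ⁻¹ * sqTail N := by
  have h1 := hasSum_contValue hp he x
  have h2 := (hasSum_nat_add_iff' N).2 h1
  have h3 := (hasSum_nat_add_iff' N).2 he
  have h4 : HasSum (fun k : ℕ => 1 / ((k + N : ℕ) : ℝ) ^ 2) (sqTail N) :=
    ((summable_nat_add_iff N (f := fun n : ℕ => 1 / (n : ℝ) ^ 2)).2
      (Real.summable_one_div_nat_pow.2 one_lt_two)).hasSum
  have h5 : 0 ≤ ∑ n ∈ Finset.range N, (n * Real.pi * p.coef n) ^ 2 :=
    Finset.sum_nonneg fun n _ => sq_nonneg _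
  have h6 := (h3.mul_left κ).add (h4.mul_left κ⁻¹)
  have hterm : ∀ k : ℕ, |cosWeight (k + N) * p.coef (k + N) * cosMap (k + N) x| ≤
      κ * (((k + N : ℕ) : ℝ) * Real.pi * p.coef (k + N)) ^ 2 +
        κ⁻¹ * (1 / ((k + N : ℕ) : ℝ) ^ 2) := by
    intro k
    rw [cosWeight_of_ne (by omega), abs_mul, abs_mul, abs_two]
    have hn : (0 : ℝ) < (k + N : ℕ) := by exact_mod_cast (by omega : 0 < k + N)
    set m : ℝ := ((k + N : ℕ) : ℝ)
    rw [mul_pow, mul_pow, ← sq_abs (p.coef (k + N))]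
    set a := |p.coef (k + N)|
    have ha : 0 ≤ a := abs_nonneg _
    have hc : |cosMap (k + N) x| ≤ 1 := Real.abs_cos_le_one _
    have hπ : (1 : ℝ) ≤ Real.pi ^ 2 := by nlinarith [Real.pi_gt_three]
    have e1 : κ * (m ^ 2 * a ^ 2) ≤ κ * (m ^ 2 * Real.pi ^ 2 * a ^ 2) := by
      gcongr
      nlinarith [sq_nonneg m]
    have e2 : 2 * a ≤ κ * (m ^ 2 * a ^ 2) + κ⁻¹ * (1 / m ^ 2) := by
      have : κ * (m ^ 2 * a ^ 2) + κ⁻¹ * (1 / m ^ 2) - 2 * a = κ * (m * a - κ⁻¹ * (1 / m)) ^ 2 := by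
        field_simp
        ring
      have : 0 ≤ κ * (m * a - κ⁻¹ * (1 / m)) ^ 2 := by positivity
      linarith
    have e3 : 2 * a * |cosMap (k + N) x| ≤ 2 * a := mul_le_of_le_one_right (by linarith) hc
    linarith
  have hle : ∀ z : ℝ, z = contValue p.density x - ∑ n ∈ Finset.range N,
      cosWeight n * p.coef n * cosMap n x → |z| ≤ κ * (e - ∑ n ∈ Finset.range N,
        (n * Real.pi * p.coef n) ^ 2) + κ⁻¹ * sqTail N := by
    rintro _ rfl
    rw [abs_le]
    constructor
    · rw [neg_le]
      exact hasSum_le (fun k => (neg_le_abs _).trans (hterm k)) h2.neg h6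
    · exact hasSum_le (fun k => (le_abs_self _).trans (hterm k)) h2 h6
  refine (hle _ rfl).trans ?_
  have : κ * (e - ∑ n ∈ Finset.range N, (n * Real.pi * p.coef n) ^ 2) ≤ κ * e := by
    gcongr; linarith
  linarith

/-! ### Integrals along paths -/

theorem integrable_of_measurable_of_le {f : Icc (0 : ℝ) T → ℝ} (hf : Measurable f) {C : ℝ}
    (h : ∀ t, |f t| ≤ C) : Integrable f (leb T) :=
  Integrable.of_bound hf.aestronglyMeasurable C (ae_of_all _ h)

theorem measurable_integral_of_version {Ψ V : Icc (0 : ℝ) T → unitInterval → ℝ}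
    (hV : Measurable (Function.uncurry V)) (h : ∀ t, Ψ t =ᵐ[volume] V t) :
    Measurable fun t => ∫ x, Ψ t x := by
  have h1 : (fun t => ∫ x, Ψ t x) = fun t => ∫ x, V t x :=
    funext fun t => integral_congr_ae (h t)
  rw [h1]
  exact (StronglyMeasurable.integral_prod_right (f := V) hV.stronglyMeasurable).measurable

theorem exists_bound_of_continuous {F : Icc (0 : ℝ) T → unitInterval → ℝ}
    (hF : Continuous (Function.uncurry F)) : ∃ C, 0 ≤ C ∧ ∀ t x, |F t x| ≤ C := by
  obtain ⟨C, hC⟩ := isCompact_univ.exists_bound_of_continuousOn hF.continuousOn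
  exact ⟨max C 0, le_max_right _ _, fun t x => (hC (t, x) trivial).trans (le_max_left _ _)⟩

theorem SubMeasure.IsAC.abs_integral_density_mul_le_of_bound {p : SubMeasure} (hp : p.IsAC)
    {f : unitInterval → ℝ} (hf : Integrable f) {C : ℝ} (hC : ∀ x, |f x| ≤ C) :
    |∫ x, p.density x * f x| ≤ C := by
  refine (SubMeasure.abs_integral_density_mul_le hp hf).trans ?_
  have : ∫ x, |f x| ≤ ∫ _ : unitInterval, C := integral_mono hf.abs (integrable_const C) hC
  simpa using this

theorem measurable_integral_density_mul (hT : 0 < T) {π : MPath T} (hπ : ∀ t, (π t).IsAC)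
    {F : Icc (0 : ℝ) T → unitInterval → ℝ} (hF : Continuous (Function.uncurry F)) :
    Measurable fun t => ∫ x, (π t).density x * F t x := by
  obtain ⟨U, hU, -, hUπ⟩ := π.exists_joint_density hT hπ
  refine measurable_integral_of_version (V := fun t x => U t x * F t x) (hU.mul hF.measurable)
    fun t => ?_
  filter_upwards [hUπ t] with x hx
  rw [hx]

theorem continuous_curry {F : Icc (0 : ℝ) T → unitInterval → ℝ}
    (hF : Continuous (Function.uncurry F)) (t : Icc (0 : ℝ) T) : Continuous (F t) :=
  hF.comp (by fun_prop : Continuous fun x : unitInterval => (t, x))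

theorem integrable_integral_density_mul (hT : 0 < T) {π : MPath T} (hπ : ∀ t, (π t).IsAC)
    {F : Icc (0 : ℝ) T → unitInterval → ℝ} (hF : Continuous (Function.uncurry F)) :
    Integrable (fun t => ∫ x, (π t).density x * F t x) (leb T) := by
  obtain ⟨C, -, hC⟩ := exists_bound_of_continuous hF
  exact integrable_of_measurable_of_le (measurable_integral_density_mul hT hπ hF) fun t =>
    (hπ t).abs_integral_density_mul_le_of_bound
      (integrable_of_continuous (continuous_curry hF t)) (hC t)

theorem tendsto_integral_integral_density_mul (hT : 0 < T) {y : ℕ → MPath T} {π : MPath T}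
    (hy : ∀ k t, (y k t).IsAC) (hπ : ∀ t, (π t).IsAC)
    (h : ∀ n t, Tendsto (fun k => (y k t).coef n) atTop (𝓝 ((π t).coef n)))
    {F : Icc (0 : ℝ) T → unitInterval → ℝ} (hF : Continuous (Function.uncurry F)) :
    Tendsto (fun k => ∫ t, (∫ x, (y k t).density x * F t x) ∂leb T) atTop
      (𝓝 (∫ t, (∫ x, (π t).density x * F t x) ∂leb T)) := by
  obtain ⟨C, -, hC⟩ := exists_bound_of_continuous hF
  refine tendsto_integral_of_dominated_convergence (fun _ => C)
    (fun k => (measurable_integral_density_mul hT (hy k) hF).aestronglyMeasurable)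
    (integrable_const C) (fun k => ae_of_all _ fun t => ?_) (ae_of_all _ fun t => ?_)
  · exact (hy k t).abs_integral_density_mul_le_of_bound
      (integrable_of_continuous (continuous_curry hF t)) (hC t)
  · exact SubMeasure.tendsto_integral_density_mul (fun k => hy k t) (hπ t) (fun n => h n t)
      (integrable_of_continuous (continuous_curry hF t))

theorem measurable_integral_mobility_mul (hT : 0 < T) {π : MPath T} (hπ : ∀ t, (π t).IsAC)
    {F : Icc (0 : ℝ) T → unitInterval → ℝ} (hF : Continuous (Function.uncurry F)) :
    Measurable fun t => ∫ x, mobility ((π t).density x) * F t x := by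
  obtain ⟨U, hU, -, hUπ⟩ := π.exists_joint_density hT hπ
  refine measurable_integral_of_version (V := fun t x => U t x * (1 - U t x) * F t x)
    ((hU.mul (hU.const_sub 1)).mul hF.measurable) fun t => ?_
  filter_upwards [hUπ t] with x hx
  rw [hx, mobility]

theorem SubMeasure.IsAC.mobility_mem {p : SubMeasure} (hp : p.IsAC) :
    ∀ᵐ x, |mobility (p.density x)| ≤ 1 := by
  filter_upwards [hp.density_mem] with x hx
  have h1 : 0 ≤ mobility (p.density x) := mul_nonneg hx.1 (sub_nonneg.2 hx.2)
  rw [abs_of_nonneg h1]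
  exact (mobility_le _).trans (by norm_num)

theorem SubMeasure.measurable_mobility (p : SubMeasure) :
    Measurable fun x => mobility (p.density x) :=
  p.measurable_density.mul (p.measurable_density.const_sub 1)

theorem SubMeasure.IsAC.integrable_mobility_mul {p : SubMeasure} (hp : p.IsAC)
    {f : unitInterval → ℝ} (hf : Integrable f) :
    Integrable fun x => mobility (p.density x) * f x :=
  hf.bdd_mul (c := 1) p.measurable_mobility.aestronglyMeasurable hp.mobility_mem

theorem SubMeasure.IsAC.abs_integral_mobility_mul_le {p : SubMeasure} (hp : p.IsAC)
    {f : unitInterval → ℝ} {C : ℝ} (hC : ∀ x, |f x| ≤ C) :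
    |∫ x, mobility (p.density x) * f x| ≤ C := by
  have h : ‖∫ x, mobility (p.density x) * f x‖ ≤ ∫ _ : unitInterval, C := by
    refine norm_integral_le_of_norm_le (integrable_const C) ?_
    filter_upwards [hp.mobility_mem] with x hx
    rw [norm_mul]
    exact (mul_le_of_le_one_left (norm_nonneg _) hx).trans (hC x)
  simpa using h

theorem integrable_integral_mobility_mul (hT : 0 < T) {π : MPath T} (hπ : ∀ t, (π t).IsAC)
    {F : Icc (0 : ℝ) T → unitInterval → ℝ} (hF : Continuous (Function.uncurry F)) :
    Integrable (fun t => ∫ x, mobility ((π t).density x) * F t x) (leb T) := by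
  obtain ⟨C, -, hC⟩ := exists_bound_of_continuous hF
  exact integrable_of_measurable_of_le (measurable_integral_mobility_mul hT hπ hF) fun t =>
    (hπ t).abs_integral_mobility_mul_le (hC t)

/-- Upper semicontinuity of `∫∫ σ(u) F` in the form of a convergent family of upper bounds. -/
theorem exists_mobility_upper_bound (hT : 0 < T) {y : ℕ → MPath T} {π : MPath T}
    (hy : ∀ k t, (y k t).IsAC) (hπ : ∀ t, (π t).IsAC)
    (h : ∀ n t, Tendsto (fun k => (y k t).coef n) atTop (𝓝 ((π t).coef n)))
    {F : Icc (0 : ℝ) T → unitInterval → ℝ} (hF : Continuous (Function.uncurry F))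
    (hF0 : ∀ t x, 0 ≤ F t x) :
    ∃ D : ℕ → ℝ, (∀ k, ∫ t, (∫ x, mobility ((y k t).density x) * F t x) ∂leb T ≤ D k) ∧
      Tendsto D atTop (𝓝 (∫ t, (∫ x, mobility ((π t).density x) * F t x) ∂leb T)) := by
  obtain ⟨C, hC0, hC⟩ := exists_bound_of_continuous hF
  have hFi : ∀ t, Integrable (F t) := fun t => integrable_of_continuous (continuous_curry hF t)
  -- the tangent of `σ` at `u`
  let g : Icc (0 : ℝ) T → unitInterval → ℝ := fun t x => (1 - 2 * (π t).density x) * F t x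
  let s : Icc (0 : ℝ) T → unitInterval → ℝ := fun t x => (π t).density x * ((π t).density x * F t x)
  have hgi : ∀ t, Integrable (g t) := by
    intro t
    have : g t = fun x => F t x - 2 * ((π t).density x * F t x) := by
      funext x; simp only [g]; ring
    rw [this]
    exact (hFi t).sub (((hπ t).integrable_density_mul (hFi t)).const_mul 2)
  have hsi : ∀ t, Integrable (s t) := fun t =>
    (hπ t).integrable_density_mul ((hπ t).integrable_density_mul (hFi t))
  have hgb : ∀ t, ∫ x, |g t x| ≤ C := by
    intro t
    have : ∫ x, |g t x| ≤ ∫ _ : unitInterval, C := by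
      refine integral_mono_ae (hgi t).abs (integrable_const C) ?_
      filter_upwards [(hπ t).density_mem] with x hx
      simp only [g]
      rw [abs_mul]
      refine (mul_le_of_le_one_left (abs_nonneg _) ?_).trans (hC t x)
      rw [abs_le]
      constructor <;> linarith [hx.1, hx.2]
    simpa using this
  have hsb : ∀ t, |∫ x, s t x| ≤ C := by
    intro t
    refine (SubMeasure.abs_integral_density_mul_le (hπ t)
      ((hπ t).integrable_density_mul (hFi t))).trans ?_
    have : ∫ x, |(π t).density x * F t x| ≤ ∫ _ : unitInterval, C := by
      refine integral_mono_ae ((hπ t).integrable_density_mul (hFi t)).abs (integrable_const C) ?_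
      filter_upwards [(hπ t).density_mem] with x hx
      rw [abs_mul, abs_of_nonneg hx.1]
      exact (mul_le_of_le_one_left (abs_nonneg _) hx.2).trans (hC t x)
    simpa using this
  have hmeas : ∀ ν : MPath T, (∀ t, (ν t).IsAC) → Measurable fun t =>
      (∫ x, (ν t).density x * g t x) + ∫ x, s t x := by
    intro ν hν
    obtain ⟨U, hU, -, hUπ⟩ := π.exists_joint_density hT hπ
    obtain ⟨W, hW, -, hWν⟩ := ν.exists_joint_density hT hν
    refine Measurable.add ?_ ?_
    · refine measurable_integral_of_version (V := fun t x => W t x * ((1 - 2 * U t x) * F t x))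
        (hW.mul (((hU.const_mul 2).const_sub 1).mul hF.measurable)) fun t => ?_
      filter_upwards [hUπ t, hWν t] with x h1 h2
      simp only [g]
      rw [h1, h2]
    · refine measurable_integral_of_version (V := fun t x => U t x * (U t x * F t x))
        (hU.mul (hU.mul hF.measurable)) fun t => ?_
      filter_upwards [hUπ t] with x h1
      simp only [s]
      rw [h1]
  have hbd : ∀ ν : MPath T, (∀ t, (ν t).IsAC) → ∀ t,
      |(∫ x, (ν t).density x * g t x) + ∫ x, s t x| ≤ 2 * C := by
    intro ν hν t
    have h1 := (SubMeasure.abs_integral_density_mul_le (hν t) (hgi t)).trans (hgb t)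
    have h2 := hsb t
    refine (abs_add_le _ _).trans ?_
    linarith
  -- The tangent bound is exact at the limit density.
  have heq : ∀ t, ∫ x, mobility ((π t).density x) * F t x =
      (∫ x, (π t).density x * g t x) + ∫ x, s t x := by
    intro t
    rw [← integral_add ((hπ t).integrable_density_mul (hgi t)) (hsi t)]
    refine integral_congr_ae (ae_of_all _ fun x => ?_)
    simp only [g, s, mobility]
    ring
  refine ⟨fun k => ∫ t, ((∫ x, (y k t).density x * g t x) + ∫ x, s t x) ∂leb T, fun k => ?_, ?_⟩
  · refine integral_mono (integrable_integral_mobility_mul hT (hy k) hF)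
      (integrable_of_measurable_of_le (hmeas _ (hy k)) (hbd _ (hy k))) fun t => ?_
    simp only
    rw [← integral_add ((hy k t).integrable_density_mul (hgi t)) (hsi t)]
    refine integral_mono ((hy k t).integrable_mobility_mul (hFi t))
      (((hy k t).integrable_density_mul (hgi t)).add (hsi t)) fun x => ?_
    simp only [g, s, mobility]
    -- The tangent to a(1 − a) at u exceeds the mobility at v by exactly (v − u)².
    nlinarith [mul_nonneg (sq_nonneg ((y k t).density x - (π t).density x)) (hF0 t x)]
  · simp_rw [heq]
    refine tendsto_integral_of_dominated_convergence (fun _ => 2 * C)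
      (fun k => (hmeas _ (hy k)).aestronglyMeasurable) (integrable_const _)
      (fun k => ae_of_all _ (hbd _ (hy k))) (ae_of_all _ fun t => ?_)
    exact (SubMeasure.tendsto_integral_density_mul (fun k => hy k t) (hπ t) (fun n => h n t)
      (hgi t)).add_const _

/-! ### Time integrals of boundary values -/

theorem aestronglyMeasurable_contValue (hT : 0 < T) {π : MPath T} (hπ : ∀ t, (π t).IsAC) {C : ℝ}
    (h : FourierEnergyLe π C) (x : unitInterval) :
    AEStronglyMeasurable (fun t => contValue (π t).density x) (leb T) := by
  obtain ⟨e, -, -, -, hes⟩ := h.exists_hasSum hT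
  refine aestronglyMeasurable_of_tendsto_ae atTop (f := fun N t =>
    ∑ n ∈ Finset.range N, cosWeight n * (π t).coef n * cosMap n x) (fun N => ?_) ?_
  · exact (Finset.measurable_fun_sum _ fun n _ =>
      ((π.measurable_coef hT n).const_mul _).mul_const _).aestronglyMeasurable
  · filter_upwards [hes] with t ht using (hasSum_contValue (hπ t) ht x).tendsto_sum_nat

theorem integrable_contValue_mul (hT : 0 < T) {π : MPath T} (hπ : ∀ t, (π t).IsAC) {C : ℝ}
    (h : FourierEnergyLe π C) (x : unitInterval) {φ : Icc (0 : ℝ) T → ℝ} (hφ : Continuous φ) :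
    Integrable (fun t => contValue (π t).density x * φ t) (leb T) := by
  refine (hφ.integrable_of_hasCompactSupport (HasCompactSupport.of_compactSpace _)).bdd_mul (c := 1)
    (aestronglyMeasurable_contValue hT hπ h x) (ae_of_all _ fun t => ?_)
  rw [Real.norm_of_nonneg (contValue_mem (hπ t) x).1]
  exact (contValue_mem (hπ t) x).2

theorem abs_integral_contValue_sub_le (hT : 0 < T) {π : MPath T} (hπ : ∀ t, (π t).IsAC) {C : ℝ}
    (h : FourierEnergyLe π C) (x : unitInterval) {φ : Icc (0 : ℝ) T → ℝ} (hφ : Continuous φ)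
    {Φ : ℝ} (hΦ0 : 0 ≤ Φ) (hΦ : ∀ t, |φ t| ≤ Φ) {N : ℕ} (hN : 0 < N) {κ : ℝ} (hκ : 0 < κ) :
    |(∫ t, contValue (π t).density x * φ t ∂leb T) -
      ∫ t, (∑ n ∈ Finset.range N, cosWeight n * (π t).coef n * cosMap n x) * φ t ∂leb T| ≤
      Φ * (κ * C + κ⁻¹ * sqTail N * T) := by
  obtain ⟨e, hei, he0, heC, hes⟩ := h.exists_hasSum hT
  have hi : Integrable (fun t => (∑ n ∈ Finset.range N,
      cosWeight n * (π t).coef n * cosMap n x) * φ t) (leb T) := by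
    refine (hφ.integrable_of_hasCompactSupport (HasCompactSupport.of_compactSpace _)).bdd_mul
      (c := ∑ n ∈ Finset.range N, |cosWeight n * cosMap n x|)
      (Finset.measurable_fun_sum _ fun n _ =>
      ((π.measurable_coef hT n).const_mul _).mul_const _).aestronglyMeasurable
      (ae_of_all _ fun t => (norm_sum_le _ _).trans (Finset.sum_le_sum fun n _ => ?_))
    rw [mul_right_comm, norm_mul]
    exact mul_le_of_le_one_right (norm_nonneg _) ((π t).abs_coef_le n)
  rw [← integral_sub (integrable_contValue_mul hT hπ h x hφ) hi, ← Real.norm_eq_abs]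
  have hbi : Integrable (fun t => (κ * e t + κ⁻¹ * sqTail N) * Φ) (leb T) :=
    ((hei.const_mul κ).add (integrable_const _)).mul_const _
  refine (norm_integral_le_of_norm_le hbi ?_).trans ?_
  · filter_upwards [hes] with t ht
    rw [← sub_mul, norm_mul]
    exact mul_le_mul (abs_contValue_sub_le (hπ t) ht x hN hκ) (hΦ t) (norm_nonneg _)
      ((abs_nonneg _).trans (abs_contValue_sub_le (hπ t) ht x hN hκ))
  · rw [integral_mul_const, integral_add (hei.const_mul κ) (integrable_const _),
      integral_const_mul, integral_const, leb_real_univ hT, smul_eq_mul, mul_comm,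
      mul_comm T]
    gcongr

/-- A common energy bound permits truncating all cosine series at the same N with a uniform error;
the truncated sums converge by dominated convergence. -/
theorem tendsto_integral_contValue_mul (hT : 0 < T) {y : ℕ → MPath T} {π : MPath T}
    (hy : ∀ k t, (y k t).IsAC) (hπ : ∀ t, (π t).IsAC) {C : ℝ}
    (hyC : ∀ k, FourierEnergyLe (y k) C) (hπC : FourierEnergyLe π C)
    (h : ∀ n t, Tendsto (fun k => (y k t).coef n) atTop (𝓝 ((π t).coef n)))
    (x : unitInterval) {φ : Icc (0 : ℝ) T → ℝ} (hφ : Continuous φ) :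
    Tendsto (fun k => ∫ t, contValue (y k t).density x * φ t ∂leb T) atTop
      (𝓝 (∫ t, contValue (π t).density x * φ t ∂leb T)) := by
  have hC : 0 ≤ C := by simpa using hπC 0
  obtain ⟨Φ', hΦ'⟩ := isCompact_univ.exists_bound_of_continuousOn hφ.continuousOn
  set Φ := max Φ' 0
  have hΦ0 : 0 ≤ Φ := le_max_right _ _
  have hΦ : ∀ t, |φ t| ≤ Φ := fun t => (hΦ' t trivial).trans (le_max_left _ _)
  have hfin : ∀ N, Tendsto (fun k => ∫ t, (∑ n ∈ Finset.range N,
      cosWeight n * (y k t).coef n * cosMap n x) * φ t ∂leb T) atTop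
      (𝓝 (∫ t, (∑ n ∈ Finset.range N, cosWeight n * (π t).coef n * cosMap n x) * φ t ∂leb T)) := by
    intro N
    refine tendsto_integral_of_dominated_convergence
      (fun _ => (∑ n ∈ Finset.range N, |cosWeight n * cosMap n x|) * Φ) (fun k => ?_)
      (integrable_const _) (fun k => ae_of_all _ fun t => ?_) (ae_of_all _ fun t => ?_)
    · exact ((Finset.measurable_fun_sum _ fun n _ =>
        (((y k).measurable_coef hT n).const_mul _).mul_const _).mul
          hφ.measurable).aestronglyMeasurable
    · rw [norm_mul]
      refine mul_le_mul ((norm_sum_le _ _).trans (Finset.sum_le_sum fun n _ => ?_)) (hΦ t)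
        (norm_nonneg _) (Finset.sum_nonneg fun n _ => abs_nonneg _)
      rw [mul_right_comm, norm_mul]
      exact mul_le_of_le_one_right (norm_nonneg _) ((y k t).abs_coef_le n)
    · exact (tendsto_finsetSum _ fun n _ => ((h n t).const_mul _).mul_const _).mul_const _
  rw [Metric.tendsto_nhds]
  intro ε hε
  -- The energy part of the error becomes at most ε/8; N is chosen afterwards, since the tail part
  -- carries κ⁻¹. The shifts by 1 avoid division by zero.
  set κ : ℝ := ε / (8 * (Φ + 1) * (C + 1)) with hκdef
  have hκ : 0 < κ := by positivity
  have hκC : Φ * (κ * C) ≤ ε / 8 := by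
    have : κ * ((Φ + 1) * (C + 1)) = ε / 8 := by rw [hκdef]; field_simp
    nlinarith [mul_nonneg hκ.le hΦ0, mul_nonneg hκ.le hC, hκ]
  have htail : Tendsto (fun N => Φ * (κ⁻¹ * sqTail N * T)) atTop (𝓝 0) := by
    have := ((tendsto_sqTail.const_mul κ⁻¹).mul_const T).const_mul Φ
    simpa using this
  obtain ⟨N, hNε, hN⟩ := ((htail.eventually (gt_mem_nhds (show 0 < ε / 8 by linarith))).and
    (eventually_gt_atTop 0)).exists
  have hb : ∀ ν : MPath T, (∀ t, (ν t).IsAC) → FourierEnergyLe ν C →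
      |(∫ t, contValue (ν t).density x * φ t ∂leb T) -
      ∫ t, (∑ n ∈ Finset.range N, cosWeight n * (ν t).coef n * cosMap n x) * φ t ∂leb T| ≤ ε / 4 :=
    fun ν hν hνC => (abs_integral_contValue_sub_le hT hν hνC x hφ hΦ0 hΦ hN hκ).trans (by linarith)
  filter_upwards [Metric.tendsto_nhds.1 (hfin N) (ε / 4) (by linarith)] with k hk
  have h1 := abs_le.1 (hb _ (hy k) (hyC k))
  have h2 := abs_le.1 (hb _ hπ hπC)
  rw [Real.dist_eq, abs_lt] at hk ⊢
  constructor <;> linarith [hk.1, hk.2, h1.1, h1.2, h2.1, h2.2]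

/-! ### Closedness of level sets -/

namespace C12

theorem continuous_restrict {f : ℝ → ℝ → ℝ}
    (hf : ContinuousOn (fun p : ℝ × ℝ => f p.1 p.2) (Icc 0 T ×ˢ Icc 0 1)) :
    Continuous (Function.uncurry fun (t : Icc (0 : ℝ) T) (x : unitInterval) => f t x) :=
  hf.comp_continuous (f := fun z : Icc (0 : ℝ) T × unitInterval => ((z.1 : ℝ), (z.2 : ℝ)))
    (by fun_prop) fun z => ⟨z.1.2, z.2.2⟩

theorem continuous_at_point {f : ℝ → ℝ → ℝ}
    (hf : ContinuousOn (fun p : ℝ × ℝ => f p.1 p.2) (Icc 0 T ×ˢ Icc 0 1)) (x : unitInterval) :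
    Continuous fun t : Icc (0 : ℝ) T => f t x :=
  (continuous_restrict hf).comp (by fun_prop : Continuous fun t : Icc (0 : ℝ) T => (t, x))

end C12

/-- The slope of the affine function `a ↦ bdry ϱ D a M`. -/
def bdrySlope (ϱ D M : ℝ) : ℝ :=
  (1 / D) * ((1 - ϱ) * (Real.exp (-M) - 1) - ϱ * (Real.exp M - 1))

/-- Being affine in the boundary value, the boundary functional passes to limits and respects convex
combinations. -/
theorem bdry_eq (ϱ D a M : ℝ) : bdry ϱ D a M = bdry ϱ D 0 M + a * bdrySlope ϱ D M := by
  unfold bdry bdrySlope; ring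

theorem continuous_bdrySlope (ϱ D : ℝ) : Continuous (bdrySlope ϱ D) := by
  unfold bdrySlope; fun_prop

theorem continuous_bdry_zero (ϱ D : ℝ) : Continuous (bdry ϱ D 0) := by
  unfold bdry; fun_prop

theorem integral_bdry_eq (α A β B : ℝ) (hT : 0 < T) {π : MPath T} (hπ : ∀ t, (π t).IsAC) {C : ℝ}
    (hC : FourierEnergyLe π C) (H : C12 T) :
    (∫ t : Icc (0 : ℝ) T, (bdry α A (contValue (π t).density 0) (H.toFun t 0)
          + bdry β B (contValue (π t).density 1) (H.toFun t 1)) ∂leb T) =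
      (∫ t : Icc (0 : ℝ) T, (bdry α A 0 (H.toFun t 0) + bdry β B 0 (H.toFun t 1)) ∂leb T) +
      (∫ t, contValue (π t).density 0 * bdrySlope α A (H.toFun t 0) ∂leb T) +
      ∫ t, contValue (π t).density 1 * bdrySlope β B (H.toFun t 1) ∂leb T := by
  have c0 : Continuous fun t : Icc (0 : ℝ) T => H.toFun t 0 := C12.continuous_at_point H.cont 0
  have c1 : Continuous fun t : Icc (0 : ℝ) T => H.toFun t 1 := C12.continuous_at_point H.cont 1
  have i0 : Integrable (fun t : Icc (0 : ℝ) T =>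
      bdry α A 0 (H.toFun t 0) + bdry β B 0 (H.toFun t 1)) (leb T) :=
    (((continuous_bdry_zero α A).comp c0).add
      ((continuous_bdry_zero β B).comp c1)).integrable_of_hasCompactSupport
      (HasCompactSupport.of_compactSpace _)
  have i1 := integrable_contValue_mul hT hπ hC 0 ((continuous_bdrySlope α A).comp c0)
  have i2 := integrable_contValue_mul hT hπ hC 1 ((continuous_bdrySlope β B).comp c1)
  simp only [Function.comp_def] at i1 i2
  have i01 : Integrable (fun t : Icc (0 : ℝ) T =>
      bdry α A 0 (H.toFun t 0) + bdry β B 0 (H.toFun t 1) +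
        contValue (π t).density 0 * bdrySlope α A (H.toFun t 0)) (leb T) := i0.add i1
  rw [← integral_add i0 i1, ← integral_add i01 i2]
  refine integral_congr_ae (ae_of_all _ fun t => ?_)
  simp only
  rw [bdry_eq α A (contValue (π t).density 0), bdry_eq β B (contValue (π t).density 1)]
  ring

theorem FourierEnergyLe.of_tendsto (hT : 0 < T) {y : ℕ → MPath T} {π : MPath T} {C : ℝ}
    (hy : ∀ k, FourierEnergyLe (y k) C)
    (h : ∀ n t, Tendsto (fun k => (y k t).coef n) atTop (𝓝 ((π t).coef n))) :
    FourierEnergyLe π C := by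
  intro M
  refine le_of_tendsto' (tendsto_integral_of_dominated_convergence
    (F := fun k t => ∑ n ∈ Finset.range M, (n * Real.pi * (y k t).coef n) ^ 2)
    (fun _ => ∑ n ∈ Finset.range M, (n * Real.pi) ^ 2) (fun k => ?_) (integrable_const _)
    (fun k => ae_of_all _ fun t => ?_) (ae_of_all _ fun t => ?_)) fun k => hy k M
  · exact (Finset.measurable_fun_sum _ fun n _ =>
      (((y k).measurable_coef hT n).const_mul _).pow_const 2).aestronglyMeasurable
  · rw [Real.norm_of_nonneg (Finset.sum_nonneg fun n _ => sq_nonneg _)]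
    refine Finset.sum_le_sum fun n _ => ?_
    rw [mul_pow]
    exact mul_le_of_le_one_right (sq_nonneg _) ((sq_le_one_iff_abs_le_one _).2
      ((y k t).abs_coef_le n))
  · exact tendsto_finsetSum _ fun n _ => ((h n t).const_mul _).pow 2

/-- All terms of J converge except the mobility term, which enters with a minus sign and is replaced
by its convergent upper bound. The energy constant depends only on A, B, T and q, so the limit
inherits it. -/
theorem rate_le_of_tendsto {α A β B : ℝ} (hα : α ∈ Icc (0 : ℝ) 1) (hβ : β ∈ Icc (0 : ℝ) 1)
    (hA : 0 < A) (hB : 0 < B) {hT : 0 < T} {q : ℝ} {y : ℕ → MPath T} {π : MPath T}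
    (hy : ∀ k, rate α A β B hT (y k) ≤ q)
    (h : ∀ n t, Tendsto (fun k => (y k t).coef n) atTop (𝓝 ((π t).coef n))) :
    rate α A β B hT π ≤ q := by
  have hyA : ∀ k t, (y k t).IsAC := fun k => (isAC_and_JReal_le_of_rate_le (hy k)).1.1
  have hyJ : ∀ k H, JReal α A β B hT H (y k) ≤ q := fun k =>
    (isAC_and_JReal_le_of_rate_le (hy k)).2
  have hyC : ∀ k, FourierEnergyLe (y k) (energyConst A B T q) := fun k =>
    fourier_energy_le hα hβ hA hB (hy k)
  have hπC := FourierEnergyLe.of_tendsto hT hyC h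
  have hπ : ∀ t, (π t).IsAC := fun t => SubMeasure.isAC_of_tendsto (fun k => hyA k t) fun n => h n t
  refine rate_le_of_JReal_le (hπC.hasFiniteEnergy hT hπ) fun H => ?_
  have c0 : Continuous fun t : Icc (0 : ℝ) T => H.toFun t 0 := C12.continuous_at_point H.cont 0
  have c1 : Continuous fun t : Icc (0 : ℝ) T => H.toFun t 1 := C12.continuous_at_point H.cont 1
  have d0 : Continuous fun t : Icc (0 : ℝ) T => H.dx t 0 := C12.continuous_at_point H.cont_dx 0
  have d1 : Continuous fun t : Icc (0 : ℝ) T => H.dx t 1 := C12.continuous_at_point H.cont_dx 1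
  have hx : Continuous (Function.uncurry fun (t : Icc (0 : ℝ) T) (x : unitInterval) =>
      (H.dx t x) ^ 2) := (C12.continuous_restrict H.cont_dx).pow 2
  obtain ⟨D, hD, hDlim⟩ := exists_mobility_upper_bound hT hyA hπ h hx fun t x => sq_nonneg _
  have l1 := SubMeasure.tendsto_integral_density_mul (fun k => hyA k (timeEnd hT))
    (hπ (timeEnd hT)) (fun n => h n _) (f := fun x : unitInterval => H.toFun T x)
    (integrable_of_continuous (continuous_curry (C12.continuous_restrict H.cont) (timeEnd hT)))
  have l2 := SubMeasure.tendsto_integral_density_mul (fun k => hyA k (timeZero hT))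
    (hπ (timeZero hT)) (fun n => h n _) (f := fun x : unitInterval => H.toFun 0 x)
    (integrable_of_continuous (continuous_curry (C12.continuous_restrict H.cont) (timeZero hT)))
  have l3 := tendsto_integral_integral_density_mul hT hyA hπ h (C12.continuous_restrict H.cont_dt)
  have l4 := tendsto_integral_integral_density_mul hT hyA hπ h (C12.continuous_restrict H.cont_dxx)
  have l5 := tendsto_integral_contValue_mul hT hyA hπ hyC hπC h 1 d1
  have l6 := tendsto_integral_contValue_mul hT hyA hπ hyC hπC h 0 d0
  have l7 := tendsto_integral_contValue_mul hT hyA hπ hyC hπC h 0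
    ((continuous_bdrySlope α A).comp c0)
  have l8 := tendsto_integral_contValue_mul hT hyA hπ hyC hπC h 1
    ((continuous_bdrySlope β B).comp c1)
  have l9 := ((tendsto_const_nhds (x := ∫ t : Icc (0 : ℝ) T,
    (bdry α A 0 (H.toFun t 0) + bdry β B 0 (H.toFun t 1)) ∂leb T)).add l7).add l8
  have L := ((((((l1.sub l2).sub l3).sub l4).add l5).sub l6).sub hDlim).sub l9
  unfold JReal
  rw [integral_bdry_eq α A β B hT hπ hπC H]
  refine le_of_tendsto' L fun k => le_trans ?_ (hyJ k H)
  unfold JReal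
  rw [integral_bdry_eq α A β B hT (hyA k) (hyC k) H]
  have := hD k
  simp only [Function.comp_def]
  linarith

theorem rateFrom_le_iff {α A β B : ℝ} {hT : 0 < T} {γ : unitInterval → unitInterval} {π : MPath T}
    {q : ℝ} : rateFrom α A β B hT γ π ≤ q ↔
      (π (timeZero hT)).density =ᵐ[volume] (fun x => (γ x : ℝ)) ∧ rate α A β B hT π ≤ q := by
  unfold rateFrom
  split_ifs with h
  · simp [h]
  · simp [h, top_le_iff]

theorem memLp_initial {γ : unitInterval → unitInterval} (hγ : Measurable γ) :
    MemLp (fun x => (γ x : ℝ)) 2 := by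
  refine MemLp.of_bound (measurable_subtype_coe.comp hγ).aestronglyMeasurable 1
    (ae_of_all _ fun x => ?_)
  rw [Real.norm_of_nonneg (γ x).2.1]
  exact (γ x).2.2

/-- The initial density is determined by its cosine coefficients, and these are constant along the
sequence. -/
theorem rateFrom_le_of_tendsto {α A β B : ℝ} (hα : α ∈ Icc (0 : ℝ) 1) (hβ : β ∈ Icc (0 : ℝ) 1)
    (hA : 0 < A) (hB : 0 < B) {hT : 0 < T} {γ : unitInterval → unitInterval} (hγ : Measurable γ)
    {q : ℝ} {y : ℕ → MPath T} {π : MPath T} (hy : ∀ k, rateFrom α A β B hT γ (y k) ≤ q)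
    (h : ∀ n t, Tendsto (fun k => (y k t).coef n) atTop (𝓝 ((π t).coef n))) :
    rateFrom α A β B hT γ π ≤ q := by
  have hr : rate α A β B hT π ≤ q :=
    rate_le_of_tendsto hα hβ hA hB (fun k => (rateFrom_le_iff.1 (hy k)).2) h
  refine rateFrom_le_iff.2 ⟨?_, hr⟩
  have hπ : (π (timeZero hT)).IsAC := (isAC_and_JReal_le_of_rate_le hr).1.1 _
  refine ae_eq_of_cos_coef_eq hπ.memLp_density (memLp_initial hγ) fun n => ?_
  rw [← hπ.pairing_eq]
  refine tendsto_nhds_unique (h n (timeZero hT)) (tendsto_const_nhds.congr fun k => ?_)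
  obtain ⟨h0, hk⟩ := rateFrom_le_iff.1 (hy k)
  rw [SubMeasure.coef, ((isAC_and_JReal_le_of_rate_le hk).1.1 _).pairing_eq]
  refine integral_congr_ae ?_
  filter_upwards [h0] with x hx
  rw [hx]

/-! ### The Skorohod topology on level sets -/

theorem exists_uniform_modulus {α A β B : ℝ} (hα : α ∈ Icc (0 : ℝ) 1) (hβ : β ∈ Icc (0 : ℝ) 1)
    (hA : 0 < A) (hB : 0 < B) (hT : 0 < T) (q : ℝ) (N : ℕ) {η : ℝ} (hη : 0 < η) :
    ∃ δ > 0, ∀ π : MPath T, rate α A β B hT π ≤ q → ∀ s t : Icc (0 : ℝ) T, |(s : ℝ) - t| < δ →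
      ∀ n < N, |(π s).coef n - (π t).coef n| < η := by
  induction N with
  | zero => exact ⟨1, one_pos, fun _ _ _ _ _ n hn => absurd hn (Nat.not_lt_zero n)⟩
  | succ N ih =>
    obtain ⟨δ, hδ, h⟩ := ih
    obtain ⟨δ', hδ', h'⟩ := coef_equicontinuous hα hβ hA hB hT q N hη
    refine ⟨min δ δ', lt_min hδ hδ', fun π hπ s t hst n hn => ?_⟩
    rcases Nat.lt_succ_iff_lt_or_eq.1 hn with hn | rfl
    · exact h π hπ s t (hst.trans_le (min_le_left _ _)) n hn
    · exact h' π hπ s t (hst.trans_le (min_le_right _ _))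

theorem SubMeasure.coef_mem_uniformity (N : ℕ) {η : ℝ} (hη : 0 < η) :
    {p : SubMeasure × SubMeasure | ∀ n < N, |p.1.coef n - p.2.coef n| < η} ∈
      uniformity SubMeasure := by
  have := (eventually_all_finite (Set.finite_Iio N)).2 fun n _ =>
    SubMeasure.pairing_mem_uniformity (cosMap n) hη
  filter_upwards [this] with p hp n hn using hp n hn

/-- If x were outside but not interior to the complement, the level set would contain paths
arbitrarily Skorohod-close to x. The uniform modulus undoes the time changes, giving a sequence
whose coefficients converge pointwise to those of x; no regularity of x is needed. -/
theorem isClosed_level {α A β B : ℝ} (hα : α ∈ Icc (0 : ℝ) 1) (hβ : β ∈ Icc (0 : ℝ) 1)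
    (hA : 0 < A) (hB : 0 < B) (hT : 0 < T) {γ : unitInterval → unitInterval} (hγ : Measurable γ)
    (q : ℝ) : IsClosed {π : MPath T | rateFrom α A β B hT γ π ≤ q} := by
  rw [← isOpen_compl_iff]
  intro x hx
  by_contra hcon
  push Not at hcon
  have hk : ∀ k : ℕ, ∃ y : MPath T, rateFrom α A β B hT γ y ≤ q ∧ ∀ t, ∀ n < k,
      |(y t).coef n - (x t).coef n| < 2 * (1 / ((k : ℝ) + 1)) := by
    intro k
    have hη : (0 : ℝ) < 1 / ((k : ℝ) + 1) := by positivity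
    -- The admissible time change is taken as small as the modulus allows, so that y(l t) and y(t)
    -- differ by less than 1/(k + 1) in the first k coefficients.
    obtain ⟨δ, hδ, hmod⟩ := exists_uniform_modulus hα hβ hA hB hT q k hη
    obtain ⟨y, ⟨l, hl, hxy⟩, hy⟩ := hcon δ hδ _ (SubMeasure.coef_mem_uniformity k hη)
    have hy' : rateFrom α A β B hT γ y ≤ q := not_not.1 hy
    refine ⟨y, hy', fun t n hn => ?_⟩
    have h1 := abs_lt.1 (hmod y (rateFrom_le_iff.1 hy').2 (l t) t (hl t) n hn)
    have h2 := abs_lt.1 (hxy t n hn)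
    rw [abs_lt]
    constructor <;> linarith [h1.1, h1.2, h2.1, h2.2]
  choose y hy hyx using hk
  refine hx (rateFrom_le_of_tendsto hα hβ hA hB hγ hy fun n t => ?_)
  rw [tendsto_iff_dist_tendsto_zero]
  have hz : Tendsto (fun k : ℕ => 2 * (1 / ((k : ℝ) + 1))) atTop (𝓝 0) := by
    simpa using (tendsto_one_div_add_atTop_nhds_zero_nat (𝕜 := ℝ)).const_mul 2
  refine squeeze_zero' (Eventually.of_forall fun k => dist_nonneg) ?_ hz
  filter_upwards [eventually_gt_atTop n] with k hk using (hyx k t n hk).le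

theorem SubMeasure.tendsto_of_coef {ι : Type*} {F : Filter ι} {y : ι → SubMeasure}
    {p : SubMeasure} (h : ∀ n, Tendsto (fun i => (y i).coef n) F (𝓝 (p.coef n))) :
    Tendsto y F (𝓝 p) := by
  rw [Uniform.tendsto_nhds_right]
  intro V hV
  obtain ⟨N, δ, hδ, H⟩ := exists_coef_control hV
  have := (eventually_all_finite (Set.finite_Iio N)).2 fun n _ =>
    Metric.tendsto_nhds.1 (h n) δ hδ
  rw [mem_map]
  filter_upwards [this] with i hi
  refine H _ _ fun n hn => ?_
  rw [← Real.dist_eq, dist_comm]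
  exact hi n hn

/-- An Arzelà–Ascoli argument with ultrafilters: compactness of the target gives pointwise limits,
and the uniform modulus passes to the limit and upgrades pointwise to uniform convergence. -/
theorem isCompact_level {α A β B : ℝ} (hα : α ∈ Icc (0 : ℝ) 1) (hβ : β ∈ Icc (0 : ℝ) 1)
    (hA : 0 < A) (hB : 0 < B) (hT : 0 < T) {γ : unitInterval → unitInterval} (hγ : Measurable γ)
    (q : ℝ) : IsCompact {π : MPath T | rateFrom α A β B hT γ π ≤ q} := by
  rw [isCompact_iff_ultrafilter_le_nhds]
  intro f hf
  have hS : ∀ᶠ π in (f : Filter (MPath T)), rate α A β B hT π ≤ q := by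
    have : {π : MPath T | rateFrom α A β B hT γ π ≤ q} ∈ f := le_principal_iff.1 hf
    filter_upwards [this] with π hπ using (rateFrom_le_iff.1 hπ).2
  have hlim : ∀ t, ∃ p, Tendsto (fun π : MPath T => π t) f (𝓝 p) := by
    intro t
    obtain ⟨p, -, hp⟩ := isCompact_iff_ultrafilter_le_nhds.1 (isCompact_univ (X := SubMeasure))
      (f.map fun π => π t) (by simp)
    exact ⟨p, hp⟩
  choose p hp using hlim
  have hc : ∀ n t, Tendsto (fun π : MPath T => (π t).coef n) f (𝓝 ((p t).coef n)) := fun n t =>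
    ((SubMeasure.continuous_pairing (cosMap n)).tendsto _).comp (hp t)
  have hmod : ∀ N : ℕ, ∀ η > 0, ∃ δ > 0, ∀ s t : Icc (0 : ℝ) T, |(s : ℝ) - t| < δ → ∀ n < N,
      |(p s).coef n - (p t).coef n| ≤ η := by
    intro N η hη
    obtain ⟨δ, hδ, H⟩ := exists_uniform_modulus hα hβ hA hB hT q N hη
    refine ⟨δ, hδ, fun s t hst n hn => le_of_tendsto ((hc n s).sub (hc n t)).abs ?_⟩
    filter_upwards [hS] with π hπ using (H π hπ s t hst n hn).le
  have hcont : Continuous p := by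
    refine continuous_iff_continuousAt.2 fun t => SubMeasure.tendsto_of_coef fun n => ?_
    rw [Metric.tendsto_nhds]
    intro η hη
    obtain ⟨δ, hδ, H⟩ := hmod (n + 1) (η / 2) (half_pos hη)
    filter_upwards [Metric.ball_mem_nhds t hδ] with s hs
    exact (H s t hs n (Nat.lt_succ_self n)).trans_lt (half_lt_self hη)
  let x : MPath T := ⟨p, fun t => hcont.continuousWithinAt,
    fun t => ⟨p t, (hcont.tendsto t).mono_left nhdsWithin_le_nhds⟩⟩
  have hfx : (f : Filter (MPath T)) ≤ 𝓝 x := by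
    refine le_nhds_iff.2 fun U hxU hU => ?_
    obtain ⟨ε, hε, V, hV, hUV⟩ := hU x hxU
    obtain ⟨N, η, hη, hN⟩ := SubMeasure.exists_coef_control hV
    have hη3 : 0 < η / 3 := by linarith
    obtain ⟨δ, hδ, H⟩ := exists_uniform_modulus hα hβ hA hB hT q N hη3
    obtain ⟨δ', hδ', H'⟩ := hmod N (η / 3) hη3
    -- Convergence at a finite net of times suffices: the moduli of the path and of the limit
    -- control the rest, with three errors of size η/3.
    obtain ⟨F, -, hF, hcov⟩ := finite_cover_balls_of_compact
      (isCompact_univ (X := Icc (0 : ℝ) T)) (lt_min hδ hδ')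
    have hev : ∀ᶠ π in (f : Filter (MPath T)), ∀ s ∈ F, ∀ n ∈ Iio N,
        dist ((π s).coef n) ((p s).coef n) < η / 3 :=
      (eventually_all_finite hF).2 fun s _ => (eventually_all_finite (Set.finite_Iio N)).2
        fun n _ => Metric.tendsto_nhds.1 (hc n s) _ hη3
    filter_upwards [hev, hS] with π h1 h2
    -- Uniform closeness is Skorohod closeness with the identity time change.
    refine hUV π ⟨OrderIso.refl _, fun t => by simpa using hε, fun t => hN _ _ fun n hn => ?_⟩
    obtain ⟨s, hs, hts⟩ := mem_iUnion₂.1 (hcov (mem_univ t))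
    have hts' : |(t : ℝ) - s| < min δ δ' := hts
    have a1 := abs_lt.1 (H π h2 t s (hts'.trans_le (min_le_left _ _)) n hn)
    have a2 := abs_le.1 (H' t s (hts'.trans_le (min_le_right _ _)) n hn)
    have a3 := h1 s hs n hn
    rw [Real.dist_eq, abs_lt] at a3
    change |(p t).coef n - (π t).coef n| < η
    rw [abs_lt]
    constructor <;> linarith [a1.1, a1.2, a2.1, a2.2, a3.1, a3.2]
  refine ⟨x, ?_, hfx⟩
  have hcl := isClosed_level hα hβ hA hB hT hγ q
  rw [← hcl.closure_eq]
  exact mem_closure_iff_ultrafilter.2 ⟨f, le_principal_iff.1 hf, hfx⟩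

/-! ### Convexity -/

namespace SubMeasure

theorem pairing_comb (a b : ℝ≥0) (hab : a + b = 1) (p q : SubMeasure) (f : C(unitInterval, ℝ)) :
    (comb a b hab p q).pairing f = a * p.pairing f + b * q.pairing f := by
  have h : (comb a b hab p q).meas = a • p.meas + b • q.meas := by
    simp [comb, meas]
  rw [pairing, h, integral_add_measure, integral_smul_nnreal_measure, integral_smul_nnreal_measure]
  · rfl
  · exact (p.integrable_continuousMap f).smul_measure_nnreal
  · exact (q.integrable_continuousMap f).smul_measure_nnreal

theorem coef_comb (a b : ℝ≥0) (hab : a + b = 1) (p q : SubMeasure) (n : ℕ) :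
    (comb a b hab p q).coef n = a * p.coef n + b * q.coef n := pairing_comb ..

theorem coe_add_coe {a b : ℝ≥0} (hab : a + b = 1) : (a : ℝ) + b = 1 := by exact_mod_cast hab

theorem IsAC.comb {p q : SubMeasure} (hp : p.IsAC) (hq : q.IsAC) (a b : ℝ≥0) (hab : a + b = 1) :
    (comb a b hab p q).IsAC := by
  refine isAC_iff_le_volume.2 (le_volume_of_pairing_le fun f hf => ?_)
  rw [pairing_comb]
  calc (a : ℝ) * p.pairing f + b * q.pairing f ≤ a * (∫ x, f x) + b * ∫ x, f x := by
        gcongr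
        · exact hp.pairing_le hf
        · exact hq.pairing_le hf
    _ = ∫ x, f x := by rw [← add_mul, coe_add_coe hab, one_mul]

/-- Comparing cosine coefficients avoids any calculus of Radon–Nikodym derivatives. -/
theorem IsAC.density_comb {p q : SubMeasure} (hp : p.IsAC) (hq : q.IsAC) (a b : ℝ≥0)
    (hab : a + b = 1) :
    (SubMeasure.comb a b hab p q).density =ᵐ[volume] fun x => a * p.density x + b * q.density x := by
  refine ae_eq_of_cos_coef_eq (hp.comb hq a b hab).memLp_density
    ((hp.memLp_density.const_mul _).add (hq.memLp_density.const_mul _)) fun n => ?_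
  have hi := integrable_of_continuous (cosMap n).continuous
  rw [← (hp.comb hq a b hab).pairing_eq, pairing_comb, hp.pairing_eq, hq.pairing_eq,
    ← integral_const_mul, ← integral_const_mul,
    ← integral_add ((hp.integrable_density_mul hi).const_mul _)
      ((hq.integrable_density_mul hi).const_mul _)]
  exact integral_congr_ae (ae_of_all _ fun x => by simp only; ring)

theorem IsAC.integral_density_comb_mul {p q : SubMeasure} (hp : p.IsAC) (hq : q.IsAC) (a b : ℝ≥0)
    (hab : a + b = 1) {f : unitInterval → ℝ} (hf : Integrable f) :
    ∫ x, (SubMeasure.comb a b hab p q).density x * f x =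
      a * (∫ x, p.density x * f x) + b * ∫ x, q.density x * f x := by
  rw [← integral_const_mul, ← integral_const_mul,
    ← integral_add ((hp.integrable_density_mul hf).const_mul _)
      ((hq.integrable_density_mul hf).const_mul _)]
  refine integral_congr_ae ?_
  filter_upwards [hp.density_comb hq a b hab] with x hx
  rw [hx]
  ring

/-- Concavity of the mobility: the two integrands differ by ab(u − v)² f. -/
theorem IsAC.integral_mobility_comb_ge {p q : SubMeasure} (hp : p.IsAC) (hq : q.IsAC) (a b : ℝ≥0)
    (hab : a + b = 1) {f : unitInterval → ℝ} (hf : Integrable f) (hf0 : ∀ x, 0 ≤ f x) :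
    a * (∫ x, mobility (p.density x) * f x) + b * (∫ x, mobility (q.density x) * f x) ≤
      ∫ x, mobility ((SubMeasure.comb a b hab p q).density x) * f x := by
  rw [← integral_const_mul, ← integral_const_mul,
    ← integral_add ((hp.integrable_mobility_mul hf).const_mul _)
      ((hq.integrable_mobility_mul hf).const_mul _)]
  refine integral_mono_ae (((hp.integrable_mobility_mul hf).const_mul _).add
    ((hq.integrable_mobility_mul hf).const_mul _))
    ((hp.comb hq a b hab).integrable_mobility_mul hf) ?_
  filter_upwards [hp.density_comb hq a b hab] with x hx
  rw [hx]
  have h1 := coe_add_coe hab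
  have hb : (b : ℝ) = 1 - a := by linarith
  have ha0 : (0 : ℝ) ≤ a := a.2
  have hb0 : (0 : ℝ) ≤ 1 - a := hb ▸ b.2
  unfold mobility
  rw [hb]
  have : 0 ≤ (a : ℝ) * (1 - a) * (p.density x - q.density x) ^ 2 * f x :=
    mul_nonneg (mul_nonneg (mul_nonneg ha0 hb0) (sq_nonneg _)) (hf0 x)
  linarith

end SubMeasure

/-- Linearity relies on both densities having continuous versions, since the default value 0 would
break it; the finite sums guarantee this. -/
theorem contValue_comb {p q : SubMeasure} (hp : p.IsAC) (hq : q.IsAC) (a b : ℝ≥0)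
    (hab : a + b = 1) {e e' : ℝ} (he : HasSum (fun n : ℕ => (n * Real.pi * p.coef n) ^ 2) e)
    (he' : HasSum (fun n : ℕ => (n * Real.pi * q.coef n) ^ 2) e') (x : unitInterval) :
    contValue (SubMeasure.comb a b hab p q).density x =
      a * contValue p.density x + b * contValue q.density x := by
  obtain ⟨w, hw, -⟩ := exists_continuous_version hp he
  obtain ⟨w', hw', -⟩ := exists_continuous_version hq he'
  have h : (SubMeasure.comb a b hab p q).density =ᵐ[volume]
      ((a : ℝ) • w + (b : ℝ) • w' : C(unitInterval, ℝ)) := by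
    filter_upwards [hp.density_comb hq a b hab, hw, hw'] with x h1 h2 h3
    rw [h1, h2, h3]
    simp
  rw [contValue_eq h, contValue_eq hw, contValue_eq hw']
  simp

theorem FourierEnergyLe.comb (hT : 0 < T) {π ν : MPath T} {C C' : ℝ} (h : FourierEnergyLe π C)
    (h' : FourierEnergyLe ν C') (a b : ℝ≥0) (hab : a + b = 1) :
    FourierEnergyLe (MPath.comb a b hab π ν) (a * C + b * C') := by
  intro M
  have i1 : ∀ ρ : MPath T, Integrable (fun t => ∑ n ∈ Finset.range M,
      (n * Real.pi * (ρ t).coef n) ^ 2) (leb T) := fun ρ =>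
    integrable_finsetSum _ fun n _ => integrable_coef_poly hT ρ n
  have hle : ∫ t, ∑ n ∈ Finset.range M, (n * Real.pi * (MPath.comb a b hab π ν t).coef n) ^ 2
      ∂leb T ≤ ∫ t, (a * (∑ n ∈ Finset.range M, (n * Real.pi * (π t).coef n) ^ 2) +
        b * ∑ n ∈ Finset.range M, (n * Real.pi * (ν t).coef n) ^ 2) ∂leb T := by
    refine integral_mono (i1 _) (((i1 π).const_mul _).add ((i1 ν).const_mul _)) fun t => ?_
    simp only
    rw [Finset.mul_sum, Finset.mul_sum, ← Finset.sum_add_distrib]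
    refine Finset.sum_le_sum fun n _ => ?_
    have e1 : (MPath.comb a b hab π ν t).coef n = a * (π t).coef n + b * (ν t).coef n :=
      SubMeasure.coef_comb a b hab ..
    rw [e1]
    have hb : (b : ℝ) = 1 - a := by linarith [SubMeasure.coe_add_coe hab]
    have hb0 : (0 : ℝ) ≤ 1 - a := hb ▸ b.2
    rw [hb]
    have : 0 ≤ (a : ℝ) * (1 - a) * (n * Real.pi * ((π t).coef n - (ν t).coef n)) ^ 2 :=
      mul_nonneg (mul_nonneg a.2 hb0) (sq_nonneg _)
    linarith
  rw [integral_add ((i1 π).const_mul _) ((i1 ν).const_mul _), integral_const_mul,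
    integral_const_mul] at hle
  refine hle.trans ?_
  have h1 := mul_le_mul_of_nonneg_left (h M) a.2
  have h2 := mul_le_mul_of_nonneg_left (h' M) b.2
  exact add_le_add h1 h2

theorem integral_eq_of_ae_eq_comb {Ω : Type*} [MeasurableSpace Ω] {μ : Measure Ω}
    {f g h : Ω → ℝ} (a b : ℝ) (hf : Integrable f μ) (hg : Integrable g μ)
    (hh : ∀ᵐ x ∂μ, h x = a * f x + b * g x) :
    ∫ x, h x ∂μ = a * (∫ x, f x ∂μ) + b * ∫ x, g x ∂μ := by
  rw [integral_congr_ae hh, integral_add (hf.const_mul a) (hg.const_mul b), integral_const_mul,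
    integral_const_mul]

/-- Every term is affine along the segment except the mobility term, where concavity and the minus
sign give the inequality. The energy bounds provide linearity of boundary values at almost every
time. -/
theorem JReal_comb_le (α A β B : ℝ) (hT : 0 < T) {π ν : MPath T} (hπ : ∀ t, (π t).IsAC)
    (hν : ∀ t, (ν t).IsAC) {C C' : ℝ} (h : FourierEnergyLe π C) (h' : FourierEnergyLe ν C')
    (a b : ℝ≥0) (hab : a + b = 1) (H : C12 T) :
    JReal α A β B hT H (MPath.comb a b hab π ν) ≤
      a * JReal α A β B hT H π + b * JReal α A β B hT H ν := by
  have hc : ∀ t, MPath.comb a b hab π ν t = SubMeasure.comb a b hab (π t) (ν t) := fun _ => rfl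
  have hcA : ∀ t, (MPath.comb a b hab π ν t).IsAC := fun t => (hπ t).comb (hν t) a b hab
  have hcE := h.comb hT h' a b hab
  obtain ⟨e, -, -, -, hes⟩ := h.exists_hasSum hT
  obtain ⟨e', -, -, -, hes'⟩ := h'.exists_hasSum hT
  have c0 : Continuous fun t : Icc (0 : ℝ) T => H.toFun t 0 := C12.continuous_at_point H.cont 0
  have c1 : Continuous fun t : Icc (0 : ℝ) T => H.toFun t 1 := C12.continuous_at_point H.cont 1
  have d0 : Continuous fun t : Icc (0 : ℝ) T => H.dx t 0 := C12.continuous_at_point H.cont_dx 0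
  have d1 : Continuous fun t : Icc (0 : ℝ) T => H.dx t 1 := C12.continuous_at_point H.cont_dx 1
  have hx : Continuous (Function.uncurry fun (t : Icc (0 : ℝ) T) (x : unitInterval) =>
      (H.dx t x) ^ 2) := (C12.continuous_restrict H.cont_dx).pow 2
  have hbulk : ∀ {F : Icc (0 : ℝ) T → unitInterval → ℝ}, Continuous (Function.uncurry F) →
      ∫ t, (∫ x, (MPath.comb a b hab π ν t).density x * F t x) ∂leb T =
        a * (∫ t, (∫ x, (π t).density x * F t x) ∂leb T) +
          b * ∫ t, (∫ x, (ν t).density x * F t x) ∂leb T := fun hF =>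
    integral_eq_of_ae_eq_comb _ _ (integrable_integral_density_mul hT hπ hF)
      (integrable_integral_density_mul hT hν hF) (ae_of_all _ fun t =>
        (hπ t).integral_density_comb_mul (hν t) a b hab
          (integrable_of_continuous (continuous_curry hF t)))
  have hbd : ∀ (x : unitInterval) {φ : Icc (0 : ℝ) T → ℝ}, Continuous φ →
      ∫ t, contValue (MPath.comb a b hab π ν t).density x * φ t ∂leb T =
        a * (∫ t, contValue (π t).density x * φ t ∂leb T) +
          b * ∫ t, contValue (ν t).density x * φ t ∂leb T := by
    intro x φ hφ
    refine integral_eq_of_ae_eq_comb _ _ (integrable_contValue_mul hT hπ h x hφ)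
      (integrable_contValue_mul hT hν h' x hφ) ?_
    filter_upwards [hes, hes'] with t h1 h2
    rw [hc, contValue_comb (hπ t) (hν t) a b hab h1 h2]
    ring
  have t1 := (hπ (timeEnd hT)).integral_density_comb_mul (hν (timeEnd hT)) a b hab
    (f := fun x : unitInterval => H.toFun T x)
    (integrable_of_continuous (continuous_curry (C12.continuous_restrict H.cont) (timeEnd hT)))
  have t2 := (hπ (timeZero hT)).integral_density_comb_mul (hν (timeZero hT)) a b hab
    (f := fun x : unitInterval => H.toFun 0 x)
    (integrable_of_continuous (continuous_curry (C12.continuous_restrict H.cont) (timeZero hT)))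
  have t3 := hbulk (C12.continuous_restrict H.cont_dt)
  have t4 := hbulk (C12.continuous_restrict H.cont_dxx)
  have t5 := hbd 1 d1
  have t6 := hbd 0 d0
  have t7 := hbd 0 ((continuous_bdrySlope α A).comp c0)
  have t8 := hbd 1 ((continuous_bdrySlope β B).comp c1)
  have t9 : a * (∫ t : Icc (0 : ℝ) T, (∫ x : unitInterval,
        mobility ((π t).density x) * (H.dx t x) ^ 2) ∂leb T) +
      b * (∫ t : Icc (0 : ℝ) T, (∫ x : unitInterval,
        mobility ((ν t).density x) * (H.dx t x) ^ 2) ∂leb T) ≤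
      ∫ t : Icc (0 : ℝ) T, (∫ x : unitInterval,
        mobility ((MPath.comb a b hab π ν t).density x) * (H.dx t x) ^ 2) ∂leb T := by
    have i1 := integrable_integral_mobility_mul hT hπ hx
    have i2 := integrable_integral_mobility_mul hT hν hx
    rw [← integral_const_mul, ← integral_const_mul,
      ← integral_add (i1.const_mul _) (i2.const_mul _)]
    exact integral_mono ((i1.const_mul _).add (i2.const_mul _))
      (integrable_integral_mobility_mul hT hcA hx) fun t =>
      (hπ t).integral_mobility_comb_ge (hν t) a b hab
        (integrable_of_continuous (continuous_curry hx t)) fun x => sq_nonneg _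
  unfold JReal
  rw [integral_bdry_eq α A β B hT hcA hcE H, integral_bdry_eq α A β B hT hπ h H,
    integral_bdry_eq α A β B hT hν h' H]
  simp only [hc, Function.comp_def] at t1 t2 t3 t4 t5 t6 t7 t8 t9 ⊢
  have hab' := SubMeasure.coe_add_coe hab
  set K := ∫ t : Icc (0 : ℝ) T, (bdry α A 0 (H.toFun t 0) + bdry β B 0 (H.toFun t 1)) ∂leb T
  have hK : K = a * K + b * K := by rw [← add_mul, hab', one_mul]
  rw [t1, t2, t3, t4, t5, t6, t7, t8]
  linarith

/-! ### Nonnegativity, convexity with extended real values, lower semicontinuity -/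

theorem rate_nonneg (α A β B : ℝ) (hT : 0 < T) (π : MPath T) : 0 ≤ rate α A β B hT π := by
  let H : C12 T := cosTest ∅ (fun _ _ => 0) (fun _ _ => 0)
    (fun _ _ _ => hasDerivWithinAt_const ..) fun _ => continuousOn_const
  refine le_trans ?_ (le_iSup _ H)
  unfold J
  split_ifs with h
  · have : JReal α A β B hT H π = 0 := by simp [JReal, H, cosTest, bdry_zero]
    rw [this, EReal.coe_zero]
  · exact le_top

theorem rateFrom_nonneg (α A β B : ℝ) (hT : 0 < T) (γ : unitInterval → unitInterval)
    (π : MPath T) : 0 ≤ rateFrom α A β B hT γ π := by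
  unfold rateFrom
  split_ifs
  · exact rate_nonneg α A β B hT π
  · exact le_top

theorem MPath.comb_zero_one (hab : (0 : ℝ≥0) + 1 = 1) (π ν : MPath T) :
    MPath.comb 0 1 hab π ν = ν := by
  cases ν
  simp [MPath.comb, SubMeasure.comb]

theorem MPath.comb_one_zero (hab : (1 : ℝ≥0) + 0 = 1) (π ν : MPath T) :
    MPath.comb 1 0 hab π ν = π := by
  cases π
  simp [MPath.comb, SubMeasure.comb]

theorem rateFrom_comb_le_of_le {α A β B : ℝ} (hα : α ∈ Icc (0 : ℝ) 1) (hβ : β ∈ Icc (0 : ℝ) 1)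
    (hA : 0 < A) (hB : 0 < B) (hT : 0 < T) {γ : unitInterval → unitInterval} {π ν : MPath T}
    {r s : ℝ} (hr : rateFrom α A β B hT γ π ≤ r) (hs : rateFrom α A β B hT γ ν ≤ s) (a b : ℝ≥0)
    (hab : a + b = 1) :
    rateFrom α A β B hT γ (MPath.comb a b hab π ν) ≤ ((a * r + b * s : ℝ) : EReal) := by
  obtain ⟨hπ0, hπ⟩ := rateFrom_le_iff.1 hr
  obtain ⟨hν0, hν⟩ := rateFrom_le_iff.1 hs
  obtain ⟨⟨hπA, -⟩, hπJ⟩ := isAC_and_JReal_le_of_rate_le hπ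
  obtain ⟨⟨hνA, -⟩, hνJ⟩ := isAC_and_JReal_le_of_rate_le hν
  have hπE : FourierEnergyLe π (energyConst A B T r) := fourier_energy_le hα hβ hA hB hπ
  have hνE : FourierEnergyLe ν (energyConst A B T s) := fourier_energy_le hα hβ hA hB hν
  refine rateFrom_le_iff.2 ⟨?_, rate_le_of_JReal_le ((hπE.comb hT hνE a b hab).hasFiniteEnergy hT
    fun t => (hπA t).comb (hνA t) a b hab) fun H =>
      (JReal_comb_le α A β B hT hπA hνA hπE hνE a b hab H).trans ?_⟩
  · filter_upwards [(hπA (timeZero hT)).density_comb (hνA (timeZero hT)) a b hab, hπ0, hν0]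
      with x h1 h2 h3
    refine h1.trans ?_
    rw [h2, h3, ← add_mul, SubMeasure.coe_add_coe hab, one_mul]
  · exact add_le_add (mul_le_mul_of_nonneg_left (hπJ H) a.2)
      (mul_le_mul_of_nonneg_left (hνJ H) b.2)

theorem rateFrom_comb_le {α A β B : ℝ} (hα : α ∈ Icc (0 : ℝ) 1) (hβ : β ∈ Icc (0 : ℝ) 1)
    (hA : 0 < A) (hB : 0 < B) (hT : 0 < T) (γ : unitInterval → unitInterval) (a b : ℝ≥0)
    (hab : a + b = 1) (π ν : MPath T) :
    rateFrom α A β B hT γ (MPath.comb a b hab π ν) ≤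
      ((a : ℝ) : EReal) * rateFrom α A β B hT γ π + ((b : ℝ) : EReal) * rateFrom α A β B hT γ ν := by
  -- Zero weights are treated apart because 0 · ⊤ = 0, so an infinite rate does not make the right
  -- side infinite there.
  rcases eq_or_ne a 0 with rfl | ha
  · obtain rfl : b = 1 := by simpa using hab
    simp [MPath.comb_zero_one]
  rcases eq_or_ne b 0 with rfl | hb
  · obtain rfl : a = 1 := by simpa using hab
    simp [MPath.comb_one_zero]
  have ha' : (0 : ℝ) < a := by positivity
  have hb' : (0 : ℝ) < b := by positivity
  have hnn : ∀ (c : ℝ≥0) (ρ : MPath T), 0 ≤ ((c : ℝ) : EReal) * rateFrom α A β B hT γ ρ :=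
    fun c ρ => mul_nonneg (by exact_mod_cast c.2) (rateFrom_nonneg ..)
  have hbot : ∀ (c : ℝ≥0) (ρ : MPath T), ((c : ℝ) : EReal) * rateFrom α A β B hT γ ρ ≠ ⊥ :=
    fun c ρ h => absurd (h ▸ hnn c ρ) (by simp)
  rcases eq_or_ne (rateFrom α A β B hT γ π) ⊤ with h1 | h1
  · rw [h1, EReal.coe_mul_top_of_pos ha', EReal.top_add_of_ne_bot (hbot b ν)]
    exact le_top
  rcases eq_or_ne (rateFrom α A β B hT γ ν) ⊤ with h2 | h2
  · rw [h2, EReal.coe_mul_top_of_pos hb', EReal.add_top_of_ne_bot (hbot a π)]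
    exact le_top
  have hne : ∀ ρ : MPath T, rateFrom α A β B hT γ ρ ≠ ⊥ := fun ρ h =>
    absurd (h ▸ rateFrom_nonneg α A β B hT γ ρ) (by simp)
  obtain ⟨r, hr⟩ : ∃ r : ℝ, rateFrom α A β B hT γ π = r :=
    ⟨_, (EReal.coe_toReal h1 (hne π)).symm⟩
  obtain ⟨s, hs⟩ : ∃ s : ℝ, rateFrom α A β B hT γ ν = s :=
    ⟨_, (EReal.coe_toReal h2 (hne ν)).symm⟩
  refine (rateFrom_comb_le_of_le hα hβ hA hB hT hr.le hs.le a b hab).trans (le_of_eq ?_)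
  rw [hr, hs]
  push_cast
  rfl

theorem lowerSemicontinuous_rateFrom {α A β B : ℝ} (hα : α ∈ Icc (0 : ℝ) 1)
    (hβ : β ∈ Icc (0 : ℝ) 1) (hA : 0 < A) (hB : 0 < B) (hT : 0 < T)
    {γ : unitInterval → unitInterval} (hγ : Measurable γ) :
    LowerSemicontinuous (rateFrom α A β B hT γ) := by
  rw [lowerSemicontinuous_iff_isClosed_preimage]
  intro q
  induction q with
  | bot =>
    convert isClosed_empty
    ext π
    simp only [mem_preimage, mem_Iic, le_bot_iff, mem_empty_iff_false, iff_false]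
    exact fun h => absurd (h ▸ rateFrom_nonneg α A β B hT γ π) (by simp)
  | coe q => exact isClosed_level hα hβ hA hB hT hγ q
  | top => simp

end RobinExclusion

end

theorem theorem2p2 (α β A B T : ℝ) (hα : 0 < α) (hαβ : α ≤ β) (hβ : β < 1)
    (hA : 0 < A) (hB : 0 < B) (hT : 0 < T)
    (γ : unitInterval → unitInterval) (hγ : Measurable γ) :
    (∀ π : RobinExclusion.MPath T, 0 ≤ RobinExclusion.rateFrom α A β B hT γ π) ∧
    (∀ (a b : NNReal) (hab : a + b = 1) (π ν : RobinExclusion.MPath T),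
      RobinExclusion.rateFrom α A β B hT γ (RobinExclusion.MPath.comb a b hab π ν) ≤
        ((a : ℝ) : EReal) * RobinExclusion.rateFrom α A β B hT γ π +
          ((b : ℝ) : EReal) * RobinExclusion.rateFrom α A β B hT γ ν) ∧
    LowerSemicontinuous (RobinExclusion.rateFrom α A β B hT γ) ∧
    (∀ q : ℝ, IsCompact
      {π : RobinExclusion.MPath T | RobinExclusion.rateFrom α A β B hT γ π ≤ (q : EReal)}) := by
  have hα' : α ∈ Icc (0 : ℝ) 1 := ⟨hα.le, (hαβ.trans_lt hβ).le⟩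
  have hβ' : β ∈ Icc (0 : ℝ) 1 := ⟨(hα.trans_le hαβ).le, hβ.le⟩
  exact ⟨RobinExclusion.rateFrom_nonneg α A β B hT γ,
    RobinExclusion.rateFrom_comb_le hα' hβ' hA hB hT γ,
    RobinExclusion.lowerSemicontinuous_rateFrom hα' hβ' hA hB hT hγ,
    RobinExclusion.isCompact_level hα' hβ' hA hB hT hγ⟩
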